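/- **Conventions.** Let $\mathsf C$ be a monoidal category with unit object $I$; the monoidal product is written as juxtaposition, and $m$, $u$ denote the multiplication and the unit of a monoid. All of the monoids below are monoids in $\mathsf C$. *Spans.* A *monoidal admissible class* $\mathcal S$ is a class of spans $X\xleftarrow{f}A\xrightarrow{g}Y$ in $\mathsf C$ such that: if $(f,g)\in\mathcal S$ then $(xf,yg)\in\mathcal S$ for all $x:X\to X'$, $y:Y\to Y'$, and $(fh,gh)\in\mathcal S$ for all $h:A'\to A$; every span with apex $I$ is in $\mathcal S$; if $(f,g),(f',g')\in\mathcal S$ then $(ff',gg')\in\mathcal S$ (monoidal products). The *$\mathcal S$-relative pullback* of a cospan $A\xrightarrow{f}B\xleftarrow{g}D$ is a span $(p_A,p_D):A\leftarrow A\Box_B D\to D$ in $\mathcal S$ with $fp_A=gp_D$ such that (i) for every span $(a,d):A\leftarrow T\to D$ in $\mathcal S$ with $fa=gd$ there is a unique $h:T\to A\Box_BD$ with $p_Ah=a$, $p_Dh=d$; (ii) if $(x,p_Ah),(x,p_Dh)\in\mathcal S$ then $(x,h)\in\mathcal S$, and if $(p_Ah,x),(p_Dh,x)\in\mathcal S$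 then $(h,x)\in\mathcal S$. If $f,g$ are monoid morphisms, $A\Box_BD$ carries the unique monoid structure making $p_A,p_D$ monoid morphisms. The legs of the cospan *are in $\mathcal S$* if the spans $A\xleftarrow{1}A\xrightarrow{f}B$ and $B\xleftarrow{g}D\xrightarrow{1}D$ belong to $\mathcal S$. For compatible morphisms, $h\Box k$ denotes the induced morphism between relative pullbacks. *Graphs.* A reflexive graph of monoids over $\mathcal S$ consists of monoid morphisms $s,t:A\to B$, $i:B\to A$ with $si=1=ti$ such that $A\xleftarrow{1}A\xrightarrow{s}B$ and $B\xleftarrow{t}A\xrightarrow{1}A$ are in $\mathcal S$. Its morphisms are pairs $(b:B\to B',a:A\to A')$ of monoid morphisms commuting with $s,t,i$. Put $A^{\Box 0}=B$, $A^{\Box 1}=A$ and let $A^{\Box n}$ be the iterated $\mathcal S$-relative pullback of $A\xrightarrow{s}B\xleftarrow{t}A$ ($n$ factors); $A\Box_BI$ is the relative pullback of $s$ and $u:I\to B$, with projections $p_A$, $p_I$. For $n>0$ put $$q_n:\ (A\Box_BI)A^{\Box n-1}\xrightarrow{p_A1}A\,A^{\Box n-1}\xrightarrow{(1\Box i\Box\cdots\Box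 i)(i\Box1)}A^{\Box n}A^{\Box n}\xrightarrow{m}A^{\Box n}.$$ *$\mathsf{CatMon}_{\mathcal S}(\mathsf C)$.* An object is a reflexive graph of monoids over $\mathcal S$ with a monoid morphism $d:A\Box_BA\to A$ such that $sd=sp_2$, $td=tp_1$, $d(1\Box i)=1=d(i\Box1)$, $d(d\Box1)=d(1\Box d)$, for which $A\Box_BI$ exists and all $q_n$, $n>0$, are invertible. Morphisms are the graph morphisms with $ad=d'(a\Box a)$. *$\mathsf{Xmod}_{\mathcal S}(\mathsf C)$.* An object is a tuple $(B,Y,e,k,x)$ of monoids $B,Y$, monoid morphisms $e:Y\to I$, $k:Y\to B$ and a distributive law $x:BY\to YB$ of monoids such that $(e1)x=1e$ and $m(k1)x=m(1k)$; the spans $Y\xleftarrow{1}Y\xrightarrow{e}I$, $B\xleftarrow{k}Y\xrightarrow{1}Y$ and $B\xleftarrow{1}B\xrightarrow{1}B$ are in $\mathcal S$; and $YB\xleftarrow{1u}Y\xrightarrow{e}I$ is the $\mathcal S$-relative pullback of $e1:YB\to B$ and $u:I\to B$. Moreover, for the reflexive graph on $A:=YB$ (with the multiplication twisted by $x$) with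 $s=e1$, $t=m(k1)$, $i=u1$ (so that $A\Box_BI=Y$, $p_A=1u$), all $q_n$, $n>0$, are invertible, and the composite $$AY\xrightarrow{1p_A}AA\xrightarrow{(i\Box1)(1\Box i)}(A\Box_BA)^2\xrightarrow{m}A\Box_BA\xrightarrow{q_2^{-1}}YA\xrightarrow{p_A1}AA\xrightarrow{m}A$$ is equal to $AY\xrightarrow{1p_A}AA\xrightarrow{m}A$. Morphisms are pairs $(b:B\to B',y:Y\to Y')$ of monoid morphisms with $e'y=e$, $k'y=bk$, $x'(by)=(yb)x$. *Simplicial monoids.* Let $S$ be a simplicial monoid in $\mathsf C$ with faces $\partial_i:S_n\to S_{n-1}$ and degeneracies $\sigma_i:S_{n-1}\to S_n$. Put $S_n^{(0)}=S_n$, $\partial_i^{(0)}=\partial_i$, $\sigma_i^{(0)}=\sigma_i$ and, for $0<k\le n$, let $S_n^{(k)}$ be the $\mathcal S$-relative pullback of $\partial_{n-k+1}^{(k-1)}:S_n^{(k-1)}\to S_{n-1}^{(k-1)}$ and $u:I\to S_{n-1}^{(k-1)}$, with projections $p$ to $S_n^{(k-1)}$ and $p_I$ to $I$; the morphisms $\partial_i^{(k)}:S_n^{(k)}\to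 S_{n-1}^{(k)}$ and $\sigma_j^{(k)}:S_{n-1}^{(k)}\to S_n^{(k)}$ ($0\le i\le n-k$, $0\le j\le n-1-k$) are induced by $\partial_i^{(k-1)}$ and $\sigma_j^{(k-1)}$. $S$ has *Moore length $1$* if all $S_n^{(k)}$ exist and, for all $n>1$, $u:I\to S_n^{(n)}$ and $p_I:S_n^{(n)}\to I$ are mutually inverse isomorphisms. For $0\le k<n$ put $$y_{(n,k)}:\ S_n^{(k+1)}S_{n-1}^{(k)}\xrightarrow{p\,\sigma_{n-1-k}^{(k)}}S_n^{(k)}S_n^{(k)}\xrightarrow{m}S_n^{(k)}.$$ **Theorem.** Let $\mathcal S$ be a monoidal admissible class of spans in a monoidal category $\mathsf C$ such that the $\mathcal S$-relative pullbacks of all cospans in $\mathsf C$ whose legs are in $\mathcal S$ exist. Then the categories $\mathsf{CatMon}_{\mathcal S}(\mathsf C)$ and $\mathsf{Xmod}_{\mathcal S}(\mathsf C)$ are equivalent to each other, and both are equivalent to the category $\mathsf{Simp}^1\mathsf{Mon}_{\mathcal S}(\mathsf C)$ whose objects are the simplicial monoids $S$ in $\mathsf C$ such that (a) $S$ has Moore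 length $1$; (b) the spans $S_1\xleftarrow{1}S_1\xrightarrow{\partial_1}S_0$ and $S_0\xleftarrow{\partial_0}S_1\xrightarrow{1}S_1$ belong to $\mathcal S$; (c) all $y_{(n,k)}$ for $0\le k<n$ are invertible, and so are, for all $n>0$, the morphisms $q_n:S_1^{(1)}S_1^{\Box n-1}\to S_1^{\Box n}$ of the reflexive graph $s=\partial_1$, $t=\partial_0:S_1\to S_0$, $i=\sigma_0:S_0\to S_1$; and whose morphisms are all the simplicial monoid morphisms. An equivalence between $\mathsf{CatMon}_{\mathcal S}(\mathsf C)$ and $\mathsf{Simp}^1\mathsf{Mon}_{\mathcal S}(\mathsf C)$ is given by the $\mathcal S$-relative nerve: it sends $(A,B,s,t,i,d)$ to the simplicial monoid with $n$-th member $A^{\Box n}$ and $$\sigma_k=1^{\Box n-k}\Box i\Box1^{\Box k}:A^{\Box n}\to A^{\Box n+1}\ (0\le k\le n);$$ on $A$ itself $\partial_0=t$ and $\partial_1=s$, and for $n>1$ the faces $A^{\Box n}\to A^{\Box n-1}$ are the projection $\partial_0=p_{1\dots n-1}$ (forgetting the last factor), $\partial_k=1^{\Box n-k-1}\Box d\Box1^{\Box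 k-1}$ for $0<k<n$, and the projection $\partial_n=p_{2\dots n}$ (forgetting the first factor). It sends a morphism $(b,a)$ to $b$ in degree $0$ and $a^{\Box n}$ in degrees $n>0$. Its inverse is given by truncation at the degrees $0$ and $1$: it sends $S$ to an $\mathcal S$-relative category on the reflexive graph $s=\partial_1$, $t=\partial_0:S_1\to S_0$, $i=\sigma_0$. -/

import Mathlib

open CategoryTheory MonoidalCategory

universe v u

namespace RelMon

section Spans

/-- A monoidal admissible class of spans `X ⟵ A ⟶ Y` in a monoidal category: it is closed under
post- and precomposition, it contains all spans with apex the monoidal unit, and it is closed under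
the monoidal product. -/
structure SpanClass (C : Type u) [Category.{v} C] [MonoidalCategory C] where
  /-- `mem f g` says that the span `X ⟵f— A —g⟶ Y` belongs to the class. -/
  mem : ∀ {X A Y : C}, (A ⟶ X) → (A ⟶ Y) → Prop
  post : ∀ {X A Y X' Y' : C} {f : A ⟶ X} {g : A ⟶ Y} (x : X ⟶ X') (y : Y ⟶ Y'),
    mem f g → mem (f ≫ x) (g ≫ y)
  pre : ∀ {X A Y A' : C} {f : A ⟶ X} {g : A ⟶ Y} (h : A' ⟶ A),
    mem f g → mem (h ≫ f) (h ≫ g)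
  unital : ∀ {X Y : C} (f : 𝟙_ C ⟶ X) (g : 𝟙_ C ⟶ Y), mem f g
  multiplicative : ∀ {X A Y X' A' Y' : C} {f : A ⟶ X} {g : A ⟶ Y} {f' : A' ⟶ X'} {g' : A' ⟶ Y'},
    mem f g → mem f' g' → mem (f ⊗ₘ f') (g ⊗ₘ g')

variable {C : Type u} [Category.{v} C] [MonoidalCategory C] (S : SpanClass C)

/-- The span `A ⟵p— P —q⟶ D` is the `S`-relative pullback of the cospan `A —f⟶ B ⟵g— D`. -/
structure IsRelPullback {A B D P : C} (f : A ⟶ B) (g : D ⟶ B) (p : P ⟶ A) (q : P ⟶ D) :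
    Prop where
  mem : S.mem p q
  w : p ≫ f = q ≫ g
  existsUnique : ∀ {T : C} (a : T ⟶ A) (d : T ⟶ D), S.mem a d → a ≫ f = d ≫ g →
    ∃! h : T ⟶ P, h ≫ p = a ∧ h ≫ q = d
  reflect_right : ∀ {X T : C} (x : T ⟶ X) (h : T ⟶ P),
    S.mem x (h ≫ p) → S.mem x (h ≫ q) → S.mem x h
  reflect_left : ∀ {X T : C} (h : T ⟶ P) (x : T ⟶ X),
    S.mem (h ≫ p) x → S.mem (h ≫ q) x → S.mem h x

/-- There exist the `S`-relative pullbacks of those cospans `A —f⟶ B ⟵g— D` in `C` whose legs are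
in `S`, that is, for which the spans `A ⟵1— A —f⟶ B` and `B ⟵g— D —1⟶ D` belong to `S`. -/
class HasLegPullbacks : Prop where
  exists_isRelPullback : ∀ {A B D : C} (f : A ⟶ B) (g : D ⟶ B),
    S.mem (𝟙 A) f → S.mem g (𝟙 D) → ∃ (P : C) (p : P ⟶ A) (q : P ⟶ D), IsRelPullback S f g p q

variable {S}

theorem IsRelPullback.hom_ext {A B D P T : C} {f : A ⟶ B} {g : D ⟶ B} {p : P ⟶ A} {q : P ⟶ D}
    (H : IsRelPullback S f g p q) {h k : T ⟶ P} (h₁ : h ≫ p = k ≫ p) (h₂ : h ≫ q = k ≫ q) :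
    h = k :=
  (H.existsUnique (k ≫ p) (k ≫ q) (S.pre k H.mem) (by simp [H.w])).unique ⟨h₁, h₂⟩ ⟨rfl, rfl⟩

theorem mul_comp_aux {P A : C} [MonObj A] (p : P ⟶ A) :
    (((p ⊗ₘ p) ≫ MonObj.mul) ⊗ₘ p) ≫ MonObj.mul =
      (α_ P P P).hom ≫ (p ⊗ₘ ((p ⊗ₘ p) ≫ MonObj.mul)) ≫ MonObj.mul := by
  have h₁ : ((p ⊗ₘ p) ≫ MonObj.mul) ⊗ₘ p = ((p ⊗ₘ p) ⊗ₘ p) ≫ (MonObj.mul (X := A) ▷ A) := by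
    rw [← tensorHom_id, tensorHom_comp_tensorHom, Category.comp_id]
  have h₂ : p ⊗ₘ ((p ⊗ₘ p) ≫ MonObj.mul) = (p ⊗ₘ (p ⊗ₘ p)) ≫ (A ◁ MonObj.mul (X := A)) := by
    rw [← id_tensorHom, tensorHom_comp_tensorHom, Category.comp_id]
  rw [h₁, h₂, Category.assoc, Category.assoc, MonObj.mul_assoc, ← associator_naturality_assoc]

/-- An `S`-relative pullback of monoid morphisms is a monoid along monoid morphisms. -/
theorem exists_mon_of_isRelPullback {A B D : Mon C} (f : A ⟶ B) (g : D ⟶ B) {P : C} {p : P ⟶ A.X}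
    {q : P ⟶ D.X} (H : IsRelPullback S f.hom g.hom p q) :
    ∃ (Q : Mon C) (p' : Q ⟶ A) (q' : Q ⟶ D), IsRelPullback S f.hom g.hom p'.hom q'.hom := by
  obtain ⟨o, ⟨ho₁, ho₂⟩, -⟩ := H.existsUnique MonObj.one MonObj.one
    (S.unital (MonObj.one (X := A.X)) (MonObj.one (X := D.X))) (by simp)
  obtain ⟨m, ⟨hm₁, hm₂⟩, -⟩ := H.existsUnique ((p ⊗ₘ p) ≫ MonObj.mul) ((q ⊗ₘ q) ≫ MonObj.mul)
    (S.post _ _ (S.multiplicative H.mem H.mem)) (by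
      simp only [Category.assoc, IsMonHom.mul_hom]
      rw [← Category.assoc, ← Category.assoc, tensorHom_comp_tensorHom, tensorHom_comp_tensorHom,
        H.w])
  let M : MonObj P :=
    { one := o
      mul := m
      one_mul := by
        apply H.hom_ext
        · rw [Category.assoc, hm₁, ← Category.assoc, ← tensorHom_id, tensorHom_comp_tensorHom, ho₁]
          simp
        · rw [Category.assoc, hm₂, ← Category.assoc, ← tensorHom_id, tensorHom_comp_tensorHom, ho₂]
          simp
      mul_one := by
        apply H.hom_ext
        · rw [Category.assoc, hm₁, ← Category.assoc, ← id_tensorHom, tensorHom_comp_tensorHom, ho₁]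
          simp
        · rw [Category.assoc, hm₂, ← Category.assoc, ← id_tensorHom, tensorHom_comp_tensorHom, ho₂]
          simp
      mul_assoc := by
        apply H.hom_ext
        · simp only [Category.assoc, hm₁]
          rw [← Category.assoc, ← Category.assoc (P ◁ m), ← tensorHom_id, ← id_tensorHom,
            tensorHom_comp_tensorHom, tensorHom_comp_tensorHom, hm₁]
          simpa using mul_comp_aux p
        · simp only [Category.assoc, hm₂]
          rw [← Category.assoc, ← Category.assoc (P ◁ m), ← tensorHom_id, ← id_tensorHom,
            tensorHom_comp_tensorHom, tensorHom_comp_tensorHom, hm₂]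
          simpa using mul_comp_aux q }
  exact ⟨⟨P⟩, Mon.Hom.mk' p ho₁ hm₁, Mon.Hom.mk' q ho₂ hm₂, H⟩

/-- Compatible monoid morphisms forming a span in `S` factor through the `S`-relative pullback
by a unique monoid morphism. -/
theorem IsRelPullback.existsUnique_mon {A B D P T : Mon C} {f : A ⟶ B} {g : D ⟶ B} {p : P ⟶ A}
    {q : P ⟶ D} (H : IsRelPullback S f.hom g.hom p.hom q.hom) (a : T ⟶ A) (d : T ⟶ D)
    (hm : S.mem a.hom d.hom) (w : a ≫ f = d ≫ g) : ∃! h : T ⟶ P, h ≫ p = a ∧ h ≫ q = d := by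
  obtain ⟨h, ⟨h₁, h₂⟩, hu⟩ := H.existsUnique a.hom d.hom hm (congrArg Mon.Hom.hom w)
  refine ⟨Mon.Hom.mk' h ?_ ?_, ⟨?_, ?_⟩, ?_⟩
  · apply H.hom_ext <;> simp [h₁, h₂]
  · apply H.hom_ext
    · rw [Category.assoc, h₁, Category.assoc, IsMonHom.mul_hom, IsMonHom.mul_hom, ← Category.assoc,
        tensorHom_comp_tensorHom, h₁]
    · rw [Category.assoc, h₂, Category.assoc, IsMonHom.mul_hom, IsMonHom.mul_hom, ← Category.assoc,
        tensorHom_comp_tensorHom, h₂]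
  · ext; exact h₁
  · ext; exact h₂
  · rintro k ⟨rfl, rfl⟩
    ext
    exact hu _ ⟨rfl, rfl⟩

end Spans

section Graphs

variable {C : Type u} [Category.{v} C] [MonoidalCategory C] (S : SpanClass C)

/-- A reflexive graph `s, t : A ⇉ B`, `i : B ⟶ A` of monoids for which the spans `A ⟵1— A —s⟶ B`
and `B ⟵t— A —1⟶ A` belong to `S`. -/
structure ReflGraph where
  A : Mon C
  B : Mon C
  s : A ⟶ B
  t : A ⟶ B
  i : B ⟶ A
  i_s : i ≫ s = 𝟙 B
  i_t : i ≫ t = 𝟙 B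
  mem_s : S.mem (𝟙 A.X) s.hom
  mem_t : S.mem t.hom (𝟙 A.X)

variable {S}

/-- Morphisms of reflexive graphs of monoids. -/
@[ext]
structure ReflGraph.Hom (G H : ReflGraph S) where
  a : G.A ⟶ H.A
  b : G.B ⟶ H.B
  s_comm : G.s ≫ b = a ≫ H.s
  t_comm : G.t ≫ b = a ≫ H.t
  i_comm : G.i ≫ a = b ≫ H.i

instance : Category (ReflGraph S) where
  Hom := ReflGraph.Hom
  id G := ⟨𝟙 _, 𝟙 _, by simp, by simp, by simp⟩
  comp f g := ⟨f.a ≫ g.a, f.b ≫ g.b,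
    by rw [← Category.assoc, f.s_comm, Category.assoc, g.s_comm, Category.assoc],
    by rw [← Category.assoc, f.t_comm, Category.assoc, g.t_comm, Category.assoc],
    by rw [← Category.assoc, f.i_comm, Category.assoc, g.i_comm, Category.assoc]⟩
  id_comp _ := ReflGraph.Hom.ext (Category.id_comp _) (Category.id_comp _)
  comp_id _ := ReflGraph.Hom.ext (Category.comp_id _) (Category.comp_id _)
  assoc _ _ _ := ReflGraph.Hom.ext (Category.assoc _ _ _) (Category.assoc _ _ _)

namespace ReflGraph

@[simp] theorem id_a (G : ReflGraph S) : (𝟙 G : ReflGraph.Hom G G).a = 𝟙 G.A := rfl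
@[simp] theorem id_b (G : ReflGraph S) : (𝟙 G : ReflGraph.Hom G G).b = 𝟙 G.B := rfl
@[simp] theorem comp_a {G H K : ReflGraph S} (f : G ⟶ H) (g : H ⟶ K) :
    (f ≫ g : ReflGraph.Hom G K).a = f.a ≫ g.a := rfl
@[simp] theorem comp_b {G H K : ReflGraph S} (f : G ⟶ H) (g : H ⟶ K) :
    (f ≫ g : ReflGraph.Hom G K).b = f.b ≫ g.b := rfl

variable (G : ReflGraph S)

theorem mem_id : S.mem (𝟙 G.B.X) (𝟙 G.B.X) := by
  have h' := S.post (𝟙 G.B.X) G.s.hom (S.pre G.i.hom G.mem_t)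
  have e₁ : G.i.hom ≫ G.s.hom = 𝟙 _ := congrArg Mon.Hom.hom G.i_s
  have e₂ : G.i.hom ≫ G.t.hom = 𝟙 _ := congrArg Mon.Hom.hom G.i_t
  simpa [e₁, e₂] using h'

/-- A monoid morphism `tgt : obj ⟶ B` for which the span `B ⟵tgt— obj —1⟶ obj` belongs to `S`. -/
structure Leg where
  obj : Mon C
  tgt : obj ⟶ G.B
  mem : S.mem tgt.hom (𝟙 obj.X)

variable [HasLegPullbacks S]

theorem exists_next (L : G.Leg) : ∃ (P : Mon C) (p : P ⟶ G.A) (q : P ⟶ L.obj),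
    IsRelPullback S G.s.hom L.tgt.hom p.hom q.hom := by
  obtain ⟨P, p, q, H⟩ := HasLegPullbacks.exists_isRelPullback G.s.hom L.tgt.hom G.mem_s L.mem
  exact exists_mon_of_isRelPullback G.s L.tgt H

/-- The `S`-relative pullback `A □_B L` of `s` and `tgt`, seen over `B` through the first projection
followed by `t`. -/
noncomputable def next (L : G.Leg) : G.Leg where
  obj := (G.exists_next L).choose
  tgt := (G.exists_next L).choose_spec.choose ≫ G.t
  mem := by
    have H := (G.exists_next L).choose_spec.choose_spec.choose_spec
    set P := (G.exists_next L).choose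
    set p := (G.exists_next L).choose_spec.choose
    set q := (G.exists_next L).choose_spec.choose_spec.choose
    apply H.reflect_right
    · simpa using S.pre p.hom G.mem_t
    · simpa using S.post G.t.hom (𝟙 _) H.mem

/-- `A^{□ (n+1)}`: the iterated `S`-relative pullback `A □_B A □_B ⋯ □_B A` with `n+1` factors,
formed along `s` on the left and `t` on the right. -/
noncomputable def powSucc : ℕ → G.Leg
  | 0 => ⟨G.A, G.t, G.mem_t⟩
  | n + 1 => G.next (powSucc n)

/-- `A^{□ n}`, where `A^{□ 0} = B`. -/
noncomputable def powLeg : ℕ → G.Leg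
  | 0 => ⟨G.B, 𝟙 G.B, G.mem_id⟩
  | n + 1 => G.powSucc n

/-- `A^{□ n}`; in particular `A^{□ 0} = B`, `A^{□ 1} = A` and `A^{□ 2} = A □_B A`. -/
noncomputable def pow (n : ℕ) : Mon C := (G.powLeg n).obj

/-- The morphism `A^{□ n} ⟶ B`: the first projection followed by `t` (the identity if `n = 0`). -/
noncomputable def tgt (n : ℕ) : G.pow n ⟶ G.B := (G.powLeg n).tgt

/-- The equality `B = A^{□ 0}`, as an identity morphism. -/
noncomputable def ofB : G.B ⟶ G.pow 0 := 𝟙 G.B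

/-- The equality `A = A^{□ 1}`, as an identity morphism. -/
noncomputable def ofA : G.A ⟶ G.pow 1 := 𝟙 G.A

/-- The first projection `p₁ : A^{□ (n+1)} ⟶ A`. -/
noncomputable def fst : (n : ℕ) → (G.pow (n + 1) ⟶ G.A)
  | 0 => 𝟙 G.A
  | n + 1 => (G.exists_next (G.powSucc n)).choose_spec.choose

/-- The projection `p_{2…n+1} : A^{□ (n+1)} ⟶ A^{□ n}` (it is `s` if `n = 0`). -/
noncomputable def rest : (n : ℕ) → (G.pow (n + 1) ⟶ G.pow n)
  | 0 => G.s
  | n + 1 => (G.exists_next (G.powSucc n)).choose_spec.choose_spec.choose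

theorem tgt_succ (n : ℕ) : G.tgt (n + 1) = G.fst n ≫ G.t := by
  cases n with
  | zero => exact (Category.id_comp G.t).symm
  | succ n => rfl

@[simp] theorem ofB_tgt : G.ofB ≫ G.tgt 0 = 𝟙 G.B := Category.comp_id (𝟙 G.B)

@[simp] theorem tgt_ofB : G.tgt 0 ≫ G.ofB = 𝟙 (G.pow 0) := Category.comp_id (𝟙 G.B)

@[simp] theorem ofA_fst : G.ofA ≫ G.fst 0 = 𝟙 G.A := Category.comp_id (𝟙 G.A)

@[simp] theorem fst_ofA : G.fst 0 ≫ G.ofA = 𝟙 (G.pow 1) := Category.comp_id (𝟙 G.A)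

theorem ofA_tgt : G.ofA ≫ G.tgt 1 = G.t := Category.id_comp G.t

theorem ofA_rest : G.ofA ≫ G.rest 0 ≫ G.tgt 0 = G.s :=
  (Category.id_comp _).trans (Category.comp_id G.s)

theorem mem_tgt (n : ℕ) : S.mem (G.tgt n).hom (𝟙 (G.pow n).X) := (G.powLeg n).mem

theorem isRelPullback (n : ℕ) :
    IsRelPullback S G.s.hom (G.tgt n).hom (G.fst n).hom (G.rest n).hom := by
  cases n with
  | zero =>
    refine ⟨G.mem_s, ?_, ?_, ?_, ?_⟩
    · change 𝟙 G.A.X ≫ G.s.hom = G.s.hom ≫ 𝟙 G.B.X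
      simp
    · intro T a d _ hw
      have hw' : a ≫ G.s.hom = d := by
        rw [hw]
        exact Category.comp_id d
      exact ⟨a, ⟨Category.comp_id a, hw'⟩, fun k hk => (Category.comp_id k).symm.trans hk.1⟩
    · intro X T x h h₁ _
      have e : h ≫ (G.fst 0).hom = h := Category.comp_id h
      rwa [e] at h₁
    · intro X T h x h₁ _
      have e : h ≫ (G.fst 0).hom = h := Category.comp_id h
      rwa [e] at h₁
  | succ n => exact (G.exists_next (G.powSucc n)).choose_spec.choose_spec.choose_spec

theorem fst_s (n : ℕ) : G.fst n ≫ G.s = G.rest n ≫ G.tgt n := by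
  ext; exact (G.isRelPullback n).w

variable {G} in
theorem pow_ext {n : ℕ} {T : Mon C} {h k : T ⟶ G.pow (n + 1)} (h₁ : h ≫ G.fst n = k ≫ G.fst n)
    (h₂ : h ≫ G.rest n = k ≫ G.rest n) : h = k := by
  ext
  exact (G.isRelPullback n).hom_ext (congrArg Mon.Hom.hom h₁) (congrArg Mon.Hom.hom h₂)

/-- The unique monoid morphism `T ⟶ A^{□ (n+1)}` with components `a : T ⟶ A` and
`r : T ⟶ A^{□ n}`. -/
noncomputable def lift {n : ℕ} {T : Mon C} (a : T ⟶ G.A) (r : T ⟶ G.pow n)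
    (hm : S.mem a.hom r.hom) (w : a ≫ G.s = r ≫ G.tgt n) : T ⟶ G.pow (n + 1) :=
  ((G.isRelPullback n).existsUnique_mon a r hm w).choose

section
variable {n : ℕ} {T : Mon C} (a : T ⟶ G.A) (r : T ⟶ G.pow n)
  (hm : S.mem a.hom r.hom) (w : a ≫ G.s = r ≫ G.tgt n)

@[simp] theorem lift_fst : G.lift a r hm w ≫ G.fst n = a :=
  ((G.isRelPullback n).existsUnique_mon a r hm w).choose_spec.1.1

@[simp] theorem lift_rest : G.lift a r hm w ≫ G.rest n = r :=
  ((G.isRelPullback n).existsUnique_mon a r hm w).choose_spec.1.2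

end

variable {G} in
/-- `1 □ h : A^{□ (m+1)} ⟶ A^{□ (n+1)}` for a morphism `h : A^{□ m} ⟶ A^{□ n}` over `B`. -/
noncomputable def oneBox {m n : ℕ} (h : G.pow m ⟶ G.pow n) (hh : h ≫ G.tgt n = G.tgt m) :
    G.pow (m + 1) ⟶ G.pow (n + 1) :=
  G.lift (G.fst m) (G.rest m ≫ h)
    (by simpa using S.post (𝟙 _) h.hom (G.isRelPullback m).mem)
    (by rw [Category.assoc, hh, fst_s])

theorem oneBox_tgt {m n : ℕ} (h : G.pow m ⟶ G.pow n) (hh : h ≫ G.tgt n = G.tgt m) :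
    oneBox h hh ≫ G.tgt (n + 1) = G.tgt (m + 1) := by
  rw [tgt_succ, tgt_succ, ← Category.assoc, oneBox, lift_fst]

/-- `i □ 1 : A^{□ n} ⟶ A^{□ (n+1)}` (it is `i : B ⟶ A` if `n = 0`). -/
noncomputable def insertFirst (n : ℕ) : G.pow n ⟶ G.pow (n + 1) :=
  G.lift (G.tgt n ≫ G.i) (𝟙 _)
    (by simpa using S.post G.i.hom (𝟙 _) (G.mem_tgt n))
    (by rw [Category.assoc, G.i_s, Category.comp_id, Category.id_comp])

theorem insertFirst_tgt (n : ℕ) : G.insertFirst n ≫ G.tgt (n + 1) = G.tgt n := by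
  rw [tgt_succ, ← Category.assoc, insertFirst, lift_fst, Category.assoc, G.i_t, Category.comp_id]

/-- `i □ ⋯ □ i : B ⟶ A^{□ n}` (the identity if `n = 0`). -/
noncomputable def diag : (n : ℕ) → (G.B ⟶ G.pow n)
  | 0 => G.ofB
  | n + 1 => diag n ≫ G.insertFirst n

theorem diag_tgt (n : ℕ) : G.diag n ≫ G.tgt n = 𝟙 G.B := by
  induction n with
  | zero => exact G.ofB_tgt
  | succ n ih => rw [diag, Category.assoc, insertFirst_tgt, ih]

/-- `1 □ i □ ⋯ □ i : A ⟶ A^{□ (n+1)}`. -/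
noncomputable def insertRest (n : ℕ) : G.A ⟶ G.pow (n + 1) :=
  G.lift (𝟙 G.A) (G.s ≫ G.diag n)
    (by simpa using S.post (𝟙 _) (G.diag n).hom G.mem_s)
    (by rw [Category.assoc, diag_tgt, Category.id_comp, Category.comp_id])

/-- For a morphism `p : Y ⟶ A` (meant to be the projection `A □_B I ⟶ A`), the morphism
`q_{n+1} : Y ⊗ A^{□ n} —p1⟶ A ⊗ A^{□ n} ⟶ A^{□ (n+1)} ⊗ A^{□ (n+1)} ⟶ A^{□ (n+1)}`
given by `(1 □ i □ ⋯ □ i) ⊗ (i □ 1)` and the multiplication. -/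
noncomputable def q {Y : C} (p : Y ⟶ G.A.X) (n : ℕ) : Y ⊗ (G.pow n).X ⟶ (G.pow (n + 1)).X :=
  (p ▷ (G.pow n).X) ≫ ((G.insertRest n).hom ⊗ₘ (G.insertFirst n).hom) ≫ MonObj.mul

variable {G} in
/-- `a^{□ n}` together with its compatibility with the morphisms to `B`. -/
noncomputable def powMapAux {H : ReflGraph S} (f : G ⟶ H) :
    (n : ℕ) → {h : G.pow n ⟶ H.pow n // h ≫ H.tgt n = G.tgt n ≫ f.b}
  | 0 => ⟨G.tgt 0 ≫ f.b ≫ H.ofB, by rw [Category.assoc, Category.assoc, ofB_tgt, Category.comp_id]⟩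
  | n + 1 => ⟨H.lift (G.fst n ≫ f.a) (G.rest n ≫ (powMapAux f n).1)
      (by simpa using S.post f.a.hom (powMapAux f n).1.hom (G.isRelPullback n).mem)
      (by rw [Category.assoc, ← f.s_comm, Category.assoc, (powMapAux f n).2, ← Category.assoc,
        fst_s, Category.assoc]),
      by rw [tgt_succ, tgt_succ, ← Category.assoc, lift_fst, Category.assoc, Category.assoc,
        f.t_comm]⟩

variable {G} in
/-- `a^{□ n} : A^{□ n} ⟶ A'^{□ n}` for a morphism `(b, a)` of reflexive graphs. -/
noncomputable def powMap {H : ReflGraph S} (f : G ⟶ H) (n : ℕ) : G.pow n ⟶ H.pow n :=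
  (powMapAux f n).1

section
variable {G}

@[simp] theorem powMap_zero {H : ReflGraph S} (f : G ⟶ H) : powMap f 0 = G.tgt 0 ≫ f.b ≫ H.ofB := rfl

@[simp] theorem powMap_fst {H : ReflGraph S} (f : G ⟶ H) (n : ℕ) :
    powMap f (n + 1) ≫ H.fst n = G.fst n ≫ f.a := by
  rw [powMap, powMapAux, lift_fst]

@[simp] theorem powMap_rest {H : ReflGraph S} (f : G ⟶ H) (n : ℕ) :
    powMap f (n + 1) ≫ H.rest n = G.rest n ≫ powMap f n := by
  rw [powMap, powMapAux, lift_rest, powMap]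

theorem powMap_id (n : ℕ) : powMap (𝟙 G) n = 𝟙 (G.pow n) := by
  induction n with
  | zero => rw [powMap_zero, id_b, Category.id_comp, tgt_ofB]
  | succ n ih =>
    apply pow_ext
    · rw [powMap_fst, id_a, Category.id_comp, Category.comp_id]
    · rw [powMap_rest, ih, Category.id_comp, Category.comp_id]

theorem powMap_comp {H K : ReflGraph S} (f : G ⟶ H) (g : H ⟶ K) (n : ℕ) :
    powMap (f ≫ g) n = powMap f n ≫ powMap g n := by
  induction n with
  | zero =>
    rw [powMap_zero, powMap_zero, powMap_zero, comp_b]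
    simp only [Category.assoc]
    rw [← Category.assoc H.ofB, ofB_tgt, Category.id_comp]
  | succ n ih =>
    apply pow_ext
    · rw [powMap_fst, Category.assoc, powMap_fst, ← Category.assoc, powMap_fst, comp_a,
        Category.assoc]
    · rw [powMap_rest, Category.assoc, powMap_rest, ← Category.assoc, powMap_rest, ih,
        Category.assoc]

end

end ReflGraph

section RelativeCategories

variable (S) [HasLegPullbacks S]

/-- A reflexive graph of monoids with a morphism `d : A □_B A ⟶ A` of the right source and
target. -/
structure CompGraph extends ReflGraph S where
  d : toReflGraph.pow 2 ⟶ A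
  d_s : d ≫ s = toReflGraph.rest 1 ≫ toReflGraph.fst 0 ≫ s
  d_t : d ≫ t = toReflGraph.fst 1 ≫ t

variable {S}

namespace CompGraph

variable (K : CompGraph S)

theorem d_over : (K.d ≫ K.ofA) ≫ K.tgt 1 = K.tgt 2 := by
  rw [Category.assoc, K.ofA_tgt, K.d_t, K.tgt_succ 1]

/-- The projection `p₁₂ : A^{□ (n+2)} ⟶ A □_B A`. -/
noncomputable def front (n : ℕ) : K.pow (n + 2) ⟶ K.pow 2 :=
  K.lift (n := 1) (K.fst (n + 1)) (K.rest (n + 1) ≫ K.fst n ≫ K.ofA)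
    (by simpa using S.post (𝟙 _) (K.fst n ≫ K.ofA).hom (K.isRelPullback (n + 1)).mem)
    (by rw [K.fst_s, K.tgt_succ n, Category.assoc, Category.assoc, K.ofA_tgt])

theorem front_fst (n : ℕ) : K.front n ≫ K.fst 1 = K.fst (n + 1) := K.lift_fst _ _ _ _

theorem front_rest (n : ℕ) : K.front n ≫ K.rest 1 = K.rest (n + 1) ≫ K.fst n ≫ K.ofA :=
  K.lift_rest _ _ _ _

theorem mem_front (n : ℕ) :
    S.mem (K.front n).hom (K.rest (n + 1) ≫ K.rest n).hom := by
  apply (K.isRelPullback 1).reflect_left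
  · rw [← Mon.comp_hom', front_fst]
    simpa using S.post (𝟙 _) (K.rest n).hom (K.isRelPullback (n + 1)).mem
  · rw [← Mon.comp_hom', front_rest]
    simpa using S.pre (K.rest (n + 1)).hom (S.post K.ofA.hom (𝟙 _) (K.isRelPullback n).mem)

/-- `d □ 1 : A^{□ (n+2)} ⟶ A^{□ (n+1)}`, composing the first two factors. -/
noncomputable def dBox (n : ℕ) : K.pow (n + 2) ⟶ K.pow (n + 1) :=
  K.lift (K.front n ≫ K.d) (K.rest (n + 1) ≫ K.rest n)
    (by simpa using S.post K.d.hom (𝟙 _) (K.mem_front n))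
    (by
      rw [Category.assoc, K.d_s, ← Category.assoc, front_rest]
      simp only [Category.assoc]
      rw [← Category.assoc K.ofA, K.ofA_fst, Category.id_comp, K.fst_s])

theorem dBox_tgt (n : ℕ) : K.dBox n ≫ K.tgt (n + 1) = K.tgt (n + 2) := by
  rw [K.tgt_succ n, K.tgt_succ (n + 1), ← Category.assoc, dBox, K.lift_fst, Category.assoc, K.d_t,
    ← Category.assoc, front_fst]

/-- The morphisms `∂_k : A^{□ (n+1)} ⟶ A^{□ n}` for `0 ≤ k ≤ n`, all of which are over `B`:
`t` if `n = 0`, and for `n > 0` the morphism `d □ 1` if `k = n` and `1 □ ∂_k` if `k < n`.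
Hence `∂_0 = p_{1…n} = 1 □ ⋯ □ 1 □ t` and `∂_k = 1 □ ⋯ □ 1 □ d □ 1 □ ⋯ □ 1` with `k - 1` identities on
the right if `0 < k ≤ n`. -/
noncomputable def faceAux :
    (n : ℕ) → Fin (n + 1) → {f : K.pow (n + 1) ⟶ K.pow n // f ≫ K.tgt n = K.tgt (n + 1)}
  | 0, _ => ⟨K.fst 0 ≫ K.t ≫ K.ofB, by
      rw [K.tgt_succ 0, Category.assoc, Category.assoc, K.ofB_tgt, Category.comp_id]⟩
  | n + 1, k => Fin.lastCases ⟨K.dBox n, K.dBox_tgt n⟩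
      (fun j => ⟨ReflGraph.oneBox (faceAux n j).1 (faceAux n j).2, K.oneBox_tgt _ _⟩) k

/-- The face morphisms `∂_k : A^{□ (n+1)} ⟶ A^{□ n}` of the nerve, for `0 ≤ k ≤ n+1`, with
`∂_{n+1} = p_{2…n+1} = s □ 1 □ ⋯ □ 1`. -/
noncomputable def face (n : ℕ) (k : Fin (n + 2)) : K.pow (n + 1) ⟶ K.pow n :=
  Fin.lastCases (K.rest n) (fun j => (K.faceAux n j).1) k

/-- The degeneracy morphisms of the nerve, together with their compatibility with the morphisms
to `B`. -/
noncomputable def degenAux :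
    (n : ℕ) → Fin (n + 1) → {f : K.pow n ⟶ K.pow (n + 1) // f ≫ K.tgt (n + 1) = K.tgt n}
  | 0, _ => ⟨K.insertFirst 0, K.insertFirst_tgt 0⟩
  | n + 1, k => Fin.lastCases ⟨K.insertFirst (n + 1), K.insertFirst_tgt (n + 1)⟩
      (fun j => ⟨ReflGraph.oneBox (degenAux n j).1 (degenAux n j).2, K.oneBox_tgt _ _⟩) k

/-- The degeneracy morphisms `σ_k = 1^{□ (n-k)} □ i □ 1^{□ k} : A^{□ n} ⟶ A^{□ (n+1)}` of the nerve,
for `0 ≤ k ≤ n`. -/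
noncomputable def degen (n : ℕ) (k : Fin (n + 1)) : K.pow n ⟶ K.pow (n + 1) :=
  (K.degenAux n k).1

open Simplicial in
/-- An identification of a simplicial monoid `N` with the `S`-relative nerve of `K`: isomorphisms of
monoids `N_n ≅ A^{□ n}` which are compatible with all face and degeneracy morphisms. -/
structure NerveIso (N : SimplicialObject (Mon C)) where
  iso (n : ℕ) : N _⦋n⦌ ≅ K.pow n
  δ_comm (n : ℕ) (k : Fin (n + 2)) : N.δ k ≫ (iso n).hom = (iso (n + 1)).hom ≫ K.face n k
  σ_comm (n : ℕ) (k : Fin (n + 1)) : N.σ k ≫ (iso (n + 1)).hom = (iso n).hom ≫ K.degen n k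

end CompGraph

variable (S) in
/-- An `S`-relative category in the category of monoids in `C`. The composition `d` is unital and
associative. -/
structure RelCat extends CompGraph S where
  one_box_i_d : toReflGraph.insertRest 1 ≫ d = 𝟙 A
  i_box_one_d : toReflGraph.ofA ≫ toReflGraph.insertFirst 1 ≫ d = 𝟙 A
  assoc : toCompGraph.dBox 1 ≫ d =
    ReflGraph.oneBox (d ≫ toReflGraph.ofA) toCompGraph.d_over ≫ d

/-- `S`-relative functors. -/
@[ext]
structure RelCat.Hom (K L : RelCat S) where
  graph : K.toReflGraph ⟶ L.toReflGraph
  d_comm : K.d ≫ graph.a = ReflGraph.powMap graph 2 ≫ L.d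

instance : Category (RelCat S) where
  Hom := RelCat.Hom
  id K := ⟨𝟙 _, by
    rw [ReflGraph.powMap_id, ReflGraph.id_a, Category.id_comp, Category.comp_id]⟩
  comp f g := ⟨f.graph ≫ g.graph, by
    rw [ReflGraph.powMap_comp, ReflGraph.comp_a, ← Category.assoc, f.d_comm, Category.assoc,
      g.d_comm, Category.assoc]⟩
  id_comp _ := RelCat.Hom.ext (Category.id_comp _)
  comp_id _ := RelCat.Hom.ext (Category.comp_id _)
  assoc _ _ _ := RelCat.Hom.ext (Category.assoc _ _ _)

variable (S) in
/-- The functor forgetting the composition of a relative category. -/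
def RelCat.forget : RelCat S ⥤ ReflGraph S where
  obj K := K.toReflGraph
  map f := f.graph

variable (S) in
/-- The relative categories for which all the morphisms
`q_n : (A □_B I) ⊗ A^{□ (n-1)} ⟶ A^{□ n}`, `n > 0`, are invertible. -/
def isCatMon : ObjectProperty (RelCat S) := fun K =>
  ∃ (Y : C) (p : Y ⟶ K.A.X) (pI : Y ⟶ 𝟙_ C),
    IsRelPullback S K.s.hom (MonObj.one (X := K.B.X)) p pI ∧ ∀ n, IsIso (K.q p n)

variable (S) in
/-- The category `CatMon_S(C)`. -/
abbrev CatMon := (isCatMon S).FullSubcategory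

end RelativeCategories

end Graphs

section Simplicial

/-- The sequence with first member `X` and further members `M 0, M 1, …`. -/
abbrev prepend {α : Type*} (X : α) (M : ℕ → α) : ℕ → α
  | 0 => X
  | k + 1 => M k

open Simplicial

variable {C : Type u} [Category.{v} C] [MonoidalCategory C] (S : SpanClass C)

/-- Passage from the monoids `X_m = S_{m+k}^{(k)}` to the monoids `Y_m = S_{m+k+1}^{(k+1)}`:
`Y_m` is the `S`-relative pullback of the last face morphism `X_{m+1} ⟶ X_m` and the unit
`I ⟶ X_m`, and the face and degeneracy morphisms of `Y` are the unique ones that are compatible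
with the projections. -/
structure MooreStep (X Y : SimplicialObject (Mon C)) where
  p (m : ℕ) : Y _⦋m⦌ ⟶ X _⦋m + 1⦌
  pI (m : ℕ) : (Y _⦋m⦌).X ⟶ 𝟙_ C
  isMonHom_pI (m : ℕ) : IsMonHom (pI m)
  isRelPullback (m : ℕ) : IsRelPullback S (X.δ (Fin.last (m + 1))).hom
    (MonObj.one (X := (X _⦋m⦌).X)) (p m).hom (pI m)
  δ_p (m : ℕ) (i : Fin (m + 2)) : Y.δ i ≫ p m = p (m + 1) ≫ X.δ i.castSucc
  δ_pI (m : ℕ) (i : Fin (m + 2)) : (Y.δ i).hom ≫ pI m = pI (m + 1)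
  σ_p (m : ℕ) (i : Fin (m + 1)) : Y.σ i ≫ p (m + 1) = p m ≫ X.σ i.castSucc
  σ_pI (m : ℕ) (i : Fin (m + 1)) : (Y.σ i).hom ≫ pI (m + 1) = pI m

variable {S} in
/-- For `X_m = S_{m+k}^{(k)}` and `Y_m = S_{m+k+1}^{(k+1)}`, the morphism
`y_{(m+k+1,k)} : S_{m+k+1}^{(k+1)} ⊗ S_{m+k}^{(k)} ⟶ S_{m+k+1}^{(k)}`. -/
def MooreStep.y {X Y : SimplicialObject (Mon C)} (Q : MooreStep S X Y) (m : ℕ) :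
    (Y _⦋m⦌).X ⊗ (X _⦋m⦌).X ⟶ (X _⦋m + 1⦌).X :=
  ((Q.p m).hom ⊗ₘ (X.σ (Fin.last m)).hom) ≫ MonObj.mul

/-- All the successive relative pullbacks `S_n^{(k)}` of a simplicial monoid `X`:
the monoid `S_{m+k}^{(k)}` is the `m`-th member of `prepend X M k`. -/
structure MooreTower (X : SimplicialObject (Mon C)) where
  M : ℕ → SimplicialObject (Mon C)
  step (k : ℕ) : MooreStep S (prepend X M k) (prepend X M (k + 1))

variable {S} in
/-- The unit `I ⟶ S_n^{(n)}` and `p_I : S_n^{(n)} ⟶ I` are mutually inverse for all `n > l`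
(here `n = k + 1`). -/
def MooreTower.HasLength {X : SimplicialObject (Mon C)} (T : MooreTower S X) (l : ℕ) : Prop :=
  ∀ k : ℕ, l < k + 1 →
    (T.step k).pI 0 ≫ MonObj.one = 𝟙 _ ∧ MonObj.one ≫ (T.step k).pI 0 = 𝟙 _

/-- The spans `X₁ ⟵1— X₁ —∂₁⟶ X₀` and `X₀ ⟵∂₀— X₁ —1⟶ X₁` belong to `S`. -/
structure LegsMem (X : SimplicialObject (Mon C)) : Prop where
  mem_s : S.mem (𝟙 (X _⦋1⦌).X) (X.δ (1 : Fin 2)).hom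
  mem_t : S.mem (X.δ (0 : Fin 2)).hom (𝟙 (X _⦋1⦌).X)

variable {S} in
/-- The truncation of a simplicial monoid at the degrees `0` and `1`, with `s = ∂₁`, `t = ∂₀` and
`i = σ₀`. -/
abbrev truncGraph (X : SimplicialObject (Mon C)) (h : LegsMem S X) : ReflGraph S where
  A := X _⦋1⦌
  B := X _⦋0⦌
  s := X.δ (1 : Fin 2)
  t := X.δ (0 : Fin 2)
  i := X.σ (0 : Fin 1)
  i_s := X.δ_comp_σ_succ (i := 0)
  i_t := X.δ_comp_σ_self (i := 0)
  mem_s := h.mem_s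
  mem_t := h.mem_t

variable [HasLegPullbacks S]

/-- The objects of `Simp¹Mon_S(C)`: simplicial monoids such that the legs `∂₁` and `∂₀` are in `S`,
which have Moore length 1, and for which all the morphisms `y_{(n,k)}` and
`q_n : S_1^{(1)} ⊗ S_1^{□ (n-1)} ⟶ S_1^{□ n}` are invertible. The successive relative pullbacks are
determined up to a unique isomorphism, so that it does not matter which ones are chosen. -/
structure IsSimpMon (X : SimplicialObject (Mon C)) : Prop where
  legs : LegsMem S X
  exists_tower : ∃ T : MooreTower S X, T.HasLength 1 ∧ (∀ k m, IsIso ((T.step k).y m)) ∧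
    ∀ n, IsIso ((truncGraph X legs).q ((T.step 0).p 0).hom n)

/-- The category `Simp¹Mon_S(C)`. -/
abbrev SimpMon := ObjectProperty.FullSubcategory
  (fun X : SimplicialObject (Mon C) => IsSimpMon S X)

/-- Truncation at the degrees `0` and `1`. -/
def SimpMon.trunc : SimpMon S ⥤ ReflGraph S where
  obj X := truncGraph X.obj X.property.legs
  map f :=
    { a := f.hom.app _
      b := f.hom.app _
      s_comm := f.hom.naturality _
      t_comm := f.hom.naturality _
      i_comm := f.hom.naturality _ }

end Simplicial

section CrossedModules

variable {C : Type u} [Category.{v} C] [MonoidalCategory C]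

/-- A distributive law `x : B ⊗ Y ⟶ Y ⊗ B` between monoids. -/
structure IsDistribLaw (B Y : Mon C) (x : B.X ⊗ Y.X ⟶ Y.X ⊗ B.X) : Prop where
  one_left : MonObj.one ▷ Y.X ≫ x = (λ_ Y.X).hom ≫ (ρ_ Y.X).inv ≫ Y.X ◁ MonObj.one
  one_right : B.X ◁ MonObj.one ≫ x = (ρ_ B.X).hom ≫ (λ_ B.X).inv ≫ MonObj.one ▷ B.X
  mul_left : MonObj.mul ▷ Y.X ≫ x = (α_ B.X B.X Y.X).hom ≫ B.X ◁ x ≫ (α_ B.X Y.X B.X).inv ≫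
    x ▷ B.X ≫ (α_ Y.X B.X B.X).hom ≫ Y.X ◁ MonObj.mul
  mul_right : B.X ◁ MonObj.mul ≫ x = (α_ B.X Y.X Y.X).inv ≫ x ▷ Y.X ≫ (α_ Y.X B.X Y.X).hom ≫
    Y.X ◁ x ≫ (α_ Y.X Y.X B.X).inv ≫ MonObj.mul ▷ B.X

/-- The multiplication `(m ⊗ m) ∘ (1 ⊗ x ⊗ 1)` on `Y ⊗ B` induced by `x : B ⊗ Y ⟶ Y ⊗ B`. -/
def twistedMul {Y B : C} (mY : Y ⊗ Y ⟶ Y) (mB : B ⊗ B ⟶ B) (x : B ⊗ Y ⟶ Y ⊗ B) :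
    (Y ⊗ B) ⊗ (Y ⊗ B) ⟶ Y ⊗ B :=
  (α_ Y B (Y ⊗ B)).hom ≫ Y ◁ ((α_ B Y B).inv ≫ x ▷ B ≫ (α_ Y B B).hom) ≫
    (α_ Y Y (B ⊗ B)).inv ≫ (mY ⊗ₘ mB)

theorem twistedMul_eq {Y B : C} (mY : Y ⊗ Y ⟶ Y) (mB : B ⊗ B ⟶ B) (x : B ⊗ Y ⟶ Y ⊗ B) :
    twistedMul mY mB x = 𝟙 _ ⊗≫ (Y ◁ x ▷ B) ⊗≫ mY ▷ (B ⊗ B) ⊗≫ Y ◁ mB := by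
  rw [twistedMul, MonoidalCategory.tensorHom_def]
  monoidal

theorem twistedMul_assoc {Y B : C} (mY : Y ⊗ Y ⟶ Y) (mB : B ⊗ B ⟶ B) (x : B ⊗ Y ⟶ Y ⊗ B)
    (aY : mY ▷ Y ≫ mY = (α_ Y Y Y).hom ≫ Y ◁ mY ≫ mY)
    (aB : mB ▷ B ≫ mB = (α_ B B B).hom ≫ B ◁ mB ≫ mB)
    (hl : mB ▷ Y ≫ x = (α_ B B Y).hom ≫ B ◁ x ≫ (α_ B Y B).inv ≫ x ▷ B ≫ (α_ Y B B).hom ≫ Y ◁ mB)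
    (hr : B ◁ mY ≫ x = (α_ B Y Y).inv ≫ x ▷ Y ≫ (α_ Y B Y).hom ≫ Y ◁ x ≫ (α_ Y Y B).inv ≫ mY ▷ B) :
    twistedMul mY mB x ▷ (Y ⊗ B) ≫ twistedMul mY mB x =
      (α_ _ _ _).hom ≫ (Y ⊗ B) ◁ twistedMul mY mB x ≫ twistedMul mY mB x := by
  rw [twistedMul_eq]
  calc
    _ = 𝟙 _ ⊗≫ Y ◁ x ▷ (B ⊗ Y ⊗ B) ⊗≫ (mY ▷ (((B ⊗ B) ⊗ Y) ⊗ B) ≫ Y ◁ ((mB ▷ Y ≫ x) ▷ B)) ⊗≫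
          mY ▷ (B ⊗ B) ⊗≫ Y ◁ mB := by monoidal
    _ = 𝟙 _ ⊗≫ Y ◁ x ▷ (B ⊗ Y ⊗ B) ⊗≫ (Y ⊗ Y) ◁ ((mB ▷ Y ≫ x) ▷ B) ⊗≫
          mY ▷ ((Y ⊗ B) ⊗ B) ⊗≫ mY ▷ (B ⊗ B) ⊗≫ Y ◁ mB := by
        rw [← whisker_exchange]; monoidal
    _ = 𝟙 _ ⊗≫ Y ◁ x ▷ (B ⊗ Y ⊗ B) ⊗≫ (Y ⊗ Y ⊗ B) ◁ x ▷ B ⊗≫ (Y ⊗ Y) ◁ x ▷ (B ⊗ B) ⊗≫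
          (((Y ⊗ Y) ⊗ Y) ◁ (mB ▷ B) ≫ (mY ▷ Y ≫ mY) ▷ (B ⊗ B)) ⊗≫ Y ◁ mB := by
        rw [hl]; monoidal
    _ = 𝟙 _ ⊗≫ Y ◁ (x ▷ (B ⊗ (Y ⊗ B)) ≫ (Y ⊗ B) ◁ (𝟙 _ ⊗≫ x ▷ B ⊗≫ 𝟙 (Y ⊗ B ⊗ B))) ⊗≫
          (Y ⊗ Y) ◁ x ▷ (B ⊗ B) ⊗≫
          (mY ▷ Y ≫ mY) ▷ ((B ⊗ B) ⊗ B) ⊗≫ Y ◁ (mB ▷ B ≫ mB) := by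
        rw [whisker_exchange]; monoidal
    _ = 𝟙 _ ⊗≫ (Y ⊗ B ⊗ Y) ◁ x ▷ B ⊗≫ Y ◁ x ▷ (Y ⊗ B ⊗ B) ⊗≫ (Y ⊗ Y) ◁ x ▷ (B ⊗ B) ⊗≫
          (Y ◁ mY ≫ mY) ▷ (B ⊗ B ⊗ B) ⊗≫ Y ◁ (B ◁ mB ≫ mB) := by
        rw [← whisker_exchange, aY, aB]; monoidal
    _ = 𝟙 _ ⊗≫ (Y ⊗ B ⊗ Y) ◁ x ▷ B ⊗≫ Y ◁ (B ◁ mY ≫ x) ▷ (B ⊗ B) ⊗≫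
          (mY ▷ (B ⊗ (B ⊗ B)) ≫ Y ◁ (B ◁ mB)) ⊗≫ Y ◁ mB := by
        rw [hr]; monoidal
    _ = 𝟙 _ ⊗≫ (Y ⊗ B ⊗ Y) ◁ x ▷ B ⊗≫ (Y ⊗ B) ◁ mY ▷ (B ⊗ B) ⊗≫
          ((Y ◁ x) ▷ (B ⊗ B) ≫ (Y ⊗ (Y ⊗ B)) ◁ mB) ⊗≫ mY ▷ (B ⊗ B) ⊗≫ Y ◁ mB := by
        rw [← whisker_exchange]; monoidal
    _ = _ := by
        rw [← whisker_exchange]; monoidal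

theorem twistedMul_one {Y B : C} (mY : Y ⊗ Y ⟶ Y) (mB : B ⊗ B ⟶ B) (x : B ⊗ Y ⟶ Y ⊗ B)
    (oY : 𝟙_ C ⟶ Y) (oB : 𝟙_ C ⟶ B)
    (uY : oY ▷ Y ≫ mY = (λ_ Y).hom) (uB : oB ▷ B ≫ mB = (λ_ B).hom)
    (h : oB ▷ Y ≫ x = (λ_ Y).hom ≫ (ρ_ Y).inv ≫ Y ◁ oB) :
    ((λ_ (𝟙_ C)).inv ≫ (oY ⊗ₘ oB)) ▷ (Y ⊗ B) ≫ twistedMul mY mB x = (λ_ (Y ⊗ B)).hom := by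
  rw [twistedMul_eq, MonoidalCategory.tensorHom_def]
  calc
    _ = 𝟙 _ ⊗≫ oY ▷ (𝟙_ C ⊗ Y ⊗ B) ⊗≫ Y ◁ (oB ▷ Y ≫ x) ▷ B ⊗≫ mY ▷ (B ⊗ B) ⊗≫ Y ◁ mB := by
        monoidal
    _ = 𝟙 _ ⊗≫ oY ▷ (Y ⊗ B) ⊗≫ ((Y ⊗ Y) ◁ (oB ▷ B) ≫ mY ▷ (B ⊗ B)) ⊗≫ Y ◁ mB := by
        rw [h]; monoidal
    _ = 𝟙 _ ⊗≫ (oY ▷ Y ≫ mY) ▷ B ⊗≫ Y ◁ (oB ▷ B ≫ mB) := by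
        rw [whisker_exchange]; monoidal
    _ = _ := by rw [uY, uB]; monoidal

theorem twistedMul_one' {Y B : C} (mY : Y ⊗ Y ⟶ Y) (mB : B ⊗ B ⟶ B) (x : B ⊗ Y ⟶ Y ⊗ B)
    (oY : 𝟙_ C ⟶ Y) (oB : 𝟙_ C ⟶ B)
    (uY : Y ◁ oY ≫ mY = (ρ_ Y).hom) (uB : B ◁ oB ≫ mB = (ρ_ B).hom)
    (h : B ◁ oY ≫ x = (ρ_ B).hom ≫ (λ_ B).inv ≫ oY ▷ B) :
    (Y ⊗ B) ◁ ((λ_ (𝟙_ C)).inv ≫ (oY ⊗ₘ oB)) ≫ twistedMul mY mB x = (ρ_ (Y ⊗ B)).hom := by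
  rw [twistedMul_eq, MonoidalCategory.tensorHom_def']
  calc
    _ = 𝟙 _ ⊗≫ (Y ⊗ B ⊗ 𝟙_ C) ◁ oB ⊗≫ Y ◁ (B ◁ oY ≫ x) ▷ B ⊗≫ mY ▷ (B ⊗ B) ⊗≫ Y ◁ mB := by
        monoidal
    _ = 𝟙 _ ⊗≫ (Y ⊗ B) ◁ oB ⊗≫ (Y ◁ oY) ▷ (B ⊗ B) ⊗≫ mY ▷ (B ⊗ B) ⊗≫ Y ◁ mB := by
        rw [h]; monoidal
    _ = 𝟙 _ ⊗≫ (Y ⊗ B) ◁ oB ⊗≫ (Y ◁ oY ≫ mY) ▷ (B ⊗ B) ⊗≫ Y ◁ mB := by monoidal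
    _ = 𝟙 _ ⊗≫ Y ◁ (B ◁ oB ≫ mB) := by rw [uY]; monoidal
    _ = _ := by rw [uB]; monoidal

theorem twistedMul_inr {Y B : C} (mY : Y ⊗ Y ⟶ Y) (mB : B ⊗ B ⟶ B) (x : B ⊗ Y ⟶ Y ⊗ B)
    (oY : 𝟙_ C ⟶ Y) (uY : Y ◁ oY ≫ mY = (ρ_ Y).hom)
    (h : B ◁ oY ≫ x = (ρ_ B).hom ≫ (λ_ B).inv ≫ oY ▷ B) :
    mB ≫ (λ_ B).inv ≫ oY ▷ B =
      (((λ_ B).inv ≫ oY ▷ B) ⊗ₘ ((λ_ B).inv ≫ oY ▷ B)) ≫ twistedMul mY mB x := by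
  rw [twistedMul_eq, MonoidalCategory.tensorHom_def]
  symm
  calc
    _ = 𝟙 _ ⊗≫ oY ▷ (B ⊗ B) ⊗≫ Y ◁ (B ◁ oY ≫ x) ▷ B ⊗≫ mY ▷ (B ⊗ B) ⊗≫ Y ◁ mB := by monoidal
    _ = 𝟙 _ ⊗≫ oY ▷ (B ⊗ B) ⊗≫ (Y ◁ oY ≫ mY) ▷ (B ⊗ B) ⊗≫ Y ◁ mB := by rw [h]; monoidal
    _ = 𝟙 _ ⊗≫ (oY ▷ (B ⊗ B) ≫ Y ◁ mB) := by rw [uY]; monoidal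
    _ = _ := by rw [← whisker_exchange]; monoidal

theorem twistedMul_hom {Y B D : C} (mY : Y ⊗ Y ⟶ Y) (mB : B ⊗ B ⟶ B) (x : B ⊗ Y ⟶ Y ⊗ B)
    (f : Y ⟶ D) (g : B ⟶ D) [MonObj D] (hf : mY ≫ f = (f ⊗ₘ f) ≫ MonObj.mul)
    (hg : mB ≫ g = (g ⊗ₘ g) ≫ MonObj.mul)
    (h : x ≫ (f ⊗ₘ g) ≫ MonObj.mul = (g ⊗ₘ f) ≫ MonObj.mul) :
    twistedMul mY mB x ≫ (f ⊗ₘ g) ≫ MonObj.mul =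
      (((f ⊗ₘ g) ≫ MonObj.mul) ⊗ₘ ((f ⊗ₘ g) ≫ MonObj.mul)) ≫ MonObj.mul := by
  have h1 : (mY ⊗ₘ mB) ≫ (f ⊗ₘ g) = ((f ⊗ₘ f) ⊗ₘ (g ⊗ₘ g)) ≫ (MonObj.mul ⊗ₘ MonObj.mul) := by
    rw [tensorHom_comp_tensorHom, tensorHom_comp_tensorHom, hf, hg]
  have e4 : ∀ (a b c d : C) (p : a ⟶ D) (q : b ⟶ D) (r : c ⟶ D) (s : d ⟶ D),
      (((p ⊗ₘ q) ≫ MonObj.mul) ⊗ₘ ((r ⊗ₘ s) ≫ MonObj.mul)) ≫ MonObj.mul =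
      (α_ a b (c ⊗ d)).hom ≫ (p ⊗ₘ ((α_ b c d).inv ≫ (((q ⊗ₘ r) ≫ MonObj.mul) ⊗ₘ s) ≫ MonObj.mul)) ≫ MonObj.mul := by
    intro a b c d p q r s
    simp only [mon_tauto]
  have h2 : x ▷ B ≫ (((f ⊗ₘ g) ≫ MonObj.mul) ⊗ₘ g) = (((g ⊗ₘ f) ≫ MonObj.mul) ⊗ₘ g) := by
    rw [← h, ← tensorHom_id, tensorHom_comp_tensorHom, Category.id_comp]
  rw [e4, twistedMul]
  simp only [Category.assoc]
  rw [← Category.assoc (mY ⊗ₘ mB), h1, Category.assoc, ← Category.assoc (_ ⊗ₘ _) (_ ⊗ₘ _),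
    tensorHom_comp_tensorHom, e4, Iso.inv_hom_id_assoc, ← Category.assoc (Y ◁ _),
    ← id_tensorHom, tensorHom_comp_tensorHom, Category.id_comp]
  simp only [Category.assoc, Iso.hom_inv_id_assoc]
  rw [← Category.assoc (x ▷ B), h2]

/-- The monoid `Y ⊗ B` induced by a distributive law. -/
abbrev twisted (B Y : Mon C) (x : B.X ⊗ Y.X ⟶ Y.X ⊗ B.X) (h : IsDistribLaw B Y x) : Mon C where
  X := Y.X ⊗ B.X
  mon :=
    { one := (λ_ (𝟙_ C)).inv ≫ (MonObj.one ⊗ₘ MonObj.one)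
      mul := twistedMul MonObj.mul MonObj.mul x
      one_mul := twistedMul_one _ _ x _ _ (MonObj.one_mul _) (MonObj.one_mul _) h.one_left
      mul_one := twistedMul_one' _ _ x _ _ (MonObj.mul_one _) (MonObj.mul_one _) h.one_right
      mul_assoc := twistedMul_assoc _ _ x (MonObj.mul_assoc _) (MonObj.mul_assoc _) h.mul_left
        h.mul_right }

/-- The monoid morphism `m ∘ (f ⊗ g) : Y ⊗ B ⟶ D`. -/
def twistedDesc {B Y D : Mon C} {x : B.X ⊗ Y.X ⟶ Y.X ⊗ B.X} (h : IsDistribLaw B Y x) (f : Y ⟶ D)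
    (g : B ⟶ D) (w : x ≫ (f.hom ⊗ₘ g.hom) ≫ MonObj.mul = (g.hom ⊗ₘ f.hom) ≫ MonObj.mul) :
    twisted B Y x h ⟶ D :=
  Mon.Hom.mk' ((f.hom ⊗ₘ g.hom) ≫ MonObj.mul)
    (by
      change ((λ_ (𝟙_ C)).inv ≫ (MonObj.one ⊗ₘ MonObj.one)) ≫ (f.hom ⊗ₘ g.hom) ≫ MonObj.mul = _
      rw [Category.assoc, ← Category.assoc (_ ⊗ₘ _), tensorHom_comp_tensorHom, IsMonHom.one_hom,
        IsMonHom.one_hom]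
      simp [← unitors_equal])
    (twistedMul_hom _ _ x f.hom g.hom (IsMonHom.mul_hom _) (IsMonHom.mul_hom _) w)

variable (S : SpanClass C)

/-- A relative precrossed module `(B, Y, e, k, x)`. The conditions on it correspond to those on the
reflexive graph of monoids `Y ⊗ B ⇉ B` with `s = e ⊗ 1`, `t = m ∘ (k ⊗ 1)`, whose fibre `(Y ⊗ B) □_B I` is `Y`. -/
structure PreXMod where
  B : Mon C
  Y : Mon C
  e : Y.X ⟶ 𝟙_ C
  isMonHom_e : IsMonHom e
  k : Y ⟶ B
  x : B.X ⊗ Y.X ⟶ Y.X ⊗ B.X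
  distrib : IsDistribLaw B Y x
  x_e : x ≫ (e ▷ B.X) ≫ (λ_ B.X).hom = (B.X ◁ e) ≫ (ρ_ B.X).hom
  x_k : x ≫ (k.hom ▷ B.X) ≫ MonObj.mul = (B.X ◁ k.hom) ≫ MonObj.mul
  mem_e : S.mem (𝟙 Y.X) e
  mem_k : S.mem k.hom (𝟙 Y.X)
  mem_B : S.mem (𝟙 B.X) (𝟙 B.X)
  isRelPullback : IsRelPullback S ((e ▷ B.X) ≫ (λ_ B.X).hom) (MonObj.one (X := B.X))
    ((ρ_ Y.X).inv ≫ Y.X ◁ MonObj.one (X := B.X)) e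

variable {S}

namespace PreXMod

/-- Morphisms `(b, y)` compatible with `e`, `k` and `x`. -/
@[ext]
structure Hom (P Q : PreXMod S) where
  b : P.B ⟶ Q.B
  y : P.Y ⟶ Q.Y
  e_comm : y.hom ≫ Q.e = P.e
  k_comm : P.k ≫ b = y ≫ Q.k
  x_comm : P.x ≫ (y.hom ⊗ₘ b.hom) = (b.hom ⊗ₘ y.hom) ≫ Q.x

instance : Category (PreXMod S) where
  Hom := PreXMod.Hom
  id P := ⟨𝟙 _, 𝟙 _, by simp, by simp, by simp⟩
  comp f g := ⟨f.b ≫ g.b, f.y ≫ g.y, by rw [Mon.comp_hom', Category.assoc, g.e_comm, f.e_comm],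
    by rw [← Category.assoc, f.k_comm, Category.assoc, g.k_comm, Category.assoc], by
      rw [Mon.comp_hom', Mon.comp_hom', ← tensorHom_comp_tensorHom, ← Category.assoc, f.x_comm,
        Category.assoc, g.x_comm, ← Category.assoc, tensorHom_comp_tensorHom]⟩
  id_comp _ := PreXMod.Hom.ext (Category.id_comp _) (Category.id_comp _)
  comp_id _ := PreXMod.Hom.ext (Category.comp_id _) (Category.comp_id _)
  assoc _ _ _ := PreXMod.Hom.ext (Category.assoc _ _ _) (Category.assoc _ _ _)

variable (P : PreXMod S)

/-- The monoid `Y ⊗ B` with the multiplication twisted by `x`. -/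
abbrev A : Mon C := twisted P.B P.Y P.x P.distrib

/-- The morphism `1 ⊗ u : Y ⟶ Y ⊗ B`. -/
def inl : P.Y.X ⟶ P.A.X := (ρ_ P.Y.X).inv ≫ P.Y.X ◁ MonObj.one (X := P.B.X)

theorem s_aux : ((P.e ≫ MonObj.one) ⊗ₘ 𝟙 P.B.X) ≫ MonObj.mul =
    (P.e ▷ P.B.X) ≫ (λ_ P.B.X).hom := by
  rw [tensorHom_id, comp_whiskerRight, Category.assoc]
  rw [MonObj.one_mul]

theorem s_aux' : (𝟙 P.B.X ⊗ₘ (P.e ≫ MonObj.one)) ≫ MonObj.mul =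
    (P.B.X ◁ P.e) ≫ (ρ_ P.B.X).hom := by
  rw [id_tensorHom, whiskerLeft_comp, Category.assoc]
  rw [MonObj.mul_one]

/-- `s = e ⊗ 1`. -/
def s : P.A ⟶ P.B :=
  Mon.Hom.mk (M := P.A) ((P.e ▷ P.B.X) ≫ (λ_ P.B.X).hom)
    (isMonHom_hom := by
      have he := P.isMonHom_e
      let e' : P.Y ⟶ P.B := Mon.Hom.mk' (P.e ≫ MonObj.one)
        (by rw [← Category.assoc, he.one_hom]; exact Category.id_comp _)
        (by
          have h₁ : MonObj.mul ≫ P.e = (P.e ⊗ₘ P.e) ≫ (λ_ (𝟙_ C)).hom := he.mul_hom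
          rw [← Category.assoc, h₁, ← tensorHom_comp_tensorHom, Category.assoc, Category.assoc,
            MonObj.one_mul_hom])
      have w : P.x ≫ (e'.hom ⊗ₘ (𝟙 P.B : P.B ⟶ P.B).hom) ≫ MonObj.mul =
          ((𝟙 P.B : P.B ⟶ P.B).hom ⊗ₘ e'.hom) ≫ MonObj.mul :=
        (congrArg (P.x ≫ ·) P.s_aux).trans (P.x_e.trans P.s_aux'.symm)
      have h := (twistedDesc P.distrib e' (𝟙 P.B) w).isMonHom_hom
      have e : (twistedDesc P.distrib e' (𝟙 P.B) w).hom = (P.e ▷ P.B.X) ≫ (λ_ P.B.X).hom :=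
        P.s_aux
      rw [e] at h
      exact h)

/-- `t = m ∘ (k ⊗ 1)`. -/
def t : P.A ⟶ P.B := twistedDesc P.distrib P.k (𝟙 P.B) (by simpa using P.x_k)

/-- `i = u ⊗ 1`. -/
def i : P.B ⟶ P.A :=
  Mon.Hom.mk' (N := P.A) ((λ_ P.B.X).inv ≫ MonObj.one ▷ P.B.X)
    (by
      change _ = (λ_ (𝟙_ C)).inv ≫ (MonObj.one ⊗ₘ MonObj.one)
      rw [MonoidalCategory.tensorHom_def', leftUnitor_inv_naturality_assoc])
    (twistedMul_inr _ _ P.x _ (MonObj.mul_one _) P.distrib.one_right)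

/-- The reflexive graph of monoids `Y ⊗ B ⇉ B`. -/
abbrev graph : ReflGraph S where
  A := P.A
  B := P.B
  s := P.s
  t := P.t
  i := P.i
  i_s := by
    ext
    have h : MonObj.one ≫ P.e = 𝟙 (𝟙_ C) := P.isMonHom_e.one_hom
    change ((λ_ P.B.X).inv ≫ MonObj.one ▷ P.B.X) ≫ (P.e ▷ P.B.X) ≫ (λ_ P.B.X).hom = 𝟙 _
    rw [Category.assoc, ← comp_whiskerRight_assoc, h]
    simp
  i_t := by
    ext
    change ((λ_ P.B.X).inv ≫ MonObj.one ▷ P.B.X) ≫ (P.k.hom ⊗ₘ 𝟙 _) ≫ MonObj.mul = 𝟙 _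
    rw [tensorHom_id, Category.assoc, ← comp_whiskerRight_assoc, IsMonHom.one_hom]
    simp
  mem_s := by
    have h := S.post (𝟙 _) (λ_ P.B.X).hom (S.multiplicative P.mem_e P.mem_B)
    rw [id_tensorHom_id, Category.comp_id, tensorHom_id] at h
    exact h
  mem_t := by
    have h := S.post (MonObj.mul (X := P.B.X)) (𝟙 _) (S.multiplicative P.mem_k P.mem_B)
    rw [id_tensorHom_id, Category.comp_id] at h
    exact h

end PreXMod

section XMod

variable [HasLegPullbacks S]

/-- The condition on `p : Y ⟶ A` that the diagram

`A ⊗ Y —(i □ 1) ⊗ (1 □ i)p⟶ (A □_B A) ⊗ (A □_B A) —m⟶ A □_B A —q₂⁻¹⟶ Y ⊗ A —p1⟶ A ⊗ A —m⟶ A`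

is equal to `A ⊗ Y —1p⟶ A ⊗ A —m⟶ A`. (Here `z` is the composite `q₂⁻¹ m ((i □ 1) ⊗ (1 □ i)p)`,
which exists and is unique when `q₂` is invertible.) -/
def ReflGraph.Peiffer (G : ReflGraph S) {Y : C} (p : Y ⟶ G.A.X) : Prop :=
  ∃ z : G.A.X ⊗ Y ⟶ Y ⊗ G.A.X,
    z ≫ (Y ◁ G.ofA.hom) ≫ G.q p 1 =
      ((G.ofA ≫ G.insertFirst 1).hom ⊗ₘ (p ≫ (G.insertRest 1).hom)) ≫ MonObj.mul ∧
    z ≫ (p ▷ G.A.X) ≫ MonObj.mul = (G.A.X ◁ p) ≫ MonObj.mul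

/-- The relative crossed modules of monoids: the precrossed modules for which all the morphisms
`q_n : Y ⊗ (Y ⊗ B)^{□ (n-1)} ⟶ (Y ⊗ B)^{□ n}` are invertible and the Peiffer condition holds. -/
structure IsXMod (P : PreXMod S) : Prop where
  isIso_q : ∀ n, IsIso (P.graph.q P.inl n)
  peiffer : P.graph.Peiffer P.inl

variable (S) in
/-- The category `Xmod_S(C)`. -/
abbrev XMod := ObjectProperty.FullSubcategory (fun P : PreXMod S => IsXMod P)

end XMod

end CrossedModules

end RelMon

open RelMon

/-! Invertibility of `q_n` says that `A^{□ n}` is built, as a monoid, from two pieces: the kernel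
`Y` of `s`, embedded through `1 □ i □ ⋯ □ i`, and `A^{□ (n-1)}`, embedded through `i □ 1`. Hence a
monoid morphism out of `A^{□ n}` is determined by its restrictions to these pieces
(`hom_ext_of_isIso_q`). For `n = 2` the unit laws prescribe both restrictions of a composition `d`.
So `d` is unique, and its source, its target, its associativity and its preservation by graph
morphisms can be checked on the pieces. Thus being a relative category is a mere property of a
reflexive graph, and `CatMon` is a full subcategory of reflexive graphs.

A morphism with prescribed restrictions exists as soon as they obey the commutation law of the two
pieces (`exists_mon_hom_of_isIso`). For `d` this is the Peiffer condition (`peiffer_iff`). For `n =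
1` invertibility says `A ≅ Y ⊗ B`, so that the multiplication of `A` amounts to a distributive law
between `B` and `Y`; precrossed modules therefore also embed fully faithfully into reflexive graphs
(`exists_graphMap_eq`), and `exists_preXMod` identifies the graphs that occur. Crossed modules and
relative categories end up as the same full subcategory.

For the nerve, `A^{□ n}` is seen as the object of chains of `n` arrows. The composites `edge n i j`
of consecutive arrows are jointly monic (`pow_ext_edge`), and faces and degeneracies act on them by
relabelling vertices. So each map of the simplex category induces exactly one morphism, and
functoriality follows from uniqueness. The kernel of every last face is `Y`, with identities as the
remaining faces; the Moore tower is therefore `Y, I, I, …`, and the first row of the `y_{(n,k)}`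
consists of the `q_n`.

Conversely, if the Moore length is `1` and the `y_{(n,k)}` are invertible, then `S_n^{(k)}` is
trivial for `k ≥ 2`, whence `X_{n+1} ≅ Y ⊗ X_n`. Comparing this with `q_{n+1}` shows by induction
that `X_n ⟶ X_1^{□ n}` is invertible (`isIso_segal`). The face `∂_1` on `X_2` becomes the
composition, and the comparison is simplicial because it matches edges (`toNerve_edge`). -/

namespace RelMon

/-! ### Products of morphisms into a monoid, and uniqueness of relative pullbacks -/

section MonoidLemmas

variable {C : Type u} [Category.{v} C] [MonoidalCategory C]

theorem tensor_mul_comp {X Y M N : C} [MonObj M] [MonObj N] (f : X ⟶ M) (g : Y ⟶ M) (h : M ⟶ N)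
    [IsMonHom h] :
    (f ⊗ₘ g) ≫ MonObj.mul ≫ h = ((f ≫ h) ⊗ₘ (g ≫ h)) ≫ MonObj.mul := by
  rw [IsMonHom.mul_hom, tensorHom_comp_tensorHom_assoc]

theorem tensor_mul_assoc {X Y Z M : C} [MonObj M] (f : X ⟶ M) (g : Y ⟶ M) (h : Z ⟶ M) :
    (((f ⊗ₘ g) ≫ MonObj.mul) ⊗ₘ h) ≫ MonObj.mul =
      (α_ X Y Z).hom ≫ (f ⊗ₘ ((g ⊗ₘ h) ≫ MonObj.mul)) ≫ MonObj.mul := by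
  simp only [mon_tauto]

/-- If monoid morphisms `p` and `i` generate a monoid in the sense that `m ∘ (p ⊗ i)` is an
epimorphism, then monoid morphisms out of it are determined by their restrictions. -/
theorem mon_hom_ext_of_epi {M N : Mon C} {X Y : C} {p : X ⟶ M.X} {i : Y ⟶ M.X}
    (_ : Epi ((p ⊗ₘ i) ≫ MonObj.mul)) {f g : M ⟶ N} (h₁ : p ≫ f.hom = p ≫ g.hom)
    (h₂ : i ≫ f.hom = i ≫ g.hom) : f = g := by
  ext
  rw [← cancel_epi ((p ⊗ₘ i) ≫ MonObj.mul), Category.assoc, Category.assoc, tensor_mul_comp,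
    tensor_mul_comp, h₁, h₂]

/-- The unit of a monoid as a monoid morphism. -/
def unitHom (M : Mon C) : Mon.trivial C ⟶ M :=
  Mon.Hom.mk' (M := Mon.trivial C) MonObj.one (Category.id_comp _)
    (MonObj.one_mul_hom (M := M.X) MonObj.one).symm

end MonoidLemmas

variable {C : Type u} [Category.{v} C] [MonoidalCategory C] {S : SpanClass C}

section Pullbacks

/-- Relative pullbacks of the same cospan are isomorphic. -/
theorem IsRelPullback.exists_iso {A B D P Q : C} {f : A ⟶ B} {g : D ⟶ B} {p : P ⟶ A} {q : P ⟶ D}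
    {p' : Q ⟶ A} {q' : Q ⟶ D} (H : IsRelPullback S f g p q) (H' : IsRelPullback S f g p' q') :
    ∃ e : P ≅ Q, e.hom ≫ p' = p ∧ e.hom ≫ q' = q := by
  obtain ⟨a, ⟨h₁, h₂⟩, -⟩ := H'.existsUnique p q H.mem H.w
  obtain ⟨b, ⟨h₃, h₄⟩, -⟩ := H.existsUnique p' q' H'.mem H'.w
  exact ⟨⟨a, b, H.hom_ext (by simp [h₁, h₃]) (by simp [h₂, h₄]),
    H'.hom_ext (by simp [h₁, h₃]) (by simp [h₂, h₄])⟩, h₁, h₂⟩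

end Pullbacks

/-! ### Calculus of the powers `A^{□ n}` and of the morphisms `q_n` -/

namespace ReflGraph

variable (G : ReflGraph S)

@[simp]
theorem i_s_assoc {Z : Mon C} (z : _ ⟶ Z) : G.i ≫ G.s ≫ z = z := by
  simpa only [Category.assoc, Category.id_comp] using G.i_s =≫ z

variable [HasLegPullbacks S]

@[simp]
theorem insertRest_fst (n : ℕ) : G.insertRest n ≫ G.fst n = 𝟙 G.A := G.lift_fst _ _ _ _

@[simp]
theorem insertRest_fst_assoc (n : ℕ) {Z : Mon C} (z : _ ⟶ Z) :
    G.insertRest n ≫ G.fst n ≫ z = z := by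
  simpa only [Category.assoc, Category.id_comp] using G.insertRest_fst n =≫ z

@[simp]
theorem insertRest_rest (n : ℕ) : G.insertRest n ≫ G.rest n = G.s ≫ G.diag n := G.lift_rest _ _ _ _

@[simp]
theorem insertRest_rest_assoc (n : ℕ) {Z : Mon C} (z : _ ⟶ Z) :
    G.insertRest n ≫ G.rest n ≫ z = G.s ≫ G.diag n ≫ z := by
  simpa only [Category.assoc, Category.id_comp] using G.insertRest_rest n =≫ z

@[simp]
theorem insertFirst_fst (n : ℕ) : G.insertFirst n ≫ G.fst n = G.tgt n ≫ G.i := G.lift_fst _ _ _ _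

@[simp]
theorem insertFirst_fst_assoc (n : ℕ) {Z : Mon C} (z : _ ⟶ Z) :
    G.insertFirst n ≫ G.fst n ≫ z = G.tgt n ≫ G.i ≫ z := by
  simpa only [Category.assoc, Category.id_comp] using G.insertFirst_fst n =≫ z

@[simp]
theorem insertFirst_rest (n : ℕ) : G.insertFirst n ≫ G.rest n = 𝟙 _ := G.lift_rest _ _ _ _

@[simp]
theorem insertFirst_rest_assoc (n : ℕ) {Z : Mon C} (z : _ ⟶ Z) :
    G.insertFirst n ≫ G.rest n ≫ z = z := by
  simpa only [Category.assoc, Category.id_comp] using G.insertFirst_rest n =≫ z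

attribute [simp] i_s i_t diag_tgt insertFirst_tgt

@[simp]
theorem diag_tgt_assoc (n : ℕ) {Z : Mon C} (z : _ ⟶ Z) : G.diag n ≫ G.tgt n ≫ z = z := by
  simpa only [Category.assoc, Category.id_comp] using G.diag_tgt n =≫ z

@[simp]
theorem insertFirst_tgt_assoc (n : ℕ) {Z : Mon C} (z : _ ⟶ Z) :
    G.insertFirst n ≫ G.tgt (n + 1) ≫ z = G.tgt n ≫ z := by
  simpa only [Category.assoc, Category.id_comp] using G.insertFirst_tgt n =≫ z

theorem ofA_tgt_assoc {Z : Mon C} (z : _ ⟶ Z) : G.ofA ≫ G.tgt 1 ≫ z = G.t ≫ z := by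
  simpa only [Category.assoc, Category.id_comp] using G.ofA_tgt =≫ z

theorem fst_s_assoc (n : ℕ) {Z : Mon C} (z : _ ⟶ Z) :
    G.fst n ≫ G.s ≫ z = G.rest n ≫ G.tgt n ≫ z := by
  simpa only [Category.assoc, Category.id_comp] using G.fst_s n =≫ z

@[simp]
theorem ofB_tgt_assoc {Z : Mon C} (z : _ ⟶ Z) : G.ofB ≫ G.tgt 0 ≫ z = z := by
  simpa only [Category.assoc, Category.id_comp] using G.ofB_tgt =≫ z

@[simp]
theorem ofA_fst_assoc {Z : Mon C} (z : _ ⟶ Z) : G.ofA ≫ G.fst 0 ≫ z = z := by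
  simpa only [Category.assoc, Category.id_comp] using G.ofA_fst =≫ z

@[simp]
theorem fst_ofA_assoc {Z : Mon C} (z : _ ⟶ Z) : G.fst 0 ≫ G.ofA ≫ z = z := by
  simpa only [Category.assoc, Category.id_comp] using G.fst_ofA =≫ z

variable {G} in
@[simp]
theorem oneBox_fst {m n : ℕ} (h : G.pow m ⟶ G.pow n) (hh : h ≫ G.tgt n = G.tgt m) :
    oneBox h hh ≫ G.fst n = G.fst m := G.lift_fst _ _ _ _

variable {G} in
@[simp]
theorem oneBox_fst_assoc {m n : ℕ} (h : G.pow m ⟶ G.pow n) (hh : h ≫ G.tgt n = G.tgt m)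
    {Z : Mon C} (z : _ ⟶ Z) :
    oneBox h hh ≫ G.fst n ≫ z = G.fst m ≫ z := by
  simpa only [Category.assoc, Category.id_comp] using oneBox_fst h hh =≫ z

variable {G} in
@[simp]
theorem oneBox_rest {m n : ℕ} (h : G.pow m ⟶ G.pow n) (hh : h ≫ G.tgt n = G.tgt m) :
    oneBox h hh ≫ G.rest n = G.rest m ≫ h := G.lift_rest _ _ _ _

variable {G} in
@[simp]
theorem oneBox_rest_assoc {m n : ℕ} (h : G.pow m ⟶ G.pow n) (hh : h ≫ G.tgt n = G.tgt m)
    {Z : Mon C} (z : _ ⟶ Z) :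
    oneBox h hh ≫ G.rest n ≫ z = G.rest m ≫ h ≫ z := by
  simpa only [Category.assoc, Category.id_comp] using oneBox_rest h hh =≫ z

variable {G} in
theorem oneBox_comp {l m n : ℕ} (h : G.pow l ⟶ G.pow m) (hh : h ≫ G.tgt m = G.tgt l)
    (k : G.pow m ⟶ G.pow n) (hk : k ≫ G.tgt n = G.tgt m) :
    oneBox h hh ≫ oneBox k hk = oneBox (h ≫ k) (by rw [Category.assoc, hk, hh]) := by
  apply pow_ext <;> simp

variable {G} in
theorem oneBox_comp_assoc {l m n : ℕ} (h : G.pow l ⟶ G.pow m) (hh : h ≫ G.tgt m = G.tgt l)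
    (k : G.pow m ⟶ G.pow n) (hk : k ≫ G.tgt n = G.tgt m) {Z : Mon C} (z : _ ⟶ Z) :
    oneBox h hh ≫ oneBox k hk ≫ z = oneBox (h ≫ k) (by rw [Category.assoc, hk, hh]) ≫ z := by
  simpa only [Category.assoc, Category.id_comp] using oneBox_comp h hh k hk =≫ z

variable {G} in
theorem insertFirst_oneBox {m n : ℕ} (h : G.pow m ⟶ G.pow n) (hh : h ≫ G.tgt n = G.tgt m) :
    G.insertFirst m ≫ oneBox h hh = h ≫ G.insertFirst n := by
  apply pow_ext <;> simp [reassoc_of% hh]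

variable {G} in
theorem insertFirst_oneBox_assoc {m n : ℕ} (h : G.pow m ⟶ G.pow n) (hh : h ≫ G.tgt n = G.tgt m)
    {Z : Mon C} (z : _ ⟶ Z) :
    G.insertFirst m ≫ oneBox h hh ≫ z = h ≫ G.insertFirst n ≫ z := by
  simpa only [Category.assoc, Category.id_comp] using insertFirst_oneBox h hh =≫ z

variable {G} in
theorem insertFirst_powMap {H : ReflGraph S} (f : G ⟶ H) (n : ℕ) :
    G.insertFirst n ≫ powMap f (n + 1) = powMap f n ≫ H.insertFirst n := by
  apply pow_ext
  · have h : powMap f n ≫ H.tgt n = G.tgt n ≫ f.b := (powMapAux f n).2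
    simp [f.i_comm, reassoc_of% h]
  · simp

variable {G} in
theorem insertFirst_powMap_assoc {H : ReflGraph S} (f : G ⟶ H) (n : ℕ) {Z : Mon C} (z : _ ⟶ Z) :
    G.insertFirst n ≫ powMap f (n + 1) ≫ z = powMap f n ≫ H.insertFirst n ≫ z := by
  simpa only [Category.assoc, Category.id_comp] using insertFirst_powMap f n =≫ z

variable {G} in
theorem powMap_tgt {H : ReflGraph S} (f : G ⟶ H) (n : ℕ) :
    powMap f n ≫ H.tgt n = G.tgt n ≫ f.b := (powMapAux f n).2

variable {G} in
theorem powMap_rest_assoc {H : ReflGraph S} (f : G ⟶ H) (n : ℕ) {Z : Mon C} (z : _ ⟶ Z) :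
    powMap f (n + 1) ≫ H.rest n ≫ z = G.rest n ≫ powMap f n ≫ z := by
  simpa only [Category.assoc, Category.id_comp] using powMap_rest f n =≫ z

variable {G} in
theorem diag_powMap {H : ReflGraph S} (f : G ⟶ H) (n : ℕ) :
    G.diag n ≫ powMap f n = f.b ≫ H.diag n := by
  induction n with
  | zero => simp [diag]
  | succ n ih => simp [diag, insertFirst_powMap, reassoc_of% ih]

variable {G} in
theorem insertRest_powMap {H : ReflGraph S} (f : G ⟶ H) (n : ℕ) :
    G.insertRest n ≫ powMap f (n + 1) = f.a ≫ H.insertRest n := by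
  apply pow_ext
  · simp
  · simp only [Category.assoc, powMap_rest, insertRest_rest_assoc, diag_powMap, insertRest_rest]
    rw [← Category.assoc, f.s_comm, Category.assoc]

variable {G} in
theorem insertRest_powMap_assoc {H : ReflGraph S} (f : G ⟶ H) (n : ℕ) {Z : Mon C} (z : _ ⟶ Z) :
    G.insertRest n ≫ powMap f (n + 1) ≫ z = f.a ≫ H.insertRest n ≫ z := by
  simpa only [Category.assoc, Category.id_comp] using insertRest_powMap f n =≫ z

theorem i_insertRest (n : ℕ) : G.i ≫ G.insertRest n = G.diag (n + 1) := by
  apply pow_ext <;> simp [diag]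

theorem insertRest_zero : G.insertRest 0 = G.ofA := by
  apply pow_ext
  · simp
  · rw [insertRest_rest]
    have := G.ofA_rest
    rw [← Category.comp_id (G.ofA ≫ G.rest 0), ← G.tgt_ofB, ← Category.assoc (G.ofA ≫ _),
      Category.assoc G.ofA, this]
    rfl

theorem ofB_insertFirst_zero : G.ofB ≫ G.insertFirst 0 = G.i ≫ G.ofA := by
  rw [← insertRest_zero, i_insertRest]
  rfl

theorem diag_one : G.diag 1 = G.i ≫ G.ofA := ofB_insertFirst_zero G

@[simp]
theorem diag_fst (n : ℕ) : G.diag (n + 1) ≫ G.fst n = G.i := by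
  simp [diag]

@[simp]
theorem diag_fst_assoc (n : ℕ) {Z : Mon C} (z : _ ⟶ Z) :
    G.diag (n + 1) ≫ G.fst n ≫ z = G.i ≫ z := by
  simpa only [Category.assoc, Category.id_comp] using G.diag_fst n =≫ z

@[simp]
theorem diag_rest (n : ℕ) : G.diag (n + 1) ≫ G.rest n = G.diag n := by
  simp [diag]

@[simp]
theorem diag_rest_assoc (n : ℕ) {Z : Mon C} (z : _ ⟶ Z) :
    G.diag (n + 1) ≫ G.rest n ≫ z = G.diag n ≫ z := by
  simpa only [Category.assoc, Category.id_comp] using G.diag_rest n =≫ z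

theorem q_eq {Y : C} (p : Y ⟶ G.A.X) (n : ℕ) :
    G.q p n = ((p ≫ (G.insertRest n).hom) ⊗ₘ (G.insertFirst n).hom) ≫ MonObj.mul := by
  rw [q, ← tensorHom_id, tensorHom_comp_tensorHom_assoc, Category.id_comp]

theorem q_comp {Y : C} (p : Y ⟶ G.A.X) (n : ℕ) {D : Mon C} (f : G.pow (n + 1) ⟶ D) :
    G.q p n ≫ f.hom =
      ((p ≫ (G.insertRest n ≫ f).hom) ⊗ₘ (G.insertFirst n ≫ f).hom) ≫ MonObj.mul := by
  rw [q_eq, Category.assoc, tensor_mul_comp]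
  simp

-- A monoid morphism applied to `q_{n+1}` is the product of its restrictions along `p (1 □ i □ ⋯ □
-- i)` and `i □ 1`, and `q_{n+1}` is an epimorphism. This is the source of all uniqueness statements
-- about compositions.
variable {G} in
theorem hom_ext_of_isIso_q {Y : C} {p : Y ⟶ G.A.X} {n : ℕ} (hq : IsIso (G.q p n)) {D : Mon C}
    {f g : G.pow (n + 1) ⟶ D}
    (h₁ : p ≫ (G.insertRest n ≫ f).hom = p ≫ (G.insertRest n ≫ g).hom)
    (h₂ : G.insertFirst n ≫ f = G.insertFirst n ≫ g) : f = g := by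
  ext
  rw [← cancel_epi (G.q p n), q_comp, q_comp, h₁, h₂]

variable {G} in
theorem q_powMap {H : ReflGraph S} (f : G ⟶ H) {Y Z : C} (p : Y ⟶ G.A.X) (r : Z ⟶ H.A.X)
    (y : Y ⟶ Z) (hy : p ≫ f.a.hom = y ≫ r) (n : ℕ) :
    G.q p n ≫ (powMap f (n + 1)).hom = (y ⊗ₘ (powMap f n).hom) ≫ H.q r n := by
  rw [q_comp, insertRest_powMap, insertFirst_powMap, q_eq, tensorHom_comp_tensorHom_assoc]
  simp [reassoc_of% hy]

/-- The kernel of `s` can be chosen to be a monoid. -/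
theorem exists_kernel {Y : C} {p : Y ⟶ G.A.X} {pI : Y ⟶ 𝟙_ C}
    (h : IsRelPullback S G.s.hom (MonObj.one (X := G.B.X)) p pI) (hq : ∀ n, IsIso (G.q p n)) :
    ∃ (K : Mon C) (r : K ⟶ G.A) (e : K ⟶ Mon.trivial C),
      IsRelPullback S G.s.hom (MonObj.one (X := G.B.X)) r.hom e.hom ∧
        ∀ n, IsIso (G.q r.hom n) := by
  obtain ⟨K, r, e, H⟩ := exists_mon_of_isRelPullback G.s (unitHom G.B) h
  refine ⟨K, r, e, H, fun n => ?_⟩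
  obtain ⟨w, hw, -⟩ := IsRelPullback.exists_iso H h
  have hn := hq n
  have : G.q r.hom n = (w.hom ▷ _) ≫ G.q p n := by
    rw [q, q, ← hw, comp_whiskerRight, Category.assoc]
  rw [this]
  infer_instance

end ReflGraph

/-! ### Unital compositions and the Peiffer condition -/

section MonoidLemmas

variable {C : Type u} [Category.{v} C] [MonoidalCategory C]

/-- If `m ∘ (f ⊗ g) : Y ⊗ A ⟶ M` is invertible and `z` is a commutation law for both `f, g` and
`f', g'`, then there is a monoid morphism `M ⟶ N` taking `f` to `f'` and `g` to `g'`. -/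
theorem exists_mon_hom_of_isIso {Y A M N : Mon C} (f : Y ⟶ M) (g : A ⟶ M) (f' : Y ⟶ N) (g' : A ⟶ N)
    (_ : IsIso ((f.hom ⊗ₘ g.hom) ≫ MonObj.mul)) (z : A.X ⊗ Y.X ⟶ Y.X ⊗ A.X)
    (hz : z ≫ (f.hom ⊗ₘ g.hom) ≫ MonObj.mul = (g.hom ⊗ₘ f.hom) ≫ MonObj.mul)
    (hz' : z ≫ (f'.hom ⊗ₘ g'.hom) ≫ MonObj.mul = (g'.hom ⊗ₘ f'.hom) ≫ MonObj.mul) :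
    ∃ d : M ⟶ N, f ≫ d = f' ∧ g ≫ d = g' := by
  -- `z` need not be a distributive law: commutation alone makes both `m (f ⊗ g)` and `m (f' ⊗ g')`
  -- carry one and the same twisted multiplication on `Y ⊗ A` to the multiplication of their target.
  -- Inverting the first one then yields a multiplicative morphism.
  have h₁ := twistedMul_hom MonObj.mul MonObj.mul z f.hom g.hom (IsMonHom.mul_hom _)
    (IsMonHom.mul_hom _) hz
  have h₂ := twistedMul_hom MonObj.mul MonObj.mul z f'.hom g'.hom (IsMonHom.mul_hom _)
    (IsMonHom.mul_hom _) hz'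
  have e₁ : (λ_ (𝟙_ C)).inv ≫ (MonObj.one ⊗ₘ MonObj.one) ≫ (f.hom ⊗ₘ g.hom) ≫ MonObj.mul =
      MonObj.one := by
    rw [tensorHom_comp_tensorHom_assoc]
    simp [← unitors_equal]
  have e₂ : (λ_ (𝟙_ C)).inv ≫ (MonObj.one ⊗ₘ MonObj.one) ≫ (f'.hom ⊗ₘ g'.hom) ≫ MonObj.mul =
      MonObj.one := by
    rw [tensorHom_comp_tensorHom_assoc]
    simp [← unitors_equal]
  have e₃ : (ρ_ Y.X).inv ≫ Y.X ◁ MonObj.one ≫ (f.hom ⊗ₘ g.hom) ≫ MonObj.mul = f.hom := by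
    rw [← id_tensorHom, tensorHom_comp_tensorHom_assoc]
    simp
  have e₄ : (ρ_ Y.X).inv ≫ Y.X ◁ MonObj.one ≫ (f'.hom ⊗ₘ g'.hom) ≫ MonObj.mul = f'.hom := by
    rw [← id_tensorHom, tensorHom_comp_tensorHom_assoc]
    simp
  have e₅ : (λ_ A.X).inv ≫ MonObj.one ▷ A.X ≫ (f.hom ⊗ₘ g.hom) ≫ MonObj.mul = g.hom := by
    rw [← tensorHom_id, tensorHom_comp_tensorHom_assoc]
    simp
  have e₆ : (λ_ A.X).inv ≫ MonObj.one ▷ A.X ≫ (f'.hom ⊗ₘ g'.hom) ≫ MonObj.mul = g'.hom := by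
    rw [← tensorHom_id, tensorHom_comp_tensorHom_assoc]
    simp
  set Q := (f.hom ⊗ₘ g.hom) ≫ MonObj.mul
  set D := (f'.hom ⊗ₘ g'.hom) ≫ MonObj.mul
  refine ⟨Mon.Hom.mk' (inv Q ≫ D) ?_ ?_, ?_, ?_⟩
  · rw [← e₁, ← e₂]
    simp
  · rw [← cancel_epi (Q ⊗ₘ Q), ← Category.assoc, ← h₁, tensorHom_comp_tensorHom_assoc,
      IsIso.hom_inv_id_assoc, ← h₂]
    simp
  · ext
    rw [Mon.comp_hom', ← e₄]
    simp [← e₃]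
  · ext
    rw [Mon.comp_hom', ← e₆]
    simp [← e₅]

end MonoidLemmas

variable {C : Type u} [Category.{v} C] [MonoidalCategory C] {S : SpanClass C} [HasLegPullbacks S]

namespace CompGraph

open ReflGraph

theorem dBox_fst (K : CompGraph S) (n : ℕ) : K.dBox n ≫ K.fst n = K.front n ≫ K.d :=
  lift_fst _ _ _ _ _

theorem dBox_rest (K : CompGraph S) (n : ℕ) : K.dBox n ≫ K.rest n = K.rest (n + 1) ≫ K.rest n :=
  lift_rest _ _ _ _ _

theorem dBox_rest_assoc (K : CompGraph S) (n : ℕ) {Z : Mon C} (z : _ ⟶ Z) :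
    K.dBox n ≫ K.rest n ≫ z = K.rest (n + 1) ≫ K.rest n ≫ z := by
  simpa only [Category.assoc, Category.id_comp] using dBox_rest K n =≫ z

/-- A unital composition is associative, when the morphism `q_3` is invertible. -/
theorem assoc_of_isIso_q (K : CompGraph S) {Y : C} {p : Y ⟶ K.A.X} (hq : IsIso (K.q p 2))
    (hd₁ : K.insertRest 1 ≫ K.d = 𝟙 _) (hd₂ : K.ofA ≫ K.insertFirst 1 ≫ K.d = 𝟙 _) :
    K.dBox 1 ≫ K.d = oneBox (K.d ≫ K.ofA) K.d_over ≫ K.d := by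
  have e₁ : K.insertRest 2 ≫ K.dBox 1 = K.insertRest 1 := by
    have h : K.insertRest 2 ≫ K.front 1 = K.insertRest 1 := by
      apply pow_ext
      · rw [Category.assoc, K.front_fst]
        simp
      · rw [Category.assoc, K.front_rest]
        simp [diag_one]
    apply pow_ext
    · rw [Category.assoc, dBox_fst, reassoc_of% h, hd₁, insertRest_fst]
    · rw [Category.assoc, dBox_rest]
      simp
  have e₂ : K.insertFirst 2 ≫ K.dBox 1 = 𝟙 _ := by
    have h : K.insertFirst 2 ≫ K.front 1 = K.fst 1 ≫ K.ofA ≫ K.insertFirst 1 := by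
      apply pow_ext
      · simp only [Category.assoc, K.front_fst]
        simp [tgt_succ K.toReflGraph 1, ofA_tgt_assoc]
      · simp only [Category.assoc, K.front_rest]
        simp
    apply pow_ext
    · rw [Category.assoc, dBox_fst, reassoc_of% h, hd₂, Category.comp_id, Category.id_comp]
    · rw [Category.assoc, dBox_rest]
      simp
  have e₃ : K.insertRest 2 ≫ oneBox (K.d ≫ K.ofA) K.d_over = K.insertRest 1 := by
    apply pow_ext
    · simp
    · have h : K.diag 2 ≫ K.d = K.i := by
        rw [← i_insertRest, Category.assoc, hd₁, Category.comp_id]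
      simp [reassoc_of% h, diag_one]
  -- On the piece `1 □ i □ i` both sides become `d (1 □ i)`; on the piece `i □ 1` both become `d`.
  apply hom_ext_of_isIso_q hq
  · rw [reassoc_of% e₁, reassoc_of% e₃]
  · rw [reassoc_of% e₂, insertFirst_oneBox_assoc, Category.assoc, hd₂, Category.comp_id]

end CompGraph

namespace ReflGraph

variable (G : ReflGraph S)

theorem ofA_comp_q {Y : C} (p : Y ⟶ G.A.X) :
    (Y ◁ G.ofA.hom) ≫ G.q p 1 =
      ((p ≫ (G.insertRest 1).hom) ⊗ₘ (G.ofA ≫ G.insertFirst 1).hom) ≫ MonObj.mul := by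
  rw [q_eq, ← id_tensorHom, tensorHom_comp_tensorHom_assoc, Category.id_comp, Mon.comp_hom']

instance : IsIso G.ofA := ⟨G.fst 0, by simp, by simp⟩

instance : IsIso (G.fst 0) := ⟨G.ofA, by simp, by simp⟩

instance {M N : Mon C} (f : M ⟶ N) [IsIso f] : IsIso f.hom :=
  inferInstanceAs (IsIso ((Mon.forget C).map f))

variable {G}

theorem ofA_powMap {H : ReflGraph S} (f : G ⟶ H) : G.ofA ≫ powMap f 1 = f.a ≫ H.ofA := by
  rw [← cancel_mono (H.fst 0), Category.assoc, powMap_fst]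
  simp

theorem ofA_powMap_assoc {H : ReflGraph S} (f : G ⟶ H) {Z : Mon C} (z : _ ⟶ Z) :
    G.ofA ≫ powMap f 1 ≫ z = f.a ≫ H.ofA ≫ z := by
  simpa only [Category.assoc, Category.id_comp] using ofA_powMap f =≫ z

/-- The lowest case of `hom_ext_of_isIso_q`, read on `A` instead of `A^{□ 1}`: the pieces are `Y`
and `B`. -/
theorem hom_ext_A {Y : C} {p : Y ⟶ G.A.X} (hq : IsIso (G.q p 0)) {D : Mon C} {f g : G.A ⟶ D}
    (h₁ : p ≫ f.hom = p ≫ g.hom) (h₂ : G.i ≫ f = G.i ≫ g) : f = g := by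
  rw [← cancel_epi (G.fst 0)]
  apply hom_ext_of_isIso_q hq
  · simp [h₁]
  · simp [h₂]

/-- The Peiffer condition is equivalent to the existence of a unital composition. -/
theorem peiffer_iff {Y : Mon C} (p : Y ⟶ G.A) (hq : ∀ n, IsIso (G.q p.hom n)) :
    G.Peiffer p.hom ↔
      ∃ d : G.pow 2 ⟶ G.A, G.insertRest 1 ≫ d = 𝟙 _ ∧ G.ofA ≫ G.insertFirst 1 ≫ d = 𝟙 _ := by
  have hq₁ := hq 1
  constructor
  · rintro ⟨z, h₁, h₂⟩
    rw [ofA_comp_q] at h₁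
    -- The two equations of the Peiffer condition say that `z` is a commutation law for the two
    -- pieces of `A □_B A` and also for their prescribed images `p` and `1` in `A`.
    obtain ⟨d, hd₁, hd₂⟩ := exists_mon_hom_of_isIso (p ≫ G.insertRest 1) (G.ofA ≫ G.insertFirst 1)
      p (𝟙 G.A) (by rw [Mon.comp_hom', ← ofA_comp_q]; infer_instance) z
      (by simpa using h₁) (by simpa using h₂)
    -- The law `d (1 □ i) = 1` is so far known only on `Y`. On `B` it follows from the other unit
    -- law, since `(1 □ i) i = i □ i = (i □ 1) i`.
    refine ⟨d, hom_ext_A (hq 0) ?_ ?_, by simpa using hd₂⟩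
    · simpa using congrArg Mon.Hom.hom hd₁
    · rw [← Category.assoc, i_insertRest, diag, diag_one]
      simpa using congrArg (G.i ≫ ·) hd₂
  · rintro ⟨d, hd₁, hd₂⟩
    -- The first equation forces this `z`. The second holds because `d` takes `q_2` to `m (p ⊗ 1)`,
    -- by the unit laws.
    refine ⟨((G.ofA ≫ G.insertFirst 1).hom ⊗ₘ (p.hom ≫ (G.insertRest 1).hom)) ≫ MonObj.mul ≫
      inv (G.q p.hom 1) ≫ Y.X ◁ (G.fst 0).hom, ?_, ?_⟩
    · simp only [Category.assoc, ← whiskerLeft_comp_assoc, ← Mon.comp_hom', fst_ofA]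
      simp
    · have h : Y.X ◁ (G.fst 0).hom ≫ p.hom ▷ G.A.X ≫ MonObj.mul = G.q p.hom 1 ≫ d.hom := by
        rw [q_comp, hd₁, ← id_tensorHom, ← tensorHom_id, tensorHom_comp_tensorHom_assoc]
        have : G.insertFirst 1 ≫ d = G.fst 0 := by
          rw [← cancel_epi G.ofA, hd₂, ofA_fst]
        simp [this]
      simp only [Category.assoc]
      rw [h, IsIso.inv_hom_id_assoc, tensor_mul_comp, Category.assoc, ← Mon.comp_hom',
        ← Mon.comp_hom', hd₁, Category.assoc, hd₂]
      simp

section Composition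

variable {Y : C} (p : Y ⟶ G.A.X) (hq : ∀ n, IsIso (G.q p n)) (d : G.pow 2 ⟶ G.A)
  (hd₁ : G.insertRest 1 ≫ d = 𝟙 _) (hd₂ : G.ofA ≫ G.insertFirst 1 ≫ d = 𝟙 _)

theorem insertFirst_comp_eq_fst {d : G.pow 2 ⟶ G.A} (hd₂ : G.ofA ≫ G.insertFirst 1 ≫ d = 𝟙 _) :
    G.insertFirst 1 ≫ d = G.fst 0 := by
  rw [← cancel_epi G.ofA, hd₂, ofA_fst]

/-- A unital composition on a reflexive graph has the right source and target, when the morphism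
`q_2` is invertible. -/
noncomputable def compGraphOfUnital : CompGraph S where
  toReflGraph := G
  d := d
  d_s := by
    apply hom_ext_of_isIso_q (hq 1)
    · rw [reassoc_of% hd₁, insertRest_rest_assoc]
      simp [diag]
    · rw [reassoc_of% insertFirst_comp_eq_fst hd₂, insertFirst_rest_assoc]
  d_t := by
    apply hom_ext_of_isIso_q (hq 1)
    · rw [reassoc_of% hd₁, insertRest_fst_assoc]
    · rw [reassoc_of% insertFirst_comp_eq_fst hd₂, insertFirst_fst_assoc, i_t, Category.comp_id,
        tgt_succ]

/-- A unital composition on a reflexive graph makes it a relative category, when the morphisms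
`q_n` are invertible. -/
noncomputable def relCatOfUnital : RelCat S where
  toCompGraph := compGraphOfUnital p hq d hd₁ hd₂
  one_box_i_d := hd₁
  i_box_one_d := hd₂
  assoc := (compGraphOfUnital p hq d hd₁ hd₂).assoc_of_isIso_q (hq 2) hd₁ hd₂

end Composition

end ReflGraph

namespace RelCat

/-- A morphism of reflexive graphs between relative categories preserves the composition if the
morphism `q_2` of its domain is invertible. -/
theorem d_comm_of_isIso_q {K L : RelCat S} {Y : C} {p : Y ⟶ K.A.X} (hq : IsIso (K.q p 1))
    (f : K.toReflGraph ⟶ L.toReflGraph) : K.d ≫ f.a = ReflGraph.powMap f 2 ≫ L.d := by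
  apply ReflGraph.hom_ext_of_isIso_q hq
  · rw [reassoc_of% K.one_box_i_d, ReflGraph.insertRest_powMap_assoc, L.one_box_i_d,
      Category.comp_id]
  · rw [← cancel_epi K.ofA, reassoc_of% K.i_box_one_d, ReflGraph.insertFirst_powMap_assoc]
    rw [ReflGraph.ofA_powMap_assoc, L.i_box_one_d, Category.comp_id]

instance : (RelCat.forget S).Faithful where
  map_injective h := RelCat.Hom.ext h

end RelCat

namespace CatMon

/-- Preservation of the composition is automatic, so relative functors are just graph morphisms. -/
theorem exists_map_eq {K L : CatMon S} (f : K.obj.toReflGraph ⟶ L.obj.toReflGraph) :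
    ∃ g : K ⟶ L, g.hom.graph = f := by
  obtain ⟨_, _, _, _, hq⟩ := K.property
  exact ⟨ObjectProperty.homMk ⟨f, RelCat.d_comm_of_isIso_q (hq 1) f⟩, rfl⟩

instance : ((isCatMon S).ι ⋙ RelCat.forget S).Full where
  map_surjective f := exists_map_eq f

end CatMon

variable {C : Type u} [Category.{v} C] [MonoidalCategory C] {S : SpanClass C} [HasLegPullbacks S]

/-! ### Edges of chains and the nerve -/

namespace CompGraph

open ReflGraph

variable (K : CompGraph S)

/-- The composite of the arrows of a chain of length `n` from the vertex `i` to the last vertex,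
where the vertices of the chain `A^{□ n}` are numbered from right to left. -/
noncomputable def edgeToLast :
    (n : ℕ) → ℕ → {f : K.pow n ⟶ K.pow 1 // f ≫ K.tgt 1 = K.tgt n}
  | 0, _ => ⟨K.tgt 0 ≫ K.i ≫ K.ofA, by simp [ofA_tgt]⟩
  | n + 1, i =>
    if i ≤ n then ⟨oneBox (edgeToLast n i).1 (edgeToLast n i).2 ≫ K.d ≫ K.ofA, by
      have h := K.d_over
      rw [Category.assoc] at h
      rw [Category.assoc, Category.assoc, h, oneBox_tgt]⟩
    -- The meaningful case is `i = n + 1`, where the composite is the identity arrow at the last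
    -- vertex; larger `i` receive the same value by convention.
    else ⟨K.tgt (n + 1) ≫ K.i ≫ K.ofA, by simp [ofA_tgt]⟩

/-- The composite of the arrows of a chain of length `n` from the vertex `i` to the vertex `j`. -/
noncomputable def edge : (n : ℕ) → ℕ → ℕ → (K.pow n ⟶ K.A)
  | 0, _, _ => K.tgt 0 ≫ K.i
  | n + 1, i, j =>
    if j ≤ n then K.rest n ≫ edge n i j else (K.edgeToLast (n + 1) i).1 ≫ K.fst 0

theorem edge_last (n i : ℕ) : K.edge n i n = (K.edgeToLast n i).1 ≫ K.fst 0 := by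
  cases n with
  | zero => simp [edge, edgeToLast]
  | succ n => simp [edge]

theorem edge_succ_of_le {n i j : ℕ} (h : j ≤ n) :
    K.edge (n + 1) i j = K.rest n ≫ K.edge n i j := by
  simp [edge, h]

theorem edge_self_last (n : ℕ) : K.edge n n n = K.tgt n ≫ K.i := by
  rw [edge_last]
  cases n <;> simp [edgeToLast]

theorem edge_succ_last {n i : ℕ} (h : i ≤ n) :
    K.edge (n + 1) i (n + 1) = oneBox (K.edgeToLast n i).1 (K.edgeToLast n i).2 ≫ K.d := by
  rw [edge_last, edgeToLast, if_pos h]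
  simp

/-- The morphism `h : A^{□ m} ⟶ A^{□ n}` acts on vertices by `φ`. -/
def ActsBy {m n : ℕ} (h : K.pow m ⟶ K.pow n) (φ : ℕ → ℕ) : Prop :=
  ∀ i j, i ≤ j → j ≤ n → h ≫ K.edge n i j = K.edge m (φ i) (φ j)

variable {K}

theorem ActsBy.edgeToLast {m n : ℕ} {h : K.pow m ⟶ K.pow n} {φ : ℕ → ℕ} (H : K.ActsBy h φ)
    (hn : φ n = m) {i : ℕ} (hi : i ≤ n) :
    h ≫ (K.edgeToLast n i).1 = (K.edgeToLast m (φ i)).1 := by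
  have h' := H i n hi le_rfl
  rw [edge_last, hn, edge_last, ← Category.assoc] at h'
  exact (cancel_mono _).1 h'

/-- `1 □ h` adjoins a new last vertex, which it preserves. An edge ending there is the new arrow
composed with an edge to the old last vertex, so `h` has to preserve last vertices, which is `hn`.
-/
theorem ActsBy.oneBox {m n : ℕ} {h : K.pow m ⟶ K.pow n} {hh : h ≫ K.tgt n = K.tgt m} {φ ψ : ℕ → ℕ}
    (H : K.ActsBy h φ) (hn : φ n = m) (hφ : ∀ i ≤ n, φ i ≤ m) (hψ : ∀ i ≤ n, ψ i = φ i)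
    (hψ' : ψ (n + 1) = m + 1) : K.ActsBy (oneBox h hh) ψ := by
  intro i j hij hj
  obtain hj | rfl := Nat.le_succ_iff.1 hj
  · rw [edge_succ_of_le _ hj, hψ i (hij.trans hj), hψ j hj, edge_succ_of_le _ (hφ j hj),
      oneBox_rest_assoc, H i j hij hj]
  · rw [hψ']
    obtain hi | rfl := Nat.le_succ_iff.1 hij
    · rw [hψ i hi, edge_succ_last _ hi, edge_succ_last _ (hφ i hi), oneBox_comp_assoc]
      simp only [H.edgeToLast hn hi]
    · rw [hψ', edge_self_last, edge_self_last, ← Category.assoc, oneBox_tgt]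

end CompGraph

namespace RelCat

open ReflGraph CompGraph

variable (K : RelCat S)

/-- The edge between the last two vertices is the first factor composed with an identity arrow, so
`d (1 □ i) = 1` gives the claim. -/
theorem edge_succ_eq_fst (n : ℕ) : K.edge (n + 1) n (n + 1) = K.fst n := by
  rw [edge_succ_last _ le_rfl]
  have h : oneBox (K.edgeToLast n n).1 (K.edgeToLast n n).2 = K.fst n ≫ K.insertRest 1 := by
    apply pow_ext
    · simp
    · rw [oneBox_rest, Category.assoc, insertRest_rest, diag_one, fst_s_assoc]
      cases n <;> simp [CompGraph.edgeToLast]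
  rw [h, Category.assoc, K.one_box_i_d, Category.comp_id]

-- Edges between neighbouring vertices are the single factors of the chain, and these are already
-- jointly monic.
variable {K} in
theorem pow_ext_edge {n : ℕ} {T : Mon C} {h k : T ⟶ K.pow n}
    (H : ∀ i j, i ≤ j → j ≤ n → h ≫ K.edge n i j = k ≫ K.edge n i j) : h = k := by
  induction n with
  | zero =>
    -- In degree `0` the only edge is, up to the identification of `A^{□ 0}` with `B`, the morphism
    -- `i`, which is split by `s`.
    have h' := H 0 0 le_rfl le_rfl =≫ (K.s ≫ K.ofB)
    simpa [edge_self_last] using h'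
  | succ n ih =>
    apply pow_ext
    · have h' := H n (n + 1) n.le_succ le_rfl
      rwa [edge_succ_eq_fst] at h'
    · apply ih
      intro i j hij hj
      simpa [edge_succ_of_le _ hj] using H i j hij (hj.trans n.le_succ)

/-- Inserting an identity arrow at the front repeats the last vertex; edges ending in the repeated
vertex are handled by the unit law `d (i □ 1) = 1`. -/
theorem actsBy_insertFirst (n : ℕ) :
    K.ActsBy (K.insertFirst n) (fun i => if i ≤ n then i else i - 1) := by
  intro i j hij hj
  obtain hj | rfl := Nat.le_succ_iff.1 hj
  · rw [edge_succ_of_le _ hj, insertFirst_rest_assoc]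
    simp [hj, hij.trans hj]
  · obtain hi | rfl := Nat.le_succ_iff.1 hij
    · rw [edge_succ_last _ hi, insertFirst_oneBox_assoc]
      have h : K.insertFirst 1 ≫ K.d = K.fst 0 := by
        rw [← cancel_epi K.ofA, K.i_box_one_d, ofA_fst]
      simp [h, hi, edge_last]
    · simp [edge_self_last]

/-- Composing the first two arrows omits the last vertex but one. Edges ending in the last vertex
are compared by associativity of `d`. -/
theorem actsBy_dBox (n : ℕ) :
    K.ActsBy (K.dBox n) (fun i => if i < n + 1 then i else i + 1) := by
  intro i j hij hj
  obtain hj | rfl := Nat.le_succ_iff.1 hj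
  · rw [edge_succ_of_le _ hj]
    simp only [Nat.lt_succ_of_le hj, Nat.lt_succ_of_le (hij.trans hj), if_true]
    rw [edge_succ_of_le _ (hj.trans n.le_succ), edge_succ_of_le _ hj, dBox_rest_assoc]
  · simp only [lt_irrefl, if_false]
    obtain hi | rfl := Nat.le_succ_iff.1 hij
    · rw [edge_succ_last _ hi]
      simp only [Nat.lt_succ_of_le hi, if_true]
      rw [edge_succ_last _ (hi.trans n.le_succ)]
      -- Composing the first two arrows commutes with composing the remaining ones from the vertex
      -- `i` on. This reduces the claim to associativity for a triple.
      have h : K.dBox n ≫ oneBox (K.edgeToLast n i).1 (K.edgeToLast n i).2 =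
          oneBox (oneBox (K.edgeToLast n i).1 (K.edgeToLast n i).2) (oneBox_tgt _ _ _) ≫
            K.dBox 1 := by
        have h' : oneBox (oneBox (K.edgeToLast n i).1 (K.edgeToLast n i).2) (oneBox_tgt _ _ _) ≫
            K.front 1 = K.front n := by
          apply pow_ext
          · rw [Category.assoc, front_fst, oneBox_fst, front_fst]
          · rw [Category.assoc, front_rest, oneBox_rest_assoc, oneBox_fst_assoc, front_rest]
        apply pow_ext
        · simp only [Category.assoc, oneBox_fst, dBox_fst, reassoc_of% h']
        · simp only [Category.assoc, oneBox_rest, dBox_rest, dBox_rest_assoc, oneBox_rest_assoc]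
      rw [reassoc_of% h, K.assoc, oneBox_comp_assoc]
      congr 2
      rw [CompGraph.edgeToLast, if_pos hi]
    · simp only [lt_irrefl, if_false]
      rw [edge_self_last, edge_self_last, ← Category.assoc, dBox_tgt]

theorem actsBy_degenAux (n : ℕ) (k : Fin (n + 1)) :
    K.ActsBy (K.degenAux n k).1 (fun i => if i ≤ k then i else i - 1) := by
  induction n with
  | zero =>
    obtain rfl := Fin.fin_one_eq_zero k
    exact K.actsBy_insertFirst 0
  | succ n ih =>
    induction k using Fin.lastCases with
    | last => simpa [CompGraph.degenAux] using K.actsBy_insertFirst (n + 1)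
    | cast k =>
      rw [CompGraph.degenAux, Fin.lastCases_castSucc]
      refine (ih k).oneBox (hh := (K.degenAux n k).2) ?_ ?_ ?_ ?_
      all_goals grind

theorem actsBy_faceAux (n : ℕ) (k : Fin (n + 1)) :
    K.ActsBy (K.faceAux n k).1 (fun i => if i < k then i else i + 1) := by
  induction n with
  | zero =>
    obtain rfl := Fin.fin_one_eq_zero k
    intro i j hij hj
    obtain rfl := Nat.le_zero.1 hj
    obtain rfl := Nat.le_zero.1 hij
    simp [edge_self_last, CompGraph.faceAux, tgt_succ]
  | succ n ih =>
    induction k using Fin.lastCases with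
    | last => simpa [CompGraph.faceAux] using K.actsBy_dBox n
    | cast k =>
      rw [CompGraph.faceAux, Fin.lastCases_castSucc]
      refine (ih k).oneBox (hh := (K.faceAux n k).2) ?_ ?_ ?_ ?_
      all_goals grind

theorem actsBy_degen (n : ℕ) (k : Fin (n + 1)) :
    K.ActsBy (K.degen n k) (fun i => if i ≤ k then i else i - 1) :=
  K.actsBy_degenAux n k

theorem actsBy_face (n : ℕ) (k : Fin (n + 2)) :
    K.ActsBy (K.face n k) (fun i => if i < k then i else i + 1) := by
  induction k using Fin.lastCases with
  | last =>
    intro i j hij hj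
    simp only [face, Fin.lastCases_last, Fin.val_last, Nat.lt_succ_of_le hj,
      Nat.lt_succ_of_le (hij.trans hj), if_true, edge_succ_of_le _ hj]
  | cast k => simpa [CompGraph.face] using K.actsBy_faceAux n k

/-- The morphism `A^{□ b} ⟶ A^{□ a}` is the one induced by `α : [a] ⟶ [b]`. -/
def IsInduced {a b : SimplexCategory} (α : a ⟶ b) (h : K.pow b.len ⟶ K.pow a.len) : Prop :=
  ∀ i j : Fin (a.len + 1), i ≤ j → h ≫ K.edge a.len i j = K.edge b.len (α i : ℕ) (α j : ℕ)

-- Together with `exists_isInduced` this makes the nerve functorial without checking any simplicial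
-- identity.
variable {K} in
theorem IsInduced.unique {a b : SimplexCategory} {α : a ⟶ b} {h k : K.pow b.len ⟶ K.pow a.len}
    (hh : K.IsInduced α h) (hk : K.IsInduced α k) : h = k := by
  apply pow_ext_edge
  intro i j hij hj
  exact (hh ⟨i, by omega⟩ ⟨j, by omega⟩ hij).trans (hk ⟨i, by omega⟩ ⟨j, by omega⟩ hij).symm

theorem isInduced_id (a : SimplexCategory) : K.IsInduced (𝟙 a) (𝟙 (K.pow a.len)) :=
  fun _ _ _ => Category.id_comp _

variable {K} in
theorem IsInduced.comp {a b c : SimplexCategory} {α : a ⟶ b} {β : b ⟶ c}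
    {h : K.pow b.len ⟶ K.pow a.len} {k : K.pow c.len ⟶ K.pow b.len}
    (hh : K.IsInduced α h) (hk : K.IsInduced β k) : K.IsInduced (α ≫ β) (k ≫ h) := by
  intro i j hij
  rw [Category.assoc, hh i j hij]
  exact hk _ _ (α.toOrderHom.monotone hij)

theorem isInduced_δ {n : ℕ} (k : Fin (n + 2)) :
    K.IsInduced (SimplexCategory.δ k) (K.face n k) := by
  intro i j hij
  refine (K.actsBy_face n k i j hij (Nat.lt_succ_iff.1 j.2)).trans ?_
  have h (l : Fin (n + 1)) : (SimplexCategory.δ k l : ℕ) =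
      if (l : ℕ) < k then (l : ℕ) else l + 1 := by
    change ((k.succAbove l : Fin (n + 2)) : ℕ) = _
    rw [Fin.succAbove]
    split_ifs <;> simp_all [Fin.lt_def]
  rw [h, h]

theorem isInduced_σ {n : ℕ} (k : Fin (n + 1)) :
    K.IsInduced (SimplexCategory.σ k) (K.degen n k) := by
  intro i j hij
  refine (K.actsBy_degen n k i j hij (Nat.lt_succ_iff.1 j.2)).trans ?_
  have h (l : Fin (n + 2)) : (SimplexCategory.σ k l : ℕ) =
      if (l : ℕ) ≤ k then (l : ℕ) else l - 1 := by
    change ((k.predAbove l : Fin (n + 1)) : ℕ) = _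
    rw [Fin.predAbove]
    simp only [Fin.lt_def, Fin.val_castSucc]
    split_ifs <;> simp <;> omega
  rw [h, h]

/-- The maps that induce a morphism contain all cofaces and codegeneracies and are closed under
composition, and these generate the simplex category. -/
theorem exists_isInduced {a b : SimplexCategory} (α : a ⟶ b) : ∃ h, K.IsInduced α h := by
  let W : MorphismProperty SimplexCategory := fun _ _ α => ∃ h, K.IsInduced α h
  have : W.IsMultiplicative :=
    { id_mem := fun a => ⟨_, K.isInduced_id a⟩
      comp_mem := fun _ _ ⟨_, hf⟩ ⟨_, hg⟩ => ⟨_, hf.comp hg⟩ }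
  have h : W = ⊤ := SimplexCategory.morphismProperty_eq_top W (fun i => ⟨_, K.isInduced_δ i⟩)
    (fun i => ⟨_, K.isInduced_σ i⟩)
  change W α
  rw [h]
  trivial

/-- The `S`-relative nerve of a relative category. -/
noncomputable def nerve : SimplicialObject (Mon C) where
  obj a := K.pow a.unop.len
  map α := (K.exists_isInduced α.unop).choose
  map_id a := (K.exists_isInduced (𝟙 a.unop)).choose_spec.unique (K.isInduced_id _)
  map_comp α β := (K.exists_isInduced (α ≫ β).unop).choose_spec.unique
    ((K.exists_isInduced β.unop).choose_spec.comp (K.exists_isInduced α.unop).choose_spec)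

theorem isInduced_nerve_map {a b : SimplexCategory} (α : a ⟶ b) :
    K.IsInduced α (K.nerve.map α.op) :=
  (K.exists_isInduced α).choose_spec

theorem nerve_δ {n : ℕ} (k : Fin (n + 2)) : K.nerve.δ k = K.face n k :=
  (K.isInduced_nerve_map _).unique (K.isInduced_δ k)

theorem nerve_σ {n : ℕ} (k : Fin (n + 1)) : K.nerve.σ k = K.degen n k :=
  (K.isInduced_nerve_map _).unique (K.isInduced_σ k)

-- Edges are iterated composites, so preservation of `d` propagates to them by induction on the
-- length of the chain. Naturality of the nerve in `K` rests on this.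
variable {K} in
theorem powMap_edge {L : RelCat S} (f : K ⟶ L) {n i j : ℕ} (hij : i ≤ j) (hj : j ≤ n) :
    powMap f.graph n ≫ L.edge n i j = K.edge n i j ≫ f.graph.a := by
  have h₀ (n : ℕ) : powMap f.graph n ≫ L.edge n n n = K.edge n n n ≫ f.graph.a := by
    rw [edge_self_last, edge_self_last, ← Category.assoc, powMap_tgt, Category.assoc,
      Category.assoc, f.graph.i_comm]
  have h₁ : powMap f.graph 1 = K.fst 0 ≫ f.graph.a ≫ L.ofA := by
    rw [← cancel_mono (L.fst 0), powMap_fst]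
    simp
  induction n generalizing i j with
  | zero =>
    obtain rfl := Nat.le_zero.1 hj
    obtain rfl := Nat.le_zero.1 hij
    exact h₀ 0
  | succ n ih =>
    obtain hj | rfl := Nat.le_succ_iff.1 hj
    · rw [edge_succ_of_le _ hj, edge_succ_of_le _ hj, powMap_rest_assoc, ih hij hj, Category.assoc]
    · obtain hi | rfl := Nat.le_succ_iff.1 hij
      · rw [edge_succ_last _ hi, edge_succ_last _ hi, Category.assoc, f.d_comm, ← Category.assoc,
          ← Category.assoc]
        congr 1
        have h₂ := ih hi le_rfl
        rw [edge_last, edge_last] at h₂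
        apply pow_ext
        · simp
        · rw [Category.assoc, oneBox_rest, powMap_rest_assoc, Category.assoc, powMap_rest,
            oneBox_rest_assoc, h₁, ← reassoc_of% h₂]
          simp
      · exact h₀ _

variable {K} in
theorem IsInduced.comp_powMap {L : RelCat S} (f : K ⟶ L) {a b : SimplexCategory} {α : a ⟶ b}
    {h : K.pow b.len ⟶ K.pow a.len} {k : L.pow b.len ⟶ L.pow a.len} (hh : K.IsInduced α h)
    (hk : L.IsInduced α k) : h ≫ powMap f.graph a.len = powMap f.graph b.len ≫ k := by
  apply pow_ext_edge
  intro i j hij hj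
  have hK := hh ⟨i, by omega⟩ ⟨j, by omega⟩ hij
  have hL := hk ⟨i, by omega⟩ ⟨j, by omega⟩ hij
  dsimp only at hK hL
  rw [Category.assoc, Category.assoc, powMap_edge f hij hj, hL, reassoc_of% hK]
  exact (powMap_edge f (α.toOrderHom.monotone hij) (Nat.lt_succ_iff.1 (Fin.is_lt _))).symm

variable (S) in
/-- The `S`-relative nerve functor. -/
noncomputable def nerveFunctor : RelCat S ⥤ SimplicialObject (Mon C) where
  obj K := K.nerve
  map {K L} f :=
    { app := fun a => powMap f.graph a.unop.len
      naturality := fun _ _ α => (K.isInduced_nerve_map α.unop).comp_powMap f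
        (L.isInduced_nerve_map α.unop) }
  map_id K := NatTrans.ext (funext fun _ => powMap_id (G := K.toReflGraph) _)
  map_comp f g := NatTrans.ext (funext fun _ => powMap_comp f.graph g.graph _)

end RelCat

variable {C : Type u} [Category.{v} C] [MonoidalCategory C] {S : SpanClass C}

/-! ### The Moore tower of the nerve -/

section Constant

open Simplicial

/-- The constant simplicial monoid. -/
abbrev constMon (M : Mon C) : SimplicialObject (Mon C) :=
  (CategoryTheory.Functor.const _).obj M

theorem isRelPullback_id_unit (M : C) [MonObj M] :
    IsRelPullback S (𝟙 M) MonObj.one MonObj.one (𝟙 (𝟙_ C)) where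
  mem := S.unital _ _
  w := by simp
  existsUnique a d _ w := ⟨d, ⟨by simpa using w.symm, by simp⟩, fun k hk => by simpa using hk.2⟩
  reflect_right _ _ _ h := by simpa using h
  reflect_left _ _ _ h := by simpa using h

variable (S) in
/-- The kernel of the identity morphisms of a constant simplicial monoid. -/
def constMooreStep (M : Mon C) : MooreStep S (constMon M) (constMon (Mon.trivial C)) where
  p _ := unitHom M
  pI _ := 𝟙 (𝟙_ C)
  isMonHom_pI _ := inferInstanceAs (IsMonHom (𝟙 (𝟙_ C)))
  isRelPullback _ := isRelPullback_id_unit M.X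
  δ_p _ _ := (Category.id_comp _).trans (Category.comp_id _).symm
  δ_pI _ _ := Category.id_comp _
  σ_p _ _ := (Category.id_comp _).trans (Category.comp_id _).symm
  σ_pI _ _ := Category.id_comp _

theorem isIso_constMooreStep_y (M : Mon C) (m : ℕ) : IsIso ((constMooreStep S M).y m) := by
  have h : (constMooreStep S M).y m = (λ_ M.X).hom :=
    (MonObj.one_mul_hom (𝟙 M.X)).trans (Category.comp_id _)
  rw [h]
  exact Iso.isIso_hom (λ_ M.X)

end Constant

variable [HasLegPullbacks S]

namespace ReflGraph

/-- Transport of the invertibility of the morphisms `q_n` along an isomorphism. -/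
theorem isIso_q_of_iso {G H : ReflGraph S} (φ : G ≅ H) {Y Z : C} {p : Y ⟶ G.A.X} {r : Z ⟶ H.A.X}
    (y : Y ≅ Z) (hy : p ≫ φ.hom.a.hom = y.hom ≫ r) {n : ℕ} (h : IsIso (H.q r n)) :
    IsIso (G.q p n) := by
  have hi (m : ℕ) : IsIso (powMap φ.hom m) :=
    ⟨powMap φ.inv m, by rw [← powMap_comp, φ.hom_inv_id, powMap_id],
      by rw [← powMap_comp, φ.inv_hom_id, powMap_id]⟩
  have e := q_powMap φ.hom p r y.hom hy n
  have h₁ := hi n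
  have h₂ := hi (n + 1)
  have : IsIso (G.q p n ≫ (powMap φ.hom (n + 1)).hom) := by
    rw [e]
    infer_instance
  exact IsIso.of_isIso_comp_right _ (powMap φ.hom (n + 1)).hom

/-- The kernel of the morphism `s` is also the kernel of the projection `A^{□ (n+1)} ⟶ A^{□ n}`. -/
theorem isRelPullback_rest (G : ReflGraph S) {Y : C} {p : Y ⟶ G.A.X} {e : Y ⟶ 𝟙_ C}
    (H : IsRelPullback S G.s.hom (MonObj.one (X := G.B.X)) p e) (n : ℕ) :
    IsRelPullback S (G.rest n).hom (MonObj.one (X := (G.pow n).X))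
      (p ≫ (G.insertRest n).hom) e := by
  have h₁ : (G.insertRest n).hom ≫ (G.fst n).hom = 𝟙 _ := congrArg Mon.Hom.hom (G.insertRest_fst n)
  have h₂ : (G.insertRest n).hom ≫ (G.rest n).hom = G.s.hom ≫ (G.diag n).hom :=
    congrArg Mon.Hom.hom (G.insertRest_rest n)
  have h₃ : (G.fst n).hom ≫ G.s.hom = (G.rest n).hom ≫ (G.tgt n).hom :=
    congrArg Mon.Hom.hom (G.fst_s n)
  refine ⟨?_, ?_, ?_, ?_, ?_⟩
  · simpa using S.post (G.insertRest n).hom (𝟙 _) H.mem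
  · rw [Category.assoc, h₂, reassoc_of% H.w, IsMonHom.one_hom]
  · intro T a d ha w
    -- If the projection of `a` to `A^{□ n}` is trivial, then its first component is killed by `s`,
    -- since `s p_1 = tgt ∘ rest`. It therefore factors through `Y`, and it determines `a`.
    obtain ⟨h, ⟨hp, he⟩, hu⟩ := H.existsUnique (a ≫ (G.fst n).hom) d
      (by simpa using S.post (G.fst n).hom (𝟙 _) ha)
      (by rw [Category.assoc, h₃, reassoc_of% w, IsMonHom.one_hom])
    refine ⟨h, ⟨(G.isRelPullback n).hom_ext ?_ ?_, he⟩, ?_⟩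
    · rw [Category.assoc, Category.assoc, h₁, Category.comp_id, hp]
    · rw [Category.assoc, Category.assoc, h₂, reassoc_of% H.w, IsMonHom.one_hom, reassoc_of% he, w]
    · rintro k ⟨rfl, rfl⟩
      exact hu k ⟨by simp [h₁], rfl⟩
  -- `fst` is a retraction of `insertRest`, so membership of spans descends to the kernel of `s`.
  · intro X T x h hp he
    refine H.reflect_right x h ?_ he
    simpa [h₁] using S.post (𝟙 _) (G.fst n).hom hp
  · intro X T h x hp he
    refine H.reflect_left h x ?_ he
    simpa [h₁] using S.post (G.fst n).hom (𝟙 _) hp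

end ReflGraph

namespace RelCat

open ReflGraph CompGraph Simplicial

variable (K : RelCat S)

theorem diag_edge {n i j : ℕ} (hij : i ≤ j) (hj : j ≤ n) : K.diag n ≫ K.edge n i j = K.i := by
  have h₀ (n : ℕ) : K.diag n ≫ K.edge n n n = K.i := by simp [edge_self_last]
  induction n generalizing i j with
  | zero =>
    obtain rfl := Nat.le_zero.1 hj
    obtain rfl := Nat.le_zero.1 hij
    exact h₀ 0
  | succ n ih =>
    obtain hj | rfl := Nat.le_succ_iff.1 hj
    · rw [edge_succ_of_le _ hj, diag_rest_assoc, ih hij hj]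
    · obtain hi | rfl := Nat.le_succ_iff.1 hij
      · have h := ih hi le_rfl
        rw [edge_last, ← Category.assoc] at h
        have h' : K.diag n ≫ (K.edgeToLast n i).1 = K.i ≫ K.ofA := by
          rw [← h, Category.assoc, fst_ofA, Category.comp_id]
        rw [edge_succ_last _ hi, diag, Category.assoc, insertFirst_oneBox_assoc, reassoc_of% h',
          K.i_box_one_d, Category.comp_id]
      · exact h₀ _

theorem insertRest_edge {n i : ℕ} (hi : i ≤ n) :
    K.insertRest n ≫ K.edge (n + 1) i (n + 1) = 𝟙 _ := by
  have h := K.diag_edge hi le_rfl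
  rw [edge_last, ← Category.assoc] at h
  have h' : K.diag n ≫ (K.edgeToLast n i).1 = K.i ≫ K.ofA := by
    rw [← h, Category.assoc, fst_ofA, Category.comp_id]
  have : K.insertRest n ≫ oneBox (K.edgeToLast n i).1 (K.edgeToLast n i).2 = K.insertRest 1 := by
    apply pow_ext
    · simp
    · simp [h', diag_one]
  rw [edge_succ_last _ hi, reassoc_of% this, K.one_box_i_d]

-- In a chain `(a, 1, …, 1)` an edge is `a` if it joins one of the lower vertices to the last one,
-- and an identity arrow otherwise. A relabelling that respects this division of the vertices sends
-- such a chain to one of the same shape. Hence all faces but the last, and all degeneracies but the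
-- last, restrict to identities on the kernels `Y`.
variable {K} in
theorem insertRest_comp_of_actsBy {m n : ℕ} {h : K.pow (m + 1) ⟶ K.pow (n + 1)} {φ : ℕ → ℕ}
    (H : K.ActsBy h φ) (hn : φ (n + 1) = m + 1) (hφ : Monotone φ) (hm : φ n ≤ m) :
    K.insertRest m ≫ h = K.insertRest n := by
  apply pow_ext_edge
  intro i j hij hj
  rw [Category.assoc, H i j hij hj]
  obtain hj | rfl := Nat.le_succ_iff.1 hj
  · have hj' : φ j ≤ m := (hφ hj).trans hm
    rw [edge_succ_of_le _ hj, edge_succ_of_le _ hj', insertRest_rest_assoc, insertRest_rest_assoc,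
      diag_edge _ (hφ hij) hj', diag_edge _ hij hj]
  · rw [hn]
    obtain hi | rfl := Nat.le_succ_iff.1 hij
    · rw [insertRest_edge _ hi, insertRest_edge _ ((hφ hi).trans hm)]
    · rw [hn, edge_self_last, edge_self_last, tgt_succ, tgt_succ]
      simp

theorem insertRest_face_castSucc (m : ℕ) (i : Fin (m + 2)) :
    K.insertRest (m + 1) ≫ K.face (m + 1) i.castSucc = K.insertRest m := by
  refine insertRest_comp_of_actsBy (K.actsBy_face _ _) ?_ ?_ ?_
  · grind
  · intro a b hab
    grind
  · grind

theorem insertRest_degen_castSucc (m : ℕ) (i : Fin (m + 1)) :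
    K.insertRest m ≫ K.degen (m + 1) i.castSucc = K.insertRest (m + 1) := by
  refine insertRest_comp_of_actsBy (K.actsBy_degen _ _) ?_ ?_ ?_
  · grind
  · intro a b hab
    grind
  · grind

theorem face_last (n : ℕ) : K.face n (Fin.last (n + 1)) = K.rest n := by
  simp [face]

theorem degen_last (n : ℕ) : K.degen n (Fin.last n) = K.insertFirst n := by
  cases n <;> simp [degen, degenAux]

/-- The nerve and the constant simplicial monoid at the kernel of `s` form the first step of the
Moore tower. -/
noncomputable def nerveMooreStep {Y : Mon C} (r : Y ⟶ K.A) (e : Y ⟶ Mon.trivial C)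
    (H : IsRelPullback S K.s.hom (MonObj.one (X := K.B.X)) r.hom e.hom) :
    MooreStep S K.nerve (constMon Y) where
  p m := r ≫ K.insertRest m
  pI _ := e.hom
  isMonHom_pI _ := e.isMonHom_hom
  isRelPullback m := by
    rw [nerve_δ, face_last]
    exact K.isRelPullback_rest H m
  δ_p m i := by
    rw [nerve_δ]
    refine (Category.id_comp _).trans (Eq.trans ?_ (Category.assoc _ _ _).symm)
    exact congrArg (r ≫ ·) (K.insertRest_face_castSucc m i).symm
  δ_pI _ _ := Category.id_comp _
  σ_p m i := by
    rw [nerve_σ]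
    refine (Category.id_comp _).trans (Eq.trans ?_ (Category.assoc _ _ _).symm)
    exact congrArg (r ≫ ·) (K.insertRest_degen_castSucc m i).symm
  σ_pI _ _ := Category.id_comp _

theorem nerveMooreStep_y {Y : Mon C} (r : Y ⟶ K.A) (e : Y ⟶ Mon.trivial C)
    (H : IsRelPullback S K.s.hom (MonObj.one (X := K.B.X)) r.hom e.hom) (m : ℕ) :
    (K.nerveMooreStep r e H).y m = K.q r.hom m := by
  rw [MooreStep.y, nerve_σ, degen_last, q_eq]
  rfl

theorem legsMem_nerve : LegsMem S K.nerve where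
  mem_s := by
    have h : K.nerve.δ (1 : Fin 2) = K.rest 0 := (K.nerve_δ (Fin.last 1)).trans (K.face_last 0)
    rw [h]
    exact K.mem_s
  mem_t := by
    have h : K.nerve.δ (0 : Fin 2) = K.fst 0 ≫ K.t ≫ K.ofB := K.nerve_δ (n := 0) 0
    rw [h]
    have h' : S.mem (K.fst 0 ≫ K.t ≫ K.ofB).hom (𝟙 (K.pow 1).X) := by
      rw [← Category.assoc, ← K.tgt_succ 0]
      simpa using S.post K.ofB.hom (𝟙 _) (K.mem_tgt 1)
    exact h'

theorem nerve_δ_one : K.nerve.δ (1 : Fin 2) = K.rest 0 :=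
  (K.nerve_δ (Fin.last 1)).trans (K.face_last 0)

theorem nerve_δ_zero : K.nerve.δ (0 : Fin 2) = K.fst 0 ≫ K.t ≫ K.ofB := K.nerve_δ (n := 0) 0

theorem nerve_σ_zero : K.nerve.σ (0 : Fin 1) = K.insertFirst 0 := K.nerve_σ (n := 0) 0

theorem fst_t_ofB_tgt : (K.fst 0 ≫ K.t ≫ K.ofB) ≫ K.tgt 0 = K.fst 0 ≫ K.t := by
  simp

theorem s_ofB : K.s ≫ K.ofB = K.ofA ≫ K.rest 0 := by
  rw [← K.ofA_rest, Category.assoc, Category.assoc, tgt_ofB, Category.comp_id]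

theorem t_ofB : K.t ≫ K.ofB = K.ofA ≫ K.fst 0 ≫ K.t ≫ K.ofB := by
  simp

/-- The truncation of the nerve of a relative category is its underlying reflexive graph. -/
noncomputable def truncNerveIso (h : LegsMem S K.nerve) :
    truncGraph K.nerve h ≅ K.toReflGraph where
  hom :=
    { a := K.fst 0
      b := K.tgt 0
      s_comm := (congrArg (· ≫ K.tgt 0) K.nerve_δ_one).trans (K.fst_s 0).symm
      t_comm := (congrArg (· ≫ K.tgt 0) K.nerve_δ_zero).trans K.fst_t_ofB_tgt
      i_comm := (congrArg (· ≫ K.fst 0) K.nerve_σ_zero).trans (K.insertFirst_fst 0) }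
  inv :=
    { a := K.ofA
      b := K.ofB
      s_comm := K.s_ofB.trans (congrArg (K.ofA ≫ ·) K.nerve_δ_one.symm)
      t_comm := K.t_ofB.trans (congrArg (K.ofA ≫ ·) K.nerve_δ_zero.symm)
      i_comm := Eq.trans K.ofB_insertFirst_zero.symm (congrArg (K.ofB ≫ ·) K.nerve_σ_zero.symm) }
  hom_inv_id := ReflGraph.Hom.ext K.fst_ofA K.tgt_ofB
  inv_hom_id := ReflGraph.Hom.ext K.ofA_fst K.ofB_tgt

theorem isSimpMon_nerve (hK : isCatMon S K) : IsSimpMon S K.nerve where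
  legs := K.legsMem_nerve
  exists_tower := by
    obtain ⟨_, _, _, H, hq⟩ := hK
    obtain ⟨Y, r, e, H, hq⟩ := K.exists_kernel H hq
    -- The kernels of the last faces form the constant simplicial monoid `Y`. Its own last faces are
    -- identities, with kernel `I`, and from then on the tower stays at `I`.
    let T : MooreTower S K.nerve :=
      { M := prepend (constMon Y) (fun _ => constMon (Mon.trivial C))
        step := fun k => match k with
          | 0 => K.nerveMooreStep r e H
          | 1 => constMooreStep S Y
          | _ + 2 => constMooreStep S (Mon.trivial C) }
    refine ⟨T, ?_, ?_, fun n => ?_⟩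
    · intro k hk
      match k, hk with
      | 1, _ => exact ⟨Category.comp_id _, Category.id_comp _⟩
      | k + 2, _ => exact ⟨Category.comp_id _, Category.id_comp _⟩
    · intro k m
      match k with
      | 0 =>
        change IsIso ((K.nerveMooreStep r e H).y m)
        rw [nerveMooreStep_y]
        exact hq m
      | 1 => exact isIso_constMooreStep_y _ _
      | k + 2 => exact isIso_constMooreStep_y _ _
    · refine isIso_q_of_iso (K.truncNerveIso K.legsMem_nerve) (Iso.refl Y.X) ?_ (hq n)
      change ((r ≫ K.insertRest 0) ≫ K.fst 0).hom = 𝟙 Y.X ≫ r.hom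
      simp

/-- The identity as an identification of the nerve with the nerve. -/
noncomputable def nerveIsoRefl : K.NerveIso K.nerve where
  iso n := Iso.refl (K.pow n)
  δ_comm _ k := (Category.comp_id _).trans ((K.nerve_δ k).trans (Category.id_comp _).symm)
  σ_comm _ k := (Category.comp_id _).trans ((K.nerve_σ k).trans (Category.id_comp _).symm)

variable {K} in
theorem nerve_map_mkOfLe {n : ℕ} (i j : Fin (n + 1)) (hij : i ≤ j) :
    K.nerve.map (SimplexCategory.mkOfLe i j hij).op ≫ K.fst 0 = K.edge n i j := by
  refine Eq.trans ?_ (K.isInduced_nerve_map (SimplexCategory.mkOfLe i j hij) 0 1 zero_le_one)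
  exact congrArg (_ ≫ ·) (K.edge_succ_eq_fst 0).symm

end RelCat

/-! ### Full faithfulness of the nerve -/

namespace CatMon

open ReflGraph CompGraph Simplicial

variable (S) in
/-- The `S`-relative nerve functor from `CatMon_S(C)` to `Simp¹Mon_S(C)`. -/
noncomputable def nerve : CatMon S ⥤ SimpMon S :=
  ObjectProperty.lift _ ((isCatMon S).ι ⋙ RelCat.nerveFunctor S)
    (fun K => K.obj.isSimpMon_nerve K.property)

variable (S) in
/-- The truncation of the nerve is the underlying reflexive graph. -/
noncomputable def nerveTruncIso :
    nerve S ⋙ SimpMon.trunc S ≅ (isCatMon S).ι ⋙ RelCat.forget S :=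
  NatIso.ofComponents (fun K => K.obj.truncNerveIso K.obj.legsMem_nerve) (fun f =>
    ReflGraph.Hom.ext (x := (nerve S ⋙ SimpMon.trunc S).map f ≫ _)
      (powMap_fst f.hom.graph 0) (powMap_tgt f.hom.graph 0))

/-- Edges of the nerve are pulled back along maps `[1] ⟶ [n]`, so by naturality a simplicial
morphism acts on them through its component in degree `1`. The family `F` repeats the components of
`f` as morphisms between powers. -/
theorem app_edge {K L : RelCat S} (f : K.nerve ⟶ L.nerve)
    (F : ∀ n, K.pow n ⟶ L.pow n) (hF : ∀ n, F n = f.app (Opposite.op ⦋n⦌)) {n i j : ℕ}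
    (hij : i ≤ j) (hj : j ≤ n) : F n ≫ L.edge n i j = K.edge n i j ≫ K.ofA ≫ F 1 ≫ L.fst 0 := by
  let α : ⦋1⦌ ⟶ ⦋n⦌ := SimplexCategory.mkOfLe ⟨i, by omega⟩ ⟨j, by omega⟩ hij
  have h (K : RelCat S) : ∃ e : K.pow n ⟶ K.pow 1, e = K.nerve.map α.op ∧
      e ≫ K.fst 0 = K.edge n i j := ⟨_, rfl, RelCat.nerve_map_mkOfLe _ _ hij⟩
  obtain ⟨e, he, he'⟩ := h K
  obtain ⟨e₁, he₁, he₁'⟩ := h L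
  have hn : e ≫ F 1 = F n ≫ e₁ := by
    rw [he, he₁, hF, hF]
    exact f.naturality α.op
  rw [← he', ← he₁', ← reassoc_of% hn]
  simp

instance : (nerve S).Faithful := by
  have : (nerve S ⋙ SimpMon.trunc S).Faithful := Functor.Faithful.of_iso (nerveTruncIso S).symm
  exact Functor.Faithful.of_comp _ (SimpMon.trunc S)

instance : (nerve S).Full where
  map_surjective {K L} f := by
    -- The only candidate is the relative functor whose underlying graph morphism is the truncation
    -- of `f`.
    obtain ⟨g, hg⟩ := ((isCatMon S).ι ⋙ RelCat.forget S).map_surjective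
      ((nerveTruncIso S).inv.app K ≫ (SimpMon.trunc S).map f ≫ (nerveTruncIso S).hom.app L)
    have ha : g.hom.graph.a = K.obj.ofA ≫ f.hom.app (Opposite.op ⦋1⦌) ≫ L.obj.fst 0 :=
      congrArg ReflGraph.Hom.a hg
    refine ⟨g, ObjectProperty.hom_ext _ (NatTrans.ext (funext fun x => ?_))⟩
    change powMap g.hom.graph x.unop.len = f.hom.app x
    -- Both simplicial morphisms agree in degree `1`, hence on all edges, and edges detect equality.
    apply RelCat.pow_ext_edge (K := L.obj)
    intro i j hij hj
    refine (RelCat.powMap_edge g.hom hij hj).trans ?_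
    rw [ha]
    exact (app_edge f.hom (fun n => f.hom.app (Opposite.op ⦋n⦌)) (fun _ => rfl) hij hj).symm

end CatMon

open Simplicial SimplexCategory

/-! ### Edges, vertices and triangles of a simplicial object -/

section SimplicialMorphisms

variable {D : Type u} [Category.{v} D] (X : SimplicialObject D)

/-- The edge `i ⟶ j`. -/
def edgeMap {n : ℕ} (i j : Fin (n + 1)) (h : i ≤ j) : X _⦋n⦌ ⟶ X _⦋1⦌ := X.map (mkOfLe i j h).op

/-- The last edge of a simplex. -/
def lastEdge (n : ℕ) : X _⦋n + 1⦌ ⟶ X _⦋1⦌ :=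
  edgeMap X (Fin.last n).castSucc (Fin.last (n + 1)) (Fin.le_last _)

/-- The last vertex of a simplex. -/
def lastVertex (n : ℕ) : X _⦋n⦌ ⟶ X _⦋0⦌ := X.map (SimplexCategory.const ⦋0⦌ ⦋n⦌ (Fin.last n)).op

/-- The iterated degeneracy under which the arrow of a `1`-simplex becomes the last edge. -/
def lastDegen (n : ℕ) : X _⦋1⦌ ⟶ X _⦋n + 1⦌ :=
  match n with
  | 0 => 𝟙 _
  | n + 1 => lastDegen n ≫ X.σ (Fin.last n).castSucc

theorem lastVertex_zero : lastVertex X 0 = 𝟙 _ := by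
  rw [lastVertex, ← X.map_id]
  congr 2
  exact SimplexCategory.Hom.ext_zero_left _ _

theorem map_edgeMap {a b : ℕ} (α : (⦋a⦌ : SimplexCategory) ⟶ ⦋b⦌) (i j : Fin (a + 1)) (h : i ≤ j) :
    X.map α.op ≫ edgeMap X i j h = edgeMap X (α i) (α j) (α.toOrderHom.monotone h) := by
  rw [edgeMap, edgeMap, ← X.map_comp, ← op_comp]
  congr 2
  exact SimplexCategory.Hom.ext_one_left _ _

theorem map_edgeMap_assoc {a b : ℕ} (α : (⦋a⦌ : SimplexCategory) ⟶ ⦋b⦌) (i j : Fin (a + 1))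
    (h : i ≤ j) {Z : D} (z : _ ⟶ Z) :
    X.map α.op ≫ edgeMap X i j h ≫ z = edgeMap X (α i) (α j) (α.toOrderHom.monotone h) ≫ z := by
  simpa only [Category.assoc, Category.id_comp] using map_edgeMap X α i j h =≫ z

theorem δ_last_edgeMap {n : ℕ} (i j : Fin (n + 1)) (h : i ≤ j) :
    X.δ (Fin.last (n + 1)) ≫ edgeMap X i j h = edgeMap X i.castSucc j.castSucc h := by
  refine (map_edgeMap X (SimplexCategory.δ (Fin.last (n + 1))) i j h).trans ?_
  congr 1 <;> exact Fin.succAbove_last_apply _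

theorem δ_last_edgeMap_assoc {n : ℕ} (i j : Fin (n + 1)) (h : i ≤ j) {Z : D} (z : _ ⟶ Z) :
    X.δ (Fin.last (n + 1)) ≫ edgeMap X i j h ≫ z = edgeMap X i.castSucc j.castSucc h ≫ z := by
  simpa only [Category.assoc, Category.id_comp] using δ_last_edgeMap X i j h =≫ z

theorem σ_last_lastEdge (n : ℕ) :
    X.σ (Fin.last n) ≫ lastEdge X n = lastVertex X n ≫ X.σ (0 : Fin 1) := by
  rw [lastEdge, edgeMap, lastVertex]
  change X.map (SimplexCategory.σ _).op ≫ _ = _ ≫ X.map (SimplexCategory.σ _).op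
  rw [← X.map_comp, ← X.map_comp, ← op_comp, ← op_comp]
  congr 2
  refine SimplexCategory.Hom.ext_one_left _ _ ?_ ?_
  · exact Fin.predAbove_last_castSucc
  · exact Fin.predAbove_right_last

theorem lastEdge_t (n : ℕ) : lastEdge X n ≫ X.δ (0 : Fin 2) = lastVertex X (n + 1) := by
  change X.map _ ≫ X.map (SimplexCategory.δ _).op = _
  rw [lastVertex, ← X.map_comp, ← op_comp]
  congr 2
  exact SimplexCategory.Hom.ext_zero_left _ _

theorem lastEdge_s (n : ℕ) :
    lastEdge X n ≫ X.δ (1 : Fin 2) = X.δ (Fin.last (n + 1)) ≫ lastVertex X n := by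
  change X.map _ ≫ X.map (SimplexCategory.δ _).op = X.map (SimplexCategory.δ _).op ≫ X.map _
  rw [← X.map_comp, ← op_comp, ← X.map_comp, ← op_comp]
  congr 2
  refine SimplexCategory.Hom.ext_zero_left _ _ ?_
  exact (Fin.succAbove_last_apply (Fin.last n)).symm

theorem lastDegen_lastEdge (n : ℕ) : lastDegen X n ≫ lastEdge X n = 𝟙 _ := by
  induction n with
  | zero =>
    rw [lastDegen, lastEdge, edgeMap, Category.id_comp, ← X.map_id]
    congr 2
    exact SimplexCategory.Hom.ext_one_left _ _
  | succ n ih =>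
    rw [lastDegen, Category.assoc]
    refine Eq.trans (congrArg (_ ≫ ·) ?_) ih
    refine (map_edgeMap X (SimplexCategory.σ (Fin.last n).castSucc) _ _ _).trans ?_
    rw [lastEdge]
    congr 1
    · change Fin.predAbove _ _ = _
      ext
      simp [Fin.predAbove, Fin.lt_def]
    · change Fin.predAbove _ _ = _
      ext
      simp [Fin.predAbove, Fin.lt_def]

theorem edgeMap_self_last (n : ℕ) :
    edgeMap X (Fin.last n) (Fin.last n) le_rfl = lastVertex X n ≫ X.σ (0 : Fin 1) := by
  rw [edgeMap, lastVertex]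
  change _ = _ ≫ X.map (SimplexCategory.σ _).op
  rw [← X.map_comp, ← op_comp]
  congr 2
  exact SimplexCategory.Hom.ext_one_left _ _

/-- The triangle on the vertices `i`, `n` and `n + 1`. -/
def lastTriangle {n : ℕ} (i : Fin (n + 1)) : X _⦋n + 1⦌ ⟶ X _⦋2⦌ :=
  X.map (mkOfLeComp i.castSucc (Fin.last n).castSucc (Fin.last (n + 1))
    (Fin.castSucc_le_castSucc_iff.2 (Fin.le_last i)) (Fin.le_last _)).op

theorem lastTriangle_lastEdge {n : ℕ} (i : Fin (n + 1)) :
    lastTriangle X i ≫ lastEdge X 1 = lastEdge X n := by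
  rw [lastTriangle, lastEdge, lastEdge, map_edgeMap]
  rfl

theorem lastTriangle_lastEdge_assoc {n : ℕ} (i : Fin (n + 1)) {Z : D} (z : _ ⟶ Z) :
    lastTriangle X i ≫ lastEdge X 1 ≫ z = lastEdge X n ≫ z := by
  simpa only [Category.assoc, Category.id_comp] using lastTriangle_lastEdge X i =≫ z

theorem lastTriangle_δ_two {n : ℕ} (i : Fin (n + 1)) :
    lastTriangle X i ≫ X.δ (2 : Fin 3) =
      X.δ (Fin.last (n + 1)) ≫ edgeMap X i (Fin.last n) (Fin.le_last i) := by
  rw [δ_last_edgeMap, lastTriangle, edgeMap]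
  change _ ≫ X.map (SimplexCategory.δ _).op = _
  rw [← X.map_comp, ← op_comp]
  congr 2
  exact SimplexCategory.Hom.ext_one_left _ _

theorem lastTriangle_δ_two_assoc {n : ℕ} (i : Fin (n + 1)) {Z : D} (z : _ ⟶ Z) :
    lastTriangle X i ≫ X.δ (2 : Fin 3) ≫ z =
      X.δ (Fin.last (n + 1)) ≫ edgeMap X i (Fin.last n) (Fin.le_last i) ≫ z := by
  simpa only [Category.assoc, Category.id_comp] using lastTriangle_δ_two X i =≫ z

theorem lastTriangle_δ_one {n : ℕ} (i : Fin (n + 1)) :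
    lastTriangle X i ≫ X.δ (1 : Fin 3) =
      edgeMap X i.castSucc (Fin.last (n + 1)) (Fin.le_last _) := by
  rw [lastTriangle, edgeMap]
  change _ ≫ X.map (SimplexCategory.δ _).op = _
  rw [← X.map_comp, ← op_comp]
  congr 2
  exact SimplexCategory.Hom.ext_one_left _ _

theorem lastTriangle_δ_one_assoc {n : ℕ} (i : Fin (n + 1)) {Z : D} (z : _ ⟶ Z) :
    lastTriangle X i ≫ X.δ (1 : Fin 3) ≫ z =
      edgeMap X i.castSucc (Fin.last (n + 1)) (Fin.le_last _) ≫ z := by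
  simpa only [Category.assoc, Category.id_comp] using lastTriangle_δ_one X i =≫ z

end SimplicialMorphisms

open Simplicial

variable {C : Type u} [Category.{v} C] [MonoidalCategory C] {S : SpanClass C}

/-! ### Splitting of simplicial monoids of Moore length 1 -/

section Kernel

variable (S) in
/-- A monoid `Y` over `X_1`, meant to be the kernel of `∂_1`, such that `X_{n+1}` is isomorphic to
`Y ⊗ X_n` via the iterated degeneracies. -/
structure KernelSplitting (X : SimplicialObject (Mon C)) where
  Y : Mon C
  p : Y ⟶ X _⦋1⦌
  e : Y.X ⟶ 𝟙_ C
  mem : S.mem p.hom e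
  δ_last (n : ℕ) : (p ≫ lastDegen X n ≫ X.δ (Fin.last (n + 1))).hom = e ≫ MonObj.one
  isIso (n : ℕ) : IsIso (((p ≫ lastDegen X n).hom ⊗ₘ (X.σ (Fin.last n)).hom) ≫ MonObj.mul)

namespace MooreStep

variable {X Y : SimplicialObject (Mon C)} (Q : MooreStep S X Y)

theorem one_y (m : ℕ) : (λ_ (𝟙_ C)).inv ≫ (MonObj.one ⊗ₘ MonObj.one) ≫ Q.y m = MonObj.one := by
  rw [y, tensorHom_comp_tensorHom_assoc]
  simp [← unitors_equal]

theorem one_whiskerRight_y (m : ℕ) :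
    (λ_ (X _⦋m⦌).X).inv ≫ (MonObj.one ▷ (X _⦋m⦌).X) ≫ Q.y m = (X.σ (Fin.last m)).hom := by
  rw [y, ← tensorHom_id, tensorHom_comp_tensorHom_assoc]
  simp

theorem isIso_one {m : ℕ} (_ : IsIso (Q.y m)) (_ : IsIso (MonObj.one (X := (X _⦋m⦌).X)))
    (_ : IsIso (MonObj.one (X := (Y _⦋m⦌).X))) : IsIso (MonObj.one (X := (X _⦋m + 1⦌).X)) := by
  rw [← Q.one_y m]
  infer_instance

/-- The last degeneracy is `y` restricted along the unit of its first factor, so it is invertible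
when that unit is. -/
theorem isIso_σ_last {m : ℕ} (_ : IsIso (Q.y m)) (_ : IsIso (MonObj.one (X := (Y _⦋m⦌).X))) :
    IsIso (X.σ (Fin.last m)).hom := by
  rw [← Q.one_whiskerRight_y m]
  infer_instance

end MooreStep

/-- The iterated last degeneracy of a simplicial object. -/
def iterDegen {D : Type*} [Category* D] (X : SimplicialObject D) (n : ℕ) : X _⦋0⦌ ⟶ X _⦋n⦌ :=
  match n with
  | 0 => 𝟙 _
  | n + 1 => iterDegen X n ≫ X.σ (Fin.last n)

theorem MooreStep.iterDegen_p {X Y : SimplicialObject (Mon C)} (Q : MooreStep S X Y) (n : ℕ) :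
    iterDegen Y n ≫ Q.p n = Q.p 0 ≫ lastDegen X n := by
  induction n with
  | zero => simp [iterDegen, lastDegen]
  | succ n ih => rw [iterDegen, lastDegen, Category.assoc, Q.σ_p, reassoc_of% ih]

theorem MooreStep.iterDegen_pI {X Y : SimplicialObject (Mon C)} (Q : MooreStep S X Y) (n : ℕ) :
    (iterDegen Y n).hom ≫ Q.pI n = Q.pI 0 := by
  induction n with
  | zero => simp [iterDegen]
  | succ n ih => rw [iterDegen, Mon.comp_hom', Category.assoc, Q.σ_pI, ih]

/-- The object in question is `S_n^{(k+2)}` with `n = m + k + 2`. For `m = 0` triviality is the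
assumption on the Moore length; in the inductive step `y` presents the next object as a product of
two objects already known to be trivial. -/
theorem MooreTower.isIso_one {X : SimplicialObject (Mon C)} (T : MooreTower S X)
    (hT : T.HasLength 1) (hy : ∀ k m, IsIso ((T.step k).y m)) (m k : ℕ) :
    IsIso (MonObj.one (X := (T.M (k + 1) _⦋m⦌).X)) := by
  induction m generalizing k with
  | zero =>
    obtain ⟨h₁, h₂⟩ := hT (k + 1) (by omega)
    exact ⟨_, h₂, h₁⟩
  | succ m ih => exact (T.step (k + 2)).isIso_one (hy _ _) (ih k) (ih (k + 1))

/-- The first step of a Moore tower of length `1` splits. -/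
noncomputable def MooreTower.kernelSplitting {X : SimplicialObject (Mon C)} (T : MooreTower S X)
    (hT : T.HasLength 1) (hy : ∀ k m, IsIso ((T.step k).y m)) : KernelSplitting S X where
  Y := T.M 0 _⦋0⦌
  p := (T.step 0).p 0
  e := (T.step 0).pI 0
  mem := ((T.step 0).isRelPullback 0).mem
  δ_last n := by
    have h := (T.step 0).iterDegen_p n
    have h' := ((T.step 0).isRelPullback n).w
    rw [← reassoc_of% h, Mon.comp_hom', Mon.comp_hom']
    refine (congrArg (_ ≫ ·) h').trans ?_
    rw [← Category.assoc, (T.step 0).iterDegen_pI]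
  isIso n := by
    -- Triviality of the second kernels makes the last degeneracies of the first kernels invertible.
    -- Thus all `S_{n+1}^{(1)}` are identified with `Y = S_1^{(1)}`, and the required morphism is
    -- `y_{(n+1,0)}` up to this identification.
    have hσ (m : ℕ) : IsIso ((T.M 0).σ (Fin.last m)).hom :=
      (T.step 1).isIso_σ_last (hy 1 m) (T.isIso_one hT hy m 0)
    have hi : IsIso (iterDegen (T.M 0) n).hom := by
      induction n with
      | zero => exact inferInstanceAs (IsIso (𝟙 (T.M 0 _⦋0⦌).X))
      | succ n ih =>
        have := hσ n
        exact inferInstanceAs (IsIso ((iterDegen (T.M 0) n).hom ≫ ((T.M 0).σ (Fin.last n)).hom))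
    have := hy 0 n
    have e : ((((T.step 0).p 0 ≫ lastDegen X n).hom ⊗ₘ (X.σ (Fin.last n)).hom) ≫ MonObj.mul) =
        ((iterDegen (T.M 0) n).hom ▷ (X _⦋n⦌).X) ≫ (T.step 0).y n := by
      rw [← (T.step 0).iterDegen_p n, MooreStep.y, ← tensorHom_id]
      erw [tensorHom_comp_tensorHom_assoc]
      rw [Category.id_comp]
      rfl
    erw [e]
    infer_instance

end Kernel

/-! ### Comparison of a simplicial monoid with the powers of its truncation -/

namespace KernelSplitting

variable {X : SimplicialObject (Mon C)} (K : KernelSplitting S X)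

/-- The isomorphism `Y ⊗ X_n ⟶ X_{n+1}`. -/
noncomputable def y (n : ℕ) : K.Y.X ⊗ (X _⦋n⦌).X ⟶ (X _⦋n + 1⦌).X :=
  ((K.p ≫ lastDegen X n).hom ⊗ₘ (X.σ (Fin.last n)).hom) ≫ MonObj.mul

instance (n : ℕ) : IsIso (K.y n) := K.isIso n

theorem y_comp {n : ℕ} {M : Mon C} (f : X _⦋n + 1⦌ ⟶ M) :
    K.y n ≫ f.hom =
      ((K.p ≫ lastDegen X n ≫ f).hom ⊗ₘ (X.σ (Fin.last n) ≫ f).hom) ≫ MonObj.mul := by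
  rw [y, Category.assoc, tensor_mul_comp]
  simp

theorem y_comp_lastEdge (n : ℕ) :
    K.y n ≫ (lastEdge X n).hom =
      (K.p.hom ⊗ₘ (lastVertex X n ≫ X.σ (0 : Fin 1)).hom) ≫ MonObj.mul := by
  rw [y_comp, lastDegen_lastEdge, σ_last_lastEdge, Category.comp_id]

theorem y_comp_δ_last (n : ℕ) :
    K.y n ≫ (X.δ (Fin.last (n + 1))).hom = K.e ▷ _ ≫ (λ_ (X _⦋n⦌).X).hom := by
  rw [y_comp, K.δ_last]
  have h : X.σ (Fin.last n) ≫ X.δ (Fin.last (n + 1)) = 𝟙 _ := X.δ_comp_σ_succ (i := Fin.last n)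
  rw [h, ← MonObj.one_mul, ← tensorHom_id, ← tensorHom_id, tensorHom_comp_tensorHom_assoc,
    Category.comp_id]
  rfl

variable [HasLegPullbacks S] (legs : LegsMem S X)

/-- Along the isomorphism `Y ⊗ X_n ≅ X_{n+1}` the span is obtained from the product of two spans in
the class: the projections of the kernel `Y`, and the span of `φ` and the degenerate last vertex.
This is what allows the comparison morphism to be lifted to the next relative pullback. -/
theorem mem_segal (K : KernelSplitting S X) {n : ℕ} (φ : X _⦋n⦌ ⟶ (truncGraph X legs).pow n)
    (hφ : φ ≫ (truncGraph X legs).tgt n = lastVertex X n) :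
    S.mem (lastEdge X n).hom (X.δ (Fin.last (n + 1)) ≫ φ).hom := by
  have h₁ : S.mem (lastVertex X n ≫ X.σ (0 : Fin 1)).hom φ.hom := by
    rw [← hφ]
    simpa using S.post (X.σ (0 : Fin 1)).hom (𝟙 _) (S.pre φ.hom ((truncGraph X legs).mem_tgt n))
  have h₂ := S.post MonObj.mul (λ_ _).hom (S.multiplicative K.mem h₁)
  have h₃ := S.pre (inv (K.y n)) h₂
  have e : (K.e ⊗ₘ φ.hom) ≫ (λ_ _).hom = K.y n ≫ (X.δ (Fin.last (n + 1)) ≫ φ).hom := by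
    rw [Mon.comp_hom', ← Category.assoc, y_comp_δ_last,
      MonoidalCategory.tensorHom_def, Category.assoc,
      leftUnitor_naturality, Category.assoc]
  rwa [← y_comp_lastEdge, e, IsIso.inv_hom_id_assoc, IsIso.inv_hom_id_assoc] at h₃

theorem lastEdge_comp_s {n : ℕ} (φ : X _⦋n⦌ ⟶ (truncGraph X legs).pow n)
    (hφ : φ ≫ (truncGraph X legs).tgt n = lastVertex X n) :
    lastEdge X n ≫ (truncGraph X legs).s =
      (X.δ (Fin.last (n + 1)) ≫ φ) ≫ (truncGraph X legs).tgt n := by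
  rw [Category.assoc, hφ]
  exact lastEdge_s X n

/-- The comparison morphisms `X_n ⟶ X_1^{□ n}`, with their compatibility with the morphisms
to `X_0`. -/
noncomputable def segalAux (n : ℕ) : {φ : X _⦋n⦌ ⟶ (truncGraph X legs).pow n //
    φ ≫ (truncGraph X legs).tgt n = lastVertex X n} :=
  match n with
  | 0 => ⟨(truncGraph X legs).ofB, (ReflGraph.ofB_tgt _).trans (lastVertex_zero X).symm⟩
  | n + 1 => ⟨(truncGraph X legs).lift (lastEdge X n) (X.δ (Fin.last (n + 1)) ≫ (segalAux n).1)
      (K.mem_segal legs _ (segalAux n).2) (lastEdge_comp_s legs _ (segalAux n).2), by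
      rw [ReflGraph.tgt_succ, ← Category.assoc, ReflGraph.lift_fst]
      exact lastEdge_t X n⟩

/-- The comparison morphism `X_n ⟶ X_1^{□ n}`. -/
noncomputable def segal (n : ℕ) : X _⦋n⦌ ⟶ (truncGraph X legs).pow n := (K.segalAux legs n).1

theorem segal_tgt (n : ℕ) : K.segal legs n ≫ (truncGraph X legs).tgt n = lastVertex X n :=
  (K.segalAux legs n).2

theorem segal_tgt_assoc (n : ℕ) {Z : Mon C} (z : _ ⟶ Z) :
    K.segal legs n ≫ (truncGraph X legs).tgt n ≫ z = lastVertex X n ≫ z := by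
  simpa only [Category.assoc, Category.id_comp] using K.segal_tgt legs n =≫ z

theorem segal_fst (n : ℕ) : K.segal legs (n + 1) ≫ (truncGraph X legs).fst n = lastEdge X n :=
  ReflGraph.lift_fst _ _ _ (K.mem_segal legs _ (K.segalAux legs n).2)
    (lastEdge_comp_s legs _ (K.segalAux legs n).2)

theorem segal_rest (n : ℕ) : K.segal legs (n + 1) ≫ (truncGraph X legs).rest n =
    X.δ (Fin.last (n + 1)) ≫ K.segal legs n :=
  ReflGraph.lift_rest _ _ _ (K.mem_segal legs _ (K.segalAux legs n).2)
    (lastEdge_comp_s legs _ (K.segalAux legs n).2)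

theorem segal_one : K.segal legs 1 = (truncGraph X legs).ofA := by
  rw [← cancel_mono ((truncGraph X legs).fst 0), segal_fst, ReflGraph.ofA_fst]
  exact lastDegen_lastEdge X 0 ▸ (Category.id_comp _).symm

theorem σ_last_segal (n : ℕ) :
    X.σ (Fin.last n) ≫ K.segal legs (n + 1) =
      K.segal legs n ≫ (truncGraph X legs).insertFirst n := by
  apply ReflGraph.pow_ext
  · rw [Category.assoc, segal_fst, Category.assoc, ReflGraph.insertFirst_fst, segal_tgt_assoc,
      σ_last_lastEdge]
  · have h : X.σ (Fin.last n) ≫ X.δ (Fin.last (n + 1)) = 𝟙 _ := X.δ_comp_σ_succ (i := Fin.last n)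
    rw [Category.assoc, segal_rest, Category.assoc, ReflGraph.insertFirst_rest, reassoc_of% h,
      Category.comp_id]

/-- An iterated degeneracy of an arrow has that arrow as its last edge. For an arrow in the kernel
of `∂_1` the remaining components are trivial, as the kernel property says on both sides. -/
theorem p_lastDegen_segal (n : ℕ) :
    (K.p ≫ lastDegen X n ≫ K.segal legs (n + 1)).hom =
      (K.p ≫ (truncGraph X legs).insertRest n).hom := by
  apply ((truncGraph X legs).isRelPullback n).hom_ext
  · rw [← Mon.comp_hom', ← Mon.comp_hom']
    simp only [Category.assoc]
    rw [segal_fst, lastDegen_lastEdge, ReflGraph.insertRest_fst]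
  · rw [← Mon.comp_hom', ← Mon.comp_hom']
    simp only [Category.assoc]
    have h := K.δ_last n
    have h₀ := K.δ_last 0
    rw [segal_rest, ReflGraph.insertRest_rest]
    have e : (K.p ≫ (truncGraph X legs).s).hom = K.e ≫ MonObj.one := by
      rw [← h₀]
      exact congrArg (fun f => (K.p ≫ f).hom) (Category.id_comp _).symm
    have e₁ : K.p ≫ lastDegen X n ≫ X.δ (Fin.last (n + 1)) ≫ K.segal legs n =
        (K.p ≫ lastDegen X n ≫ X.δ (Fin.last (n + 1))) ≫ K.segal legs n := by
      simp
    have e₂ : K.p ≫ (truncGraph X legs).s ≫ (truncGraph X legs).diag n =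
        (K.p ≫ (truncGraph X legs).s) ≫ (truncGraph X legs).diag n := by
      rw [Category.assoc]
    rw [e₁, e₂, Mon.comp_hom', h, Mon.comp_hom', e, Category.assoc, Category.assoc,
      IsMonHom.one_hom, IsMonHom.one_hom]

/-- The comparison matches the two product decompositions piece by piece; as `y` and `q` are both
invertible, invertibility passes from degree `n` to degree `n + 1`. -/
theorem y_comp_segal (n : ℕ) :
    K.y n ≫ (K.segal legs (n + 1)).hom =
      (K.Y.X ◁ (K.segal legs n).hom) ≫ (truncGraph X legs).q K.p.hom n := by
  rw [y_comp, p_lastDegen_segal, σ_last_segal, ReflGraph.q_eq, ← id_tensorHom,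
    tensorHom_comp_tensorHom_assoc, Category.id_comp, Mon.comp_hom', Mon.comp_hom']

theorem isIso_segal (hq : ∀ n, IsIso ((truncGraph X legs).q K.p.hom n)) (n : ℕ) :
    IsIso (K.segal legs n) := by
  induction n with
  | zero => exact ⟨(truncGraph X legs).tgt 0, ReflGraph.ofB_tgt _, ReflGraph.tgt_ofB _⟩
  | succ n ih =>
    have := hq n
    have h : IsIso (K.y n ≫ (K.segal legs (n + 1)).hom) := by
      rw [y_comp_segal]
      infer_instance
    have h' : IsIso ((Mon.forget C).map (K.segal legs (n + 1))) :=
      IsIso.of_isIso_comp_left (K.y n) (K.segal legs (n + 1)).hom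
    exact isIso_of_reflects_iso _ (Mon.forget C)

section Category

variable (hq : ∀ n, IsIso ((truncGraph X legs).q K.p.hom n))

/-- Under the comparison `1 □ i` is the degeneracy `σ_0`, so that the unit law `d (1 □ i) = 1`
becomes `∂_1 σ_0 = 1`. -/
theorem insertRest_one_eq :
    (truncGraph X legs).insertRest 1 = X.σ (0 : Fin 2) ≫ K.segal legs 2 := by
  have e : lastDegen X 1 = X.σ (0 : Fin 2) := Category.id_comp _
  apply ReflGraph.pow_ext
  · rw [ReflGraph.insertRest_fst, Category.assoc, segal_fst, ← e, lastDegen_lastEdge]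
  · have h : X.σ (0 : Fin 2) ≫ X.δ (2 : Fin 3) = X.δ (1 : Fin 2) ≫ X.σ (0 : Fin 1) :=
      X.δ_comp_σ_of_gt (i := (1 : Fin 2)) (j := (0 : Fin 1)) (by decide)
    rw [ReflGraph.insertRest_rest, Category.assoc, segal_rest, ReflGraph.diag_one, segal_one]
    exact ((reassoc_of% h) (truncGraph X legs).ofA).symm

/-- The relative category on the truncation of a simplicial monoid whose comparison morphisms are
invertible. -/
noncomputable def relCat : RelCat S :=
  have := K.isIso_segal legs hq 2
  ReflGraph.relCatOfUnital (G := truncGraph X legs) K.p.hom hq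
    -- A composable pair is filled to a unique `2`-simplex, whose face `∂_1` is the composite.
    (inv (K.segal legs 2) ≫ X.δ (1 : Fin 3))
    (by
      have h : X.σ (0 : Fin 2) ≫ X.δ (1 : Fin 3) = 𝟙 _ := X.δ_comp_σ_succ (i := (0 : Fin 2))
      rw [insertRest_one_eq, Category.assoc, IsIso.hom_inv_id_assoc]
      exact h)
    (by
      have h : X.σ (1 : Fin 2) ≫ X.δ (1 : Fin 3) = 𝟙 _ := X.δ_comp_σ_self (i := (1 : Fin 2))
      have h' := K.σ_last_segal legs 1
      rw [segal_one] at h'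
      rw [← reassoc_of% h', IsIso.hom_inv_id_assoc]
      exact h)

theorem segal_d :
    K.segal legs 2 ≫ (K.relCat legs hq).d = X.δ (1 : Fin 3) := by
  have := K.isIso_segal legs hq 2
  exact IsIso.hom_inv_id_assoc (K.segal legs 2) (X.δ (1 : Fin 3))

end Category

end KernelSplitting

open Simplicial ReflGraph CompGraph

variable {C : Type u} [Category.{v} C] [MonoidalCategory C] {S : SpanClass C} [HasLegPullbacks S]

namespace KernelSplitting

variable {X : SimplicialObject (Mon C)} (K : KernelSplitting S X) (legs : LegsMem S X)
  (hq : ∀ n, IsIso ((truncGraph X legs).q K.p.hom n))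

/-- The comparison morphism `X_n ⟶ A^{□ n}` to the nerve of the truncation. -/
noncomputable def toNerve (n : ℕ) : X _⦋n⦌ ⟶ (K.relCat legs hq).pow n := K.segal legs n

/-- The equality of `X_1` and the monoid of arrows of the truncation, as an identity morphism. -/
noncomputable def toArrows : X _⦋1⦌ ⟶ (K.relCat legs hq).A := 𝟙 (X _⦋1⦌)

theorem toNerve_fst (n : ℕ) :
    K.toNerve legs hq (n + 1) ≫ (K.relCat legs hq).fst n = lastEdge X n ≫ K.toArrows legs hq :=
  (K.segal_fst legs n).trans (Category.comp_id _).symm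

theorem toNerve_rest (n : ℕ) : K.toNerve legs hq (n + 1) ≫ (K.relCat legs hq).rest n =
    X.δ (Fin.last (n + 1)) ≫ K.toNerve legs hq n :=
  K.segal_rest legs n

theorem toNerve_rest_assoc (n : ℕ) {Z : Mon C} (z : _ ⟶ Z) :
    K.toNerve legs hq (n + 1) ≫ (K.relCat legs hq).rest n ≫ z =
      X.δ (Fin.last (n + 1)) ≫ K.toNerve legs hq n ≫ z := by
  simpa only [Category.assoc, Category.id_comp] using K.toNerve_rest legs hq n =≫ z

theorem toNerve_d :
    K.toNerve legs hq 2 ≫ (K.relCat legs hq).d = X.δ (1 : Fin 3) ≫ K.toArrows legs hq :=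
  (K.segal_d legs hq).trans (Category.comp_id _).symm

theorem toNerve_one_fst :
    K.toNerve legs hq 1 ≫ (K.relCat legs hq).fst 0 = K.toArrows legs hq := by
  have h : lastEdge X 0 = 𝟙 _ := (Category.id_comp _).symm.trans (lastDegen_lastEdge X 0)
  rw [toNerve_fst, h, Category.id_comp]

theorem toNerve_tgt_i (n : ℕ) :
    K.toNerve legs hq n ≫ (K.relCat legs hq).tgt n ≫ (K.relCat legs hq).i =
      edgeMap X (Fin.last n) (Fin.last n) le_rfl ≫ K.toArrows legs hq := by
  rw [edgeMap_self_last]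
  exact (K.segal_tgt_assoc legs n (X.σ (0 : Fin 1))).trans (Category.comp_id _).symm

/-- Edges among the lower vertices are inherited through the last face. An edge from `i` to the new
last vertex is the face `∂_1` of the triangle on `i`, `n` and `n + 1`, that is, the composite of its
other two edges. -/
theorem toNerve_edge {n : ℕ} (i j : Fin (n + 1)) (hij : i ≤ j) :
    K.toNerve legs hq n ≫ (K.relCat legs hq).edge n i j =
      edgeMap X i j hij ≫ K.toArrows legs hq := by
  have h₀ (n : ℕ) : K.toNerve legs hq n ≫ (K.relCat legs hq).edge n n n =
      edgeMap X (Fin.last n) (Fin.last n) le_rfl ≫ K.toArrows legs hq := by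
    rw [edge_self_last, toNerve_tgt_i]
  induction n with
  | zero =>
    obtain rfl := Fin.fin_one_eq_zero i
    obtain rfl := Fin.fin_one_eq_zero j
    exact h₀ 0
  | succ n ih =>
    induction j using Fin.lastCases with
    | cast j =>
      obtain ⟨i, rfl⟩ : ∃ i' : Fin (n + 1), i'.castSucc = i :=
        Fin.exists_castSucc_eq.2 (by rintro rfl; exact absurd hij (by simp))
      rw [Fin.val_castSucc, Fin.val_castSucc, edge_succ_of_le _ (Nat.lt_succ_iff.1 j.2),
        toNerve_rest_assoc, ih i j hij, δ_last_edgeMap_assoc]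
    | last =>
      induction i using Fin.lastCases with
      | last => exact h₀ (n + 1)
      | cast i =>
        rw [Fin.val_last, Fin.val_castSucc, edge_succ_last _ (Nat.lt_succ_iff.1 i.2)]
        have h := ih i (Fin.last n) (Fin.le_last i)
        rw [Fin.val_last, edge_last] at h
        have e : K.toNerve legs hq (n + 1) ≫ oneBox ((K.relCat legs hq).edgeToLast n i).1
            ((K.relCat legs hq).edgeToLast n i).2 = lastTriangle X i ≫ K.toNerve legs hq 2 := by
          apply pow_ext
          · rw [Category.assoc, oneBox_fst, toNerve_fst, Category.assoc, toNerve_fst,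
              lastTriangle_lastEdge_assoc]
          · rw [Category.assoc, oneBox_rest, toNerve_rest_assoc, Category.assoc, toNerve_rest,
              ← cancel_mono ((K.relCat legs hq).fst 0), Category.assoc, Category.assoc, h,
              Category.assoc, Category.assoc, toNerve_one_fst]
            exact (lastTriangle_δ_two_assoc X i _).symm
        rw [reassoc_of% e, toNerve_d, lastTriangle_δ_one_assoc]

theorem isInduced_toNerve {a b : ℕ} (α : (⦋a⦌ : SimplexCategory) ⟶ ⦋b⦌)
    {k : (K.relCat legs hq).pow b ⟶ (K.relCat legs hq).pow a}
    (hk : (K.relCat legs hq).IsInduced α k) :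
    X.map α.op ≫ K.toNerve legs hq a = K.toNerve legs hq b ≫ k := by
  apply RelCat.pow_ext_edge
  intro i j hij hj
  have h₁ := K.toNerve_edge legs hq (n := a) ⟨i, by omega⟩ ⟨j, by omega⟩ hij
  have h₂ := hk ⟨i, by simp; omega⟩ ⟨j, by simp; omega⟩ hij
  dsimp only at h₁
  rw [Category.assoc, h₁, map_edgeMap_assoc, Category.assoc]
  exact ((congrArg (_ ≫ ·) h₂).trans (K.toNerve_edge legs hq _ _ _)).symm

/-- The comparison of a simplicial monoid with the nerve of its truncation. -/
noncomputable def isoNerve : X ≅ (K.relCat legs hq).nerve :=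
  NatIso.ofComponents
    (fun a =>
      have : IsIso (K.toNerve legs hq a.unop.len) := K.isIso_segal legs hq _
      (asIso (K.toNerve legs hq a.unop.len) : X _⦋a.unop.len⦌ ≅ (K.relCat legs hq).pow a.unop.len))
    (fun {a b} α => K.isInduced_toNerve legs hq (a := b.unop.len) (b := a.unop.len) α.unop
      ((K.relCat legs hq).isInduced_nerve_map α.unop))

end KernelSplitting

/-! ### The nerve is an equivalence, with truncation as its inverse -/

namespace CatMon

instance : (nerve S).EssSurj where
  mem_essImage X := by
    obtain ⟨T, hT, hy, hq⟩ := X.property.exists_tower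
    let K := T.kernelSplitting hT hy
    let R := K.relCat X.property.legs hq
    exact ⟨⟨R, _, _, _, (T.step 0).isRelPullback 0, hq⟩,
      ⟨ObjectProperty.isoMk _ (K.isoNerve X.property.legs hq).symm⟩⟩

noncomputable instance : (nerve S).IsEquivalence where

theorem exists_nerve_equivalence (S : SpanClass C) [HasLegPullbacks S] :
    ∃ e : CatMon S ≌ SimpMon S,
      (∃ φ : ∀ K : CatMon S, K.obj.NerveIso (e.functor.obj K).obj,
        ∀ (K L : CatMon S) (f : K ⟶ L) (n : ℕ),
          (e.functor.map f).hom.app (Opposite.op (SimplexCategory.mk n)) ≫ ((φ L).iso n).hom =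
            ((φ K).iso n).hom ≫ ReflGraph.powMap ((RelCat.forget S).map f.hom) n) ∧
      Nonempty (e.inverse ⋙ (isCatMon S).ι ⋙ RelCat.forget S ≅ SimpMon.trunc S) := by
  refine ⟨(nerve S).asEquivalence, ⟨fun K => K.obj.nerveIsoRefl, fun K L f n => ?_⟩, ⟨?_⟩⟩
  · exact (Category.comp_id _).trans (Category.id_comp _).symm
  -- Forgetting the composition is truncating the nerve, and the nerve of the inverse is the
  -- identity by the counit.
  · exact Functor.isoWhiskerLeft _ (nerveTruncIso S).symm ≪≫ (Functor.associator _ _ _).symm ≪≫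
      Functor.isoWhiskerRight (nerve S).asEquivalence.counitIso _ ≪≫ Functor.leftUnitor _

end CatMon

/-! ### Distributive laws and twisted monoids -/

section DistributiveLaws

variable {C : Type u} [Category.{v} C] [MonoidalCategory C]

theorem twistedMul_inl {Y B : C} (mY : Y ⊗ Y ⟶ Y) (mB : B ⊗ B ⟶ B) (x : B ⊗ Y ⟶ Y ⊗ B)
    (oB : 𝟙_ C ⟶ B) (uB : oB ▷ B ≫ mB = (λ_ B).hom)
    (h : oB ▷ Y ≫ x = (λ_ Y).hom ≫ (ρ_ Y).inv ≫ Y ◁ oB) :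
    mY ≫ (ρ_ Y).inv ≫ Y ◁ oB =
      (((ρ_ Y).inv ≫ Y ◁ oB) ⊗ₘ ((ρ_ Y).inv ≫ Y ◁ oB)) ≫ twistedMul mY mB x := by
  rw [twistedMul_eq, MonoidalCategory.tensorHom_def']
  symm
  calc
    _ = 𝟙 _ ⊗≫ (Y ⊗ Y) ◁ oB ⊗≫ Y ◁ (oB ▷ Y ≫ x) ▷ B ⊗≫ mY ▷ (B ⊗ B) ⊗≫ Y ◁ mB := by monoidal
    _ = 𝟙 _ ⊗≫ (Y ⊗ Y) ◁ oB ⊗≫ ((Y ⊗ Y) ◁ (oB ▷ B) ≫ mY ▷ (B ⊗ B)) ⊗≫ Y ◁ mB := by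
        rw [h]; monoidal
    _ = 𝟙 _ ⊗≫ (Y ⊗ Y) ◁ oB ⊗≫ mY ▷ (𝟙_ C ⊗ B) ⊗≫ Y ◁ (oB ▷ B ≫ mB) := by
        rw [whisker_exchange]; monoidal
    _ = 𝟙 _ ⊗≫ ((Y ⊗ Y) ◁ oB ≫ mY ▷ B) := by rw [uB]; monoidal
    _ = _ := by rw [whisker_exchange]; monoidal

/-- In the twisted monoid the product of `Y` and `B`, in this order, is the identity. Hence the two
factors generate it, and morphisms out of it can be compared on them. -/
theorem inl_inr_twistedMul {Y B : C} (mY : Y ⊗ Y ⟶ Y) (mB : B ⊗ B ⟶ B) (x : B ⊗ Y ⟶ Y ⊗ B)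
    (oY : 𝟙_ C ⟶ Y) (oB : 𝟙_ C ⟶ B) (uY : Y ◁ oY ≫ mY = (ρ_ Y).hom)
    (uB : oB ▷ B ≫ mB = (λ_ B).hom)
    (h : oB ▷ Y ≫ x = (λ_ Y).hom ≫ (ρ_ Y).inv ≫ Y ◁ oB) :
    (((ρ_ Y).inv ≫ Y ◁ oB) ⊗ₘ ((λ_ B).inv ≫ oY ▷ B)) ≫ twistedMul mY mB x = 𝟙 _ := by
  rw [twistedMul_eq, MonoidalCategory.tensorHom_def']
  calc
    _ = 𝟙 _ ⊗≫ Y ◁ oY ▷ B ⊗≫ Y ◁ (oB ▷ Y ≫ x) ▷ B ⊗≫ mY ▷ (B ⊗ B) ⊗≫ Y ◁ mB := by monoidal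
    _ = 𝟙 _ ⊗≫ Y ◁ oY ▷ B ⊗≫ ((Y ⊗ Y) ◁ (oB ▷ B) ≫ mY ▷ (B ⊗ B)) ⊗≫ Y ◁ mB := by
        rw [h]; monoidal
    _ = 𝟙 _ ⊗≫ (Y ◁ oY ≫ mY) ▷ B ⊗≫ Y ◁ (oB ▷ B ≫ mB) := by
        rw [whisker_exchange]; monoidal
    _ = _ := by rw [uY, uB]; monoidal

/-- The product in the opposite order recovers `x`, so the distributive law can be read off from the
multiplication and the two embeddings. -/
theorem inr_inl_twistedMul {Y B : C} (mY : Y ⊗ Y ⟶ Y) (mB : B ⊗ B ⟶ B) (x : B ⊗ Y ⟶ Y ⊗ B)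
    (oY : 𝟙_ C ⟶ Y) (oB : 𝟙_ C ⟶ B) (uY : oY ▷ Y ≫ mY = (λ_ Y).hom)
    (uB : B ◁ oB ≫ mB = (ρ_ B).hom) :
    (((λ_ B).inv ≫ oY ▷ B) ⊗ₘ ((ρ_ Y).inv ≫ Y ◁ oB)) ≫ twistedMul mY mB x = x := by
  rw [twistedMul_eq, MonoidalCategory.tensorHom_def']
  calc
    _ = 𝟙 _ ⊗≫ (B ⊗ Y) ◁ oB ⊗≫ (oY ▷ ((B ⊗ Y) ⊗ B) ≫ Y ◁ (x ▷ B)) ⊗≫ mY ▷ (B ⊗ B) ⊗≫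
          Y ◁ mB := by monoidal
    _ = 𝟙 _ ⊗≫ ((B ⊗ Y) ◁ oB ≫ x ▷ B) ⊗≫ (oY ▷ Y ≫ mY) ▷ (B ⊗ B) ⊗≫ Y ◁ mB := by
        rw [← whisker_exchange]; monoidal
    _ = 𝟙 _ ⊗≫ x ⊗≫ Y ◁ (B ◁ oB ≫ mB) := by
        rw [whisker_exchange, uY]; monoidal
    _ = _ := by rw [uB]; monoidal

/-- If `m ∘ (r ⊗ i) : Y ⊗ B ⟶ A` is invertible for monoid morphisms `r` and `i`, then it induces a
distributive law. -/
theorem isDistribLaw_of_isIso {A B Y : Mon C} (r : Y ⟶ A) (i : B ⟶ A)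
    (_ : IsIso ((r.hom ⊗ₘ i.hom) ≫ MonObj.mul)) {x : B.X ⊗ Y.X ⟶ Y.X ⊗ B.X}
    (hx : x ≫ (r.hom ⊗ₘ i.hom) ≫ MonObj.mul = (i.hom ⊗ₘ r.hom) ≫ MonObj.mul) :
    IsDistribLaw B Y x := by
  have h₁ : x ▷ B.X ≫ (((r.hom ⊗ₘ i.hom) ≫ MonObj.mul) ⊗ₘ i.hom) =
      ((i.hom ⊗ₘ r.hom) ≫ MonObj.mul) ⊗ₘ i.hom := by
    rw [← hx, ← tensorHom_id, tensorHom_comp_tensorHom, Category.id_comp]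
  have h₂ : B.X ◁ x ≫ (i.hom ⊗ₘ ((r.hom ⊗ₘ i.hom) ≫ MonObj.mul)) =
      i.hom ⊗ₘ ((i.hom ⊗ₘ r.hom) ≫ MonObj.mul) := by
    rw [← hx, ← id_tensorHom, tensorHom_comp_tensorHom, Category.id_comp]
  have h₃ : x ▷ Y.X ≫ (((r.hom ⊗ₘ i.hom) ≫ MonObj.mul) ⊗ₘ r.hom) =
      ((i.hom ⊗ₘ r.hom) ≫ MonObj.mul) ⊗ₘ r.hom := by
    rw [← hx, ← tensorHom_id, tensorHom_comp_tensorHom, Category.id_comp]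
  have h₄ : Y.X ◁ x ≫ (r.hom ⊗ₘ ((r.hom ⊗ₘ i.hom) ≫ MonObj.mul)) =
      r.hom ⊗ₘ ((i.hom ⊗ₘ r.hom) ≫ MonObj.mul) := by
    rw [← hx, ← id_tensorHom, tensorHom_comp_tensorHom, Category.id_comp]
  -- After composition with the monomorphism `m (r ⊗ i)`, both sides of each axiom are iterated
  -- products in `A`, and `hx` replaces `x` by a product in the opposite order. The axioms thereby
  -- reduce to unitality and associativity of `A`.
  refine ⟨?_, ?_, ?_, ?_⟩ <;> rw [← cancel_mono ((r.hom ⊗ₘ i.hom) ≫ MonObj.mul)] <;>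
    simp only [Category.assoc, hx]
  · rw [← tensorHom_id, ← id_tensorHom, tensorHom_comp_tensorHom_assoc,
      tensorHom_comp_tensorHom_assoc]
    simp
  · rw [← tensorHom_id, ← id_tensorHom, tensorHom_comp_tensorHom_assoc,
      tensorHom_comp_tensorHom_assoc]
    simp
  · have e₁ : Y.X ◁ MonObj.mul ≫ (r.hom ⊗ₘ i.hom) ≫ MonObj.mul =
        (α_ _ _ _).inv ≫ (((r.hom ⊗ₘ i.hom) ≫ MonObj.mul) ⊗ₘ i.hom) ≫ MonObj.mul := by
      rw [tensor_mul_assoc, Iso.inv_hom_id_assoc, ← id_tensorHom, tensorHom_comp_tensorHom_assoc,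
        IsMonHom.mul_hom, Category.id_comp]
    have e₂ : MonObj.mul ▷ Y.X ≫ (i.hom ⊗ₘ r.hom) ≫ MonObj.mul =
        (((i.hom ⊗ₘ i.hom) ≫ MonObj.mul) ⊗ₘ r.hom) ≫ MonObj.mul := by
      rw [← tensorHom_id, tensorHom_comp_tensorHom_assoc, IsMonHom.mul_hom, Category.id_comp]
    rw [e₁, Iso.hom_inv_id_assoc, reassoc_of% h₁, tensor_mul_assoc, Iso.inv_hom_id_assoc,
      reassoc_of% h₂, e₂, tensor_mul_assoc]
  · have e₁ : MonObj.mul ▷ B.X ≫ (r.hom ⊗ₘ i.hom) ≫ MonObj.mul =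
        (α_ _ _ _).hom ≫ (r.hom ⊗ₘ ((r.hom ⊗ₘ i.hom) ≫ MonObj.mul)) ≫ MonObj.mul := by
      rw [← tensor_mul_assoc, ← tensorHom_id, tensorHom_comp_tensorHom_assoc, IsMonHom.mul_hom,
        Category.id_comp]
    have e₂ : B.X ◁ MonObj.mul ≫ (i.hom ⊗ₘ r.hom) ≫ MonObj.mul =
        (i.hom ⊗ₘ ((r.hom ⊗ₘ r.hom) ≫ MonObj.mul)) ≫ MonObj.mul := by
      rw [← id_tensorHom, tensorHom_comp_tensorHom_assoc, IsMonHom.mul_hom, Category.id_comp]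
    rw [e₁, Iso.inv_hom_id_assoc, reassoc_of% h₄, ← tensor_mul_assoc, reassoc_of% h₃,
      tensor_mul_assoc, Iso.inv_hom_id_assoc, e₂]

end DistributiveLaws

variable {C : Type u} [Category.{v} C] [MonoidalCategory C] {S : SpanClass C}

/-! ### Precrossed modules as reflexive graphs -/

namespace PreXMod

variable (P : PreXMod S)

/-- The morphism `1 ⊗ u : Y ⟶ Y ⊗ B`, as a monoid morphism. -/
def inlHom : P.Y ⟶ P.A :=
  Mon.Hom.mk' (N := P.A) P.inl
    (by
      change MonObj.one ≫ (ρ_ P.Y.X).inv ≫ P.Y.X ◁ MonObj.one =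
        (λ_ (𝟙_ C)).inv ≫ (MonObj.one ⊗ₘ MonObj.one)
      rw [MonoidalCategory.tensorHom_def, rightUnitor_inv_naturality_assoc, unitors_inv_equal])
    (twistedMul_inl _ _ P.x _ (MonObj.one_mul _) P.distrib.one_left)

theorem inl_i_mul : (P.inl ⊗ₘ P.i.hom) ≫ P.A.mon.mul = 𝟙 P.A.X :=
  inl_inr_twistedMul _ _ P.x _ _ (MonObj.mul_one _) (MonObj.one_mul _) P.distrib.one_left

theorem i_inl_mul : (P.i.hom ⊗ₘ P.inl) ≫ P.A.mon.mul = P.x :=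
  inr_inl_twistedMul _ _ P.x _ _ (MonObj.one_mul _) (MonObj.mul_one _)

theorem tensor_mon_mul_comp {M N : Mon C} {X Y : C} (f : X ⟶ M.X) (g : Y ⟶ M.X) (h : M ⟶ N) :
    (f ⊗ₘ g) ≫ M.mon.mul ≫ h.hom = ((f ≫ h.hom) ⊗ₘ (g ≫ h.hom)) ≫ N.mon.mul :=
  tensor_mul_comp f g h.hom

theorem inl_s : P.inl ≫ P.s.hom = P.e ≫ MonObj.one := P.isRelPullback.w

variable {P} in
theorem hom_ext_A {D : Mon C} {f g : P.A ⟶ D} (h₁ : P.inlHom ≫ f = P.inlHom ≫ g)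
    (h₂ : P.i ≫ f = P.i ≫ g) : f = g :=
  mon_hom_ext_of_epi (p := P.inl) (i := P.i.hom) (by rw [inl_i_mul]; infer_instance)
    (congrArg Mon.Hom.hom h₁) (congrArg Mon.Hom.hom h₂)

section
variable {D : Mon C} (f : P.Y ⟶ D) (g : P.B ⟶ D)
  (w : P.x ≫ (f.hom ⊗ₘ g.hom) ≫ MonObj.mul = (g.hom ⊗ₘ f.hom) ≫ MonObj.mul)

@[simp] theorem inlHom_desc : P.inlHom ≫ twistedDesc P.distrib f g w = f := by
  ext
  change ((ρ_ P.Y.X).inv ≫ P.Y.X ◁ MonObj.one) ≫ (f.hom ⊗ₘ g.hom) ≫ MonObj.mul = f.hom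
  rw [Category.assoc, ← id_tensorHom, tensorHom_comp_tensorHom_assoc]
  simp

@[simp] theorem i_desc : P.i ≫ twistedDesc P.distrib f g w = g := by
  ext
  change ((λ_ P.B.X).inv ≫ MonObj.one ▷ P.B.X) ≫ (f.hom ⊗ₘ g.hom) ≫ MonObj.mul = g.hom
  rw [Category.assoc, ← tensorHom_id, tensorHom_comp_tensorHom_assoc]
  simp

end

@[simp] theorem inlHom_t : P.inlHom ≫ P.t = P.k := inlHom_desc P _ _ _

@[simp] theorem i_s : P.i ≫ P.s = 𝟙 P.B := P.graph.i_s

@[simp] theorem i_t : P.i ≫ P.t = 𝟙 P.B := P.graph.i_t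

variable {P} {Q : PreXMod S}

/-- The monoid morphism `y ⊗ b` induced by a morphism `(b, y)` of precrossed modules. -/
def mapA (f : P ⟶ Q) : P.A ⟶ Q.A :=
  twistedDesc P.distrib (f.y ≫ Q.inlHom) (f.b ≫ Q.i) (by
    have h : ((f.y.hom ≫ Q.inl) ⊗ₘ (f.b.hom ≫ Q.i.hom)) ≫ Q.A.mon.mul = f.y.hom ⊗ₘ f.b.hom := by
      rw [← tensorHom_comp_tensorHom, Category.assoc, inl_i_mul]
      exact Category.comp_id _
    have h' : ((f.b.hom ≫ Q.i.hom) ⊗ₘ (f.y.hom ≫ Q.inl)) ≫ Q.A.mon.mul =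
        (f.b.hom ⊗ₘ f.y.hom) ≫ Q.x := by
      rw [← tensorHom_comp_tensorHom, Category.assoc, i_inl_mul]
    exact (congrArg (P.x ≫ ·) h).trans (f.x_comm.trans h'.symm))

theorem inlHom_mapA (f : P ⟶ Q) : P.inlHom ≫ mapA f = f.y ≫ Q.inlHom := inlHom_desc P _ _ _

theorem i_mapA (f : P ⟶ Q) : P.i ≫ mapA f = f.b ≫ Q.i := i_desc P _ _ _

/-- The morphism of reflexive graphs induced by a morphism of precrossed modules. -/
def graphMap (f : P ⟶ Q) : P.graph ⟶ Q.graph where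
  a := mapA f
  b := f.b
  s_comm := by
    apply hom_ext_A
    · rw [reassoc_of% inlHom_mapA f]
      ext
      change P.inl ≫ P.s.hom ≫ f.b.hom = f.y.hom ≫ Q.inl ≫ Q.s.hom
      rw [inl_s, ← Category.assoc, inl_s, ← Category.assoc, f.e_comm, Category.assoc,
        IsMonHom.one_hom]
    · rw [reassoc_of% i_mapA f, i_s, ← Category.assoc, i_s, Category.id_comp, Category.comp_id]
  t_comm := by
    apply hom_ext_A
    · rw [reassoc_of% inlHom_mapA f, inlHom_t, ← Category.assoc, inlHom_t, f.k_comm]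
    · rw [reassoc_of% i_mapA f, i_t, ← Category.assoc, i_t, Category.id_comp, Category.comp_id]
  i_comm := i_mapA f

theorem mapA_id (P : PreXMod S) : mapA (𝟙 P) = 𝟙 P.A :=
  hom_ext_A ((inlHom_mapA (𝟙 P)).trans ((Category.id_comp _).trans (Category.comp_id _).symm))
    ((i_mapA (𝟙 P)).trans ((Category.id_comp _).trans (Category.comp_id _).symm))

theorem mapA_comp {R : PreXMod S} (f : P ⟶ Q) (g : Q ⟶ R) :
    mapA (f ≫ g) = mapA f ≫ mapA g := by
  apply hom_ext_A
  · rw [reassoc_of% inlHom_mapA f, inlHom_mapA, inlHom_mapA]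
    exact Category.assoc _ _ _
  · rw [reassoc_of% i_mapA f, i_mapA, i_mapA]
    exact Category.assoc _ _ _

/-- The functor taking a precrossed module to the associated reflexive graph. -/
def toGraph : PreXMod S ⥤ ReflGraph S where
  obj P := P.graph
  map f := graphMap f
  map_id P := ReflGraph.Hom.ext (mapA_id P) rfl
  map_comp f g := ReflGraph.Hom.ext (mapA_comp f g) rfl

instance : (toGraph : PreXMod S ⥤ ReflGraph S).Faithful where
  map_injective {P Q f g} h := by
    refine PreXMod.Hom.ext (congrArg ReflGraph.Hom.b h) ?_
    ext
    -- The component `y` is determined because `Y` is a relative pullback: its projection to `Y ⊗ B`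
    -- is fixed by the graph morphism, and its projection to `I` by compatibility with `e`.
    apply Q.isRelPullback.hom_ext
    · have h' : P.inlHom ≫ mapA f = P.inlHom ≫ mapA g :=
        congrArg (P.inlHom ≫ ·) (congrArg ReflGraph.Hom.a h)
      rw [inlHom_mapA, inlHom_mapA] at h'
      exact congrArg Mon.Hom.hom h'
    · exact f.e_comm.trans g.e_comm.symm

/-- The morphism `e`, as a monoid morphism. -/
def eHom (P : PreXMod S) : P.Y ⟶ Mon.trivial C :=
  Mon.Hom.mk (N := Mon.trivial C) P.e (isMonHom_hom := P.isMonHom_e)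

/-- A graph morphism preserves the kernels of `s`, which gives `y`; it preserves products, hence
equals `y ⊗ b`; and `x` is itself a product, hence is respected. -/
theorem exists_graphMap_eq (f : P.graph ⟶ Q.graph) : ∃ g : P ⟶ Q, graphMap g = f := by
  have f_s : P.s ≫ f.b = f.a ≫ Q.s := f.s_comm
  have f_t : P.t ≫ f.b = f.a ≫ Q.t := f.t_comm
  have f_i : P.i ≫ f.a = f.b ≫ Q.i := f.i_comm
  have H : IsRelPullback S Q.s.hom (unitHom Q.B).hom Q.inlHom.hom Q.eHom.hom := Q.isRelPullback
  obtain ⟨y, ⟨h₁, h₂⟩, -⟩ := H.existsUnique_mon (P.inlHom ≫ f.a) P.eHom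
    (by
      have h := S.post f.a.hom (𝟙 _) P.isRelPullback.mem
      rwa [Category.comp_id] at h) (by
      rw [Category.assoc, ← f_s]
      ext
      change P.inl ≫ P.s.hom ≫ f.b.hom = P.e ≫ MonObj.one
      rw [← Category.assoc, inl_s, Category.assoc, IsMonHom.one_hom])
  have h₁' : P.inl ≫ f.a.hom = y.hom ≫ Q.inl := congrArg Mon.Hom.hom h₁.symm
  have f_i' : P.i.hom ≫ f.a.hom = f.b.hom ≫ Q.i.hom := congrArg Mon.Hom.hom f_i
  -- The identity of `Y ⊗ B` is the product of the two embeddings, and `f.a` is known on each of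
  -- them.
  have hf : f.a.hom = y.hom ⊗ₘ f.b.hom := by
    rw [← Category.id_comp f.a.hom, ← P.inl_i_mul, Category.assoc, tensor_mon_mul_comp, h₁', f_i',
      ← tensorHom_comp_tensorHom, Category.assoc, inl_i_mul]
    exact Category.comp_id _
  let g : P ⟶ Q :=
    { b := f.b
      y := y
      e_comm := congrArg Mon.Hom.hom h₂
      k_comm := by
        rw [← inlHom_t, ← inlHom_t, Category.assoc, f_t, ← Category.assoc, ← h₁, Category.assoc]
      x_comm := by
        rw [← hf, ← P.i_inl_mul, Category.assoc, tensor_mon_mul_comp, h₁', f_i',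
          ← tensorHom_comp_tensorHom, Category.assoc, i_inl_mul] }
  refine ⟨g, ReflGraph.Hom.ext (hom_ext_A ?_ ?_) rfl⟩
  · exact (inlHom_mapA g).trans h₁
  · exact (i_mapA g).trans f_i.symm

end PreXMod

variable {C : Type u} [Category.{v} C] [MonoidalCategory C] {S : SpanClass C}

/-- Relative pullbacks are preserved by replacing the first object of the cospan by an isomorphic
one. -/
theorem IsRelPullback.of_iso {A A' B D P : C} {f : A ⟶ B} {g : D ⟶ B} {p : P ⟶ A} {q : P ⟶ D}
    (H : IsRelPullback S f g p q) (φ : A' ≅ A) {f' : A' ⟶ B} {p' : P ⟶ A'} (hf : φ.hom ≫ f = f')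
    (hp : p' ≫ φ.hom = p) : IsRelPullback S f' g p' q := by
  subst hf hp
  refine ⟨?_, ?_, ?_, ?_, ?_⟩
  · simpa using S.post φ.inv (𝟙 _) H.mem
  · simpa using H.w
  · intro T a d h w
    obtain ⟨k, ⟨h₁, h₂⟩, hu⟩ := H.existsUnique (a ≫ φ.hom) d
      (by simpa using S.post φ.hom (𝟙 _) h) (by simpa using w)
    refine ⟨k, ⟨by simpa [← cancel_mono φ.hom] using h₁, h₂⟩, ?_⟩
    rintro l ⟨rfl, rfl⟩
    exact hu l (by simp)
  · intro X T x h h₁ h₂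
    exact H.reflect_right x h (by simpa using S.post (𝟙 _) φ.hom h₁) h₂
  · intro X T h x h₁ h₂
    exact H.reflect_left h x (by simpa using S.post φ.hom (𝟙 _) h₁) h₂

variable [HasLegPullbacks S]

namespace ReflGraph

variable (G : ReflGraph S)

/-- Up to the identifications of `A^{□ 0}` with `B` and of `A^{□ 1}` with `A`, `q_1` is the
decomposition `Y ⊗ B ⟶ A`. -/
theorem ofB_comp_q_fst {Y : C} (p : Y ⟶ G.A.X) :
    (Y ◁ G.ofB.hom) ≫ G.q p 0 ≫ (G.fst 0).hom = (p ⊗ₘ G.i.hom) ≫ MonObj.mul := by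
  rw [q_comp, insertRest_fst, insertFirst_fst, ← id_tensorHom, tensorHom_comp_tensorHom_assoc,
    ← Mon.comp_hom', ofB_tgt_assoc]
  simp

variable {G} in
theorem isIso_tensor_mul_of_isIso_q {Y : C} {p : Y ⟶ G.A.X} (hq : IsIso (G.q p 0)) :
    IsIso ((p ⊗ₘ G.i.hom) ≫ MonObj.mul) := by
  have h : IsIso G.ofB := inferInstanceAs (IsIso (𝟙 G.B))
  rw [← ofB_comp_q_fst]
  infer_instance

variable {G} in
/-- A reflexive graph for which `q_1` is invertible is isomorphic to the one of a precrossed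
module. -/
theorem exists_preXMod {Y : Mon C} (r : Y ⟶ G.A) (e : Y.X ⟶ 𝟙_ C) (he : IsMonHom e)
    (H : IsRelPullback S G.s.hom (MonObj.one (X := G.B.X)) r.hom e)
    (hq : IsIso (G.q r.hom 0)) :
    ∃ (P : PreXMod S) (φ : P.graph ≅ G) (y : P.Y.X ≅ Y.X), P.inl ≫ φ.hom.a.hom = y.hom ≫ r.hom := by
  have hQ := isIso_tensor_mul_of_isIso_q hq
  -- The law is forced: it rewrites a product of `B` and `Y` in `A` as a product of `Y` and `B`.
  let x := ((G.i.hom ⊗ₘ r.hom) ≫ MonObj.mul) ≫ inv ((r.hom ⊗ₘ G.i.hom) ≫ MonObj.mul)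
  have hx : x ≫ (r.hom ⊗ₘ G.i.hom) ≫ MonObj.mul = (G.i.hom ⊗ₘ r.hom) ≫ MonObj.mul := by simp [x]
  have hr : r.hom ≫ G.s.hom = e ≫ MonObj.one := H.w
  have hi : G.i.hom ≫ G.s.hom = 𝟙 _ := congrArg Mon.Hom.hom G.i_s
  have hi' : G.i.hom ≫ G.t.hom = 𝟙 _ := congrArg Mon.Hom.hom G.i_t
  have h₁ : ((r.hom ⊗ₘ G.i.hom) ≫ MonObj.mul) ≫ G.s.hom = (e ▷ G.B.X) ≫ (λ_ G.B.X).hom := by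
    rw [Category.assoc, tensor_mul_comp, hr, hi, tensorHom_id, comp_whiskerRight, Category.assoc,
      MonObj.one_mul]
  have h₂ : ((G.i.hom ⊗ₘ r.hom) ≫ MonObj.mul) ≫ G.s.hom = (G.B.X ◁ e) ≫ (ρ_ G.B.X).hom := by
    rw [Category.assoc, tensor_mul_comp, hr, hi, id_tensorHom, whiskerLeft_comp, Category.assoc,
      MonObj.mul_one]
  have h₃ : ((r.hom ⊗ₘ G.i.hom) ≫ MonObj.mul) ≫ G.t.hom =
      ((r ≫ G.t).hom ▷ G.B.X) ≫ MonObj.mul := by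
    rw [Category.assoc, tensor_mul_comp, hi', tensorHom_id, Mon.comp_hom']
  have h₄ : ((G.i.hom ⊗ₘ r.hom) ≫ MonObj.mul) ≫ G.t.hom =
      (G.B.X ◁ (r ≫ G.t).hom) ≫ MonObj.mul := by
    rw [Category.assoc, tensor_mul_comp, hi', id_tensorHom, Mon.comp_hom']
  have h₅ : ((ρ_ Y.X).inv ≫ Y.X ◁ MonObj.one) ≫ (r.hom ⊗ₘ G.i.hom) ≫ MonObj.mul = r.hom := by
    rw [Category.assoc, ← id_tensorHom, tensorHom_comp_tensorHom_assoc]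
    simp
  let P : PreXMod S :=
    { B := G.B
      Y := Y
      e := e
      isMonHom_e := he
      k := r ≫ G.t
      x := x
      distrib := isDistribLaw_of_isIso r G.i hQ hx
      x_e := by rw [← h₁, ← h₂, ← Category.assoc, hx]
      x_k := by rw [← h₃, ← h₄, ← Category.assoc, hx]
      -- The first leg `1` is tested after the two projections of `Y`. This leaves the span of the
      -- pullback itself and the span `(e, e)`, which factors through `I`.
      mem_e := by
        apply H.reflect_left
        · simpa using H.mem
        · simpa using S.pre e (S.unital (𝟙 _) (𝟙 _))
      mem_k := by
        apply H.reflect_right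
        · simpa using S.pre r.hom G.mem_t
        · simpa using S.post G.t.hom (𝟙 _) H.mem
      mem_B := G.mem_id
      isRelPullback := H.of_iso (asIso ((r.hom ⊗ₘ G.i.hom) ≫ MonObj.mul)) h₁ h₅ }
  let a : P.A ⟶ G.A := twistedDesc P.distrib r G.i hx
  have ha : IsIso a := by
    have : IsIso ((Mon.forget C).map a) := hQ
    exact isIso_of_reflects_iso a (Mon.forget C)
  have hs : P.s = a ≫ G.s := by ext; exact h₁.symm
  have ht : P.t = a ≫ G.t := by
    ext
    exact (congrArg (· ≫ MonObj.mul) (tensorHom_id _ _)).trans h₃.symm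
  have hi : P.i ≫ a = G.i := P.i_desc _ _ _
  let φ : P.graph ≅ G :=
    { hom := ⟨a, 𝟙 _, (Category.comp_id _).trans hs, (Category.comp_id _).trans ht,
        hi.trans (Category.id_comp _).symm⟩
      inv := ⟨inv a, 𝟙 _, by rw [Category.comp_id, IsIso.eq_inv_comp]; exact hs.symm,
        by rw [Category.comp_id, IsIso.eq_inv_comp]; exact ht.symm,
        by rw [Category.id_comp, IsIso.comp_inv_eq]; exact hi.symm⟩
      hom_inv_id := ReflGraph.Hom.ext (IsIso.hom_inv_id a) (Category.comp_id _)
      inv_hom_id := ReflGraph.Hom.ext (IsIso.inv_hom_id a) (Category.comp_id _) }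
  exact ⟨P, φ, Iso.refl _, h₅.trans (Category.id_comp _).symm⟩

end ReflGraph

/-! ### Crossed modules as relative categories -/

namespace XMod

theorem exists_comp (P : XMod S) : ∃ d : P.obj.graph.pow 2 ⟶ P.obj.graph.A,
    P.obj.graph.insertRest 1 ≫ d = 𝟙 _ ∧ P.obj.graph.ofA ≫ P.obj.graph.insertFirst 1 ≫ d = 𝟙 _ :=
  (ReflGraph.peiffer_iff P.obj.inlHom P.property.isIso_q).1 P.property.peiffer

/-- The relative category associated to a crossed module. -/
noncomputable def relCat (P : XMod S) : RelCat S :=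
  P.obj.graph.relCatOfUnital P.obj.inl P.property.isIso_q P.exists_comp.choose
    P.exists_comp.choose_spec.1 P.exists_comp.choose_spec.2

/-- The functor taking a crossed module to the associated relative category. -/
noncomputable def toCatMon : XMod S ⥤ CatMon S where
  obj P := ⟨P.relCat, P.obj.Y.X, (show P.obj.Y.X ⟶ P.obj.A.X from P.obj.inl), P.obj.e,
    P.obj.isRelPullback, P.property.isIso_q⟩
  map {P Q} f := ObjectProperty.homMk
    { graph := PreXMod.graphMap f.hom
      d_comm := RelCat.d_comm_of_isIso_q (K := P.relCat) (L := Q.relCat) (P.property.isIso_q 1)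
        (PreXMod.graphMap f.hom) }
  map_id P := by
    apply ((isCatMon S).ι ⋙ RelCat.forget S).map_injective
    exact PreXMod.toGraph.map_id P.obj
  map_comp f g := by
    apply ((isCatMon S).ι ⋙ RelCat.forget S).map_injective
    exact PreXMod.toGraph.map_comp f.hom g.hom

instance : (toCatMon (S := S)).Faithful where
  map_injective {_ _ f g} h := by
    have h' : PreXMod.graphMap f.hom = PreXMod.graphMap g.hom :=
      congrArg (((isCatMon S).ι ⋙ RelCat.forget S).map ·) h
    exact ObjectProperty.hom_ext _ (PreXMod.toGraph.map_injective h')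

instance : (toCatMon (S := S)).Full where
  map_surjective {P Q} f := by
    obtain ⟨g, hg⟩ := PreXMod.exists_graphMap_eq (P := P.obj) (Q := Q.obj) f.hom.graph
    exact ⟨ObjectProperty.homMk g, ((isCatMon S).ι ⋙ RelCat.forget S).map_injective hg⟩

instance : (toCatMon (S := S)).EssSurj where
  mem_essImage K := by
    obtain ⟨_, _, _, H, hq⟩ := K.property
    obtain ⟨Y, r, e, H, hq⟩ := K.obj.exists_kernel H hq
    obtain ⟨P, φ, y, hy⟩ := ReflGraph.exists_preXMod r e.hom e.isMonHom_hom H (hq 0)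
    have hP : ∀ n, IsIso (P.graph.q P.inlHom.hom n) :=
      fun n => ReflGraph.isIso_q_of_iso φ y hy (hq n)
    -- The composition of `K` is carried along the isomorphism of graphs; its unit laws survive, and
    -- they imply the Peiffer condition.
    have hd : P.graph.Peiffer P.inlHom.hom := by
      refine (ReflGraph.peiffer_iff P.inlHom hP).2
        ⟨ReflGraph.powMap φ.hom 2 ≫ K.obj.d ≫ φ.inv.a, ?_, ?_⟩
      · rw [ReflGraph.insertRest_powMap_assoc, reassoc_of% K.obj.one_box_i_d]
        exact congrArg ReflGraph.Hom.a φ.hom_inv_id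
      · rw [ReflGraph.insertFirst_powMap_assoc, ReflGraph.ofA_powMap_assoc,
          reassoc_of% K.obj.i_box_one_d]
        exact congrArg ReflGraph.Hom.a φ.hom_inv_id
    let X : XMod S := ⟨P, hP, hd⟩
    -- An isomorphism of the underlying graphs suffices, because forgetting the composition is fully
    -- faithful on `CatMon`.
    let φ' : ((isCatMon S).ι ⋙ RelCat.forget S).obj (toCatMon.obj X) ≅
        ((isCatMon S).ι ⋙ RelCat.forget S).obj K := φ
    exact ⟨X, ⟨((isCatMon S).ι ⋙ RelCat.forget S).preimageIso φ'⟩⟩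

instance : (toCatMon (S := S)).IsEquivalence where

end XMod

end RelMon

/-- The categories `CatMon_S(C)` and `Simp¹Mon_S(C)` are equivalent, by the `S`-relative nerve in one
direction and by truncation at the degrees `0` and `1` in the other one; and both of them are
equivalent to `Xmod_S(C)`. -/
theorem theorem3p1 {C : Type u} [Category.{v} C] [MonoidalCategory C] (S : SpanClass C)
    [HasLegPullbacks S] :
    (∃ e : CatMon S ≌ SimpMon S,
      (∃ φ : ∀ K : CatMon S, K.obj.NerveIso (e.functor.obj K).obj,
        ∀ (K L : CatMon S) (f : K ⟶ L) (n : ℕ),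
          (e.functor.map f).hom.app (Opposite.op (SimplexCategory.mk n)) ≫ ((φ L).iso n).hom =
            ((φ K).iso n).hom ≫ ReflGraph.powMap ((RelCat.forget S).map f.hom) n) ∧
      Nonempty (e.inverse ⋙ (isCatMon S).ι ⋙ RelCat.forget S ≅ SimpMon.trunc S)) ∧
    Nonempty (CatMon S ≌ XMod S) ∧ Nonempty (SimpMon S ≌ XMod S) :=
  ⟨CatMon.exists_nerve_equivalence S, ⟨(XMod.toCatMon (S := S)).asEquivalence.symm⟩,
    ⟨(CatMon.nerve S).asEquivalence.symm.trans (XMod.toCatMon (S := S)).asEquivalence.symm⟩⟩
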